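/- **Setting.** Formulas are those of many-sorted second-order logic with equality (between terms of equal sort), with first-order variables, function variables of type $(w,\sigma)$ and relation variables of type $w$, for $w$ a word of sorts and $\sigma$ a sort. Structures have a nonempty universe for each sort, and these universes are pairwise disjoint. Let $\Sigma$ be a *pure* signature with finitely many sorts $\sigma_0$ (foreground), $\sigma_1,\dots,\sigma_k$ (background, $k\ge 0$) and at most countably many function and relation symbols: the type of every symbol is over a single sort, and no symbol involves $\sigma_0$. An *EQSMT sentence* over $\Sigma$ is a sentence (all first-order, function and relation variables are quantified) consisting of a block of existential quantifiers, followed by a block of universal quantifiers, followed by a quantifier-free formula. In the existential block, the first-order variables may have any sort, the relation variables have a type in $\sigma_0^+$, and the function variables have a type $(w,\sigma_i)$ with $w\in\sigma_0^+$ and $1\le i\le k$. In the universal block, the first-order variables may have any sort, and the relation and function variables may have arbitrary types $w'$ and $(w',\sigma)$, where $w'$ is a nonempty word of sorts and $\sigma$ is a sort. For $1\le i\le k$ let $T_{\sigma_i}$ be an arbitrary (possibly infinite) set of first-order sentences over the sort $\sigma_i$ alone. A sentence is $T$-satisfiable if some structure satisfies it and all sentences of $T$. **Theorem 1.** If, for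 each $1\le i\le k$, it is decidable whether a given first-order $\exists^*\forall^*$ sentence over the sort $\sigma_i$ alone is $T_{\sigma_i}$-satisfiable, then it is decidable whether a given EQSMT sentence is $\bigcup_{i=1}^k T_{\sigma_i}$-satisfiable. Moreover, there is a single procedure, independent of the theories $T_{\sigma_i}$, that decides this with finitely many black-box calls: from an EQSMT sentence it computes a finite list of calls, each one asking the solver for some $T_{\sigma_i}$ about an $\exists^*\forall^*$ first-order sentence over $\sigma_i$, and from the answers to these calls it computes whether the EQSMT sentence is $\bigcup_{i=1}^k T_{\sigma_i}$-satisfiable. -/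

import Mathlib

universe u

namespace EQSMT

/-- The sorts: `0` is the foreground sort, and `1, …, k` are the background sorts. -/
abbrev Srt (k : ℕ) : Type := Fin (k + 1)

/-- Tuples of type `w` over a family of universes indexed by the sorts. -/
abbrev Tuple {k : ℕ} (A : Srt k → Type u) (w : List (Srt k)) : Type u :=
  ∀ j : Fin w.length, A (w.get j)

/-- A many-sorted signature over the sorts `Srt k`: its function symbols of each type `(w, σ)`
(constants are the case `w = []`) and its relation symbols of each type `w`, `w` nonempty. -/
structure Signature (k : ℕ) where
  Func : List (Srt k) → Srt k → Type
  Rel : List (Srt k) → Type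
  rel_nil : IsEmpty (Rel [])

/-- A pure signature: every symbol is over a single sort, and that sort is a background sort. -/
def Signature.IsPure {k : ℕ} (S : Signature k) : Prop :=
  (∀ w σ, Nonempty (S.Func w σ) → σ ≠ 0 ∧ ∀ τ ∈ w, τ = σ) ∧
  (∀ w, Nonempty (S.Rel w) → ∃ σ, σ ≠ 0 ∧ ∀ τ ∈ w, τ = σ)

/-- Variables with their types: for each type there are infinitely many names `n : ℕ`.
`fo σ n` is a first-order variable of sort `σ`, `fn w σ n` a function variable of type `(w, σ)`,
and `rel w n` a relation variable of type `w`. -/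
inductive Var (k : ℕ) : Type
  | fo (σ : Srt k) (n : ℕ)
  | fn (w : List (Srt k)) (σ : Srt k) (n : ℕ)
  | rel (w : List (Srt k)) (n : ℕ)
  deriving DecidableEq

/-- Terms of each sort. `app` applies a function symbol, `fapp` a function variable. -/
inductive Term {k : ℕ} (S : Signature k) : Srt k → Type
  | var (σ : Srt k) (n : ℕ) : Term S σ
  | app {w : List (Srt k)} {σ : Srt k} (f : S.Func w σ)
      (args : ∀ j : Fin w.length, Term S (w.get j)) : Term S σ
  | fapp (w : List (Srt k)) (σ : Srt k) (n : ℕ)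
      (args : ∀ j : Fin w.length, Term S (w.get j)) : Term S σ

/-- Formulas of many-sorted second-order logic. `ratom` is an atom of a relation symbol, `rapp`
an atom of a relation variable; `ex` and `all` quantify over variables of all three kinds. -/
inductive Formula {k : ℕ} (S : Signature k) : Type
  | bot : Formula S
  | imp (φ ψ : Formula S) : Formula S
  | eq {σ : Srt k} (s t : Term S σ) : Formula S
  | ratom {w : List (Srt k)} (R : S.Rel w)
      (args : ∀ j : Fin w.length, Term S (w.get j)) : Formula S
  | rapp (w : List (Srt k)) (n : ℕ)
      (args : ∀ j : Fin w.length, Term S (w.get j)) : Formula S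
  | ex (v : Var k) (φ : Formula S) : Formula S
  | all (v : Var k) (φ : Formula S) : Formula S

section Semantics

/-- A many-sorted structure: a family of nonempty universes (disjoint by typing), and an
interpretation of the symbols. -/
structure Model {k : ℕ} (S : Signature k) where
  carrier : Srt k → Type u
  nonempty : ∀ σ, Nonempty (carrier σ)
  func : ∀ {w : List (Srt k)} {σ : Srt k}, S.Func w σ → Tuple carrier w → carrier σ
  rel : ∀ {w : List (Srt k)}, S.Rel w → Tuple carrier w → Prop

/-- The objects over which a variable ranges. -/
def Var.Domain {k : ℕ} (A : Srt k → Type u) : Var k → Type u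
  | .fo σ _ => A σ
  | .fn w σ _ => Tuple A w → A σ
  | .rel w _ => Tuple A w → Prop

/-- Interpretations of all variables. -/
abbrev Valuation {k : ℕ} (A : Srt k → Type u) : Type u :=
  ∀ v : Var k, v.Domain A

/-- The value of a term. -/
def Term.eval {k : ℕ} {S : Signature k} (M : Model.{u} S) (ρ : Valuation M.carrier) :
    {σ : Srt k} → Term S σ → M.carrier σ
  | _, .var σ n => ρ (.fo σ n)
  | _, .app f args => M.func f fun j => (args j).eval M ρ
  | _, .fapp w σ n args =>
      (show Tuple M.carrier w → M.carrier σ from ρ (.fn w σ n)) fun j => (args j).eval M ρ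

/-- Satisfaction of a formula in a structure under an interpretation of the variables. -/
def Formula.Holds {k : ℕ} {S : Signature k} (M : Model.{u} S) :
    Valuation M.carrier → Formula S → Prop
  | _, .bot => False
  | ρ, .imp φ ψ => φ.Holds M ρ → ψ.Holds M ρ
  | ρ, .eq s t => s.eval M ρ = t.eval M ρ
  | ρ, .ratom R args => M.rel R fun j => (args j).eval M ρ
  | ρ, .rapp w n args =>
      (show Tuple M.carrier w → Prop from ρ (.rel w n)) fun j => (args j).eval M ρ
  | ρ, .ex v φ => ∃ a : v.Domain M.carrier, φ.Holds M (Function.update ρ v a)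
  | ρ, .all v φ => ∀ a : v.Domain M.carrier, φ.Holds M (Function.update ρ v a)

/-- `M ⊨ φ`. -/
def Model.Satisfies {k : ℕ} {S : Signature k} (M : Model.{u} S) (φ : Formula S) : Prop :=
  ∀ ρ : Valuation M.carrier, φ.Holds M ρ

/-- `φ` is `T`-satisfiable. When `T` and `φ` only involve one sort, the other sorts of the
structure play no role: they can always be filled in with one-point universes. -/
def Satisfiable {k : ℕ} {S : Signature k} (T : Set (Formula S)) (φ : Formula S) : Prop :=
  ∃ M : Model.{u} S, (∀ α ∈ T, M.Satisfies α) ∧ M.Satisfies φ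

end Semantics

section Fragments

/-- The (first-order and function) variables of a term. -/
def Term.vars {k : ℕ} {S : Signature k} : {σ : Srt k} → Term S σ → Set (Var k)
  | _, .var σ n => {.fo σ n}
  | _, .app _ args => ⋃ j, (args j).vars
  | _, .fapp w σ n args => {.fn w σ n} ∪ ⋃ j, (args j).vars

/-- The free variables (of all kinds) of a formula. -/
def Formula.freeVars {k : ℕ} {S : Signature k} : Formula S → Set (Var k)
  | .bot => ∅
  | .imp φ ψ => φ.freeVars ∪ ψ.freeVars
  | .eq s t => s.vars ∪ t.vars
  | .ratom _ args => ⋃ j, (args j).vars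
  | .rapp w n args => {.rel w n} ∪ ⋃ j, (args j).vars
  | .ex v φ => φ.freeVars \ {v}
  | .all v φ => φ.freeVars \ {v}

/-- A sentence: all variables are quantified. -/
def Formula.IsSentence {k : ℕ} {S : Signature k} (φ : Formula S) : Prop :=
  φ.freeVars = ∅

/-- First-order terms that only involve the sort `σ`. -/
def Term.IsOver {k : ℕ} {S : Signature k} (σ : Srt k) : {τ : Srt k} → Term S τ → Prop
  | _, .var τ _ => τ = σ
  | τ, .app (w := w) _ args => τ = σ ∧ (∀ υ ∈ w, υ = σ) ∧ ∀ j, (args j).IsOver σ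
  | _, .fapp _ _ _ _ => False

/-- First-order formulas that only involve the sort `σ`. -/
def Formula.IsOver {k : ℕ} {S : Signature k} (σ : Srt k) : Formula S → Prop
  | .bot => True
  | .imp φ ψ => φ.IsOver σ ∧ ψ.IsOver σ
  | .eq s t => s.IsOver σ ∧ t.IsOver σ
  | .ratom (w := w) _ args => (∀ υ ∈ w, υ = σ) ∧ ∀ j, (args j).IsOver σ
  | .rapp _ _ _ => False
  | .ex v φ => (∃ n, v = .fo σ n) ∧ φ.IsOver σ
  | .all v φ => (∃ n, v = .fo σ n) ∧ φ.IsOver σ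

/-- Quantifier-free formulas; they may contain variables of all three kinds. -/
def Formula.IsQF {k : ℕ} {S : Signature k} : Formula S → Prop
  | .imp φ ψ => φ.IsQF ∧ ψ.IsQF
  | .ex _ _ => False
  | .all _ _ => False
  | _ => True

/-- `∀* ψ` with `ψ` quantifier-free, over first-order, function and relation variables of all
sorts. -/
inductive Formula.IsUniversal {k : ℕ} {S : Signature k} : Formula S → Prop
  | qf {φ : Formula S} : φ.IsQF → Formula.IsUniversal φ
  | fo (σ : Srt k) (n : ℕ) {φ : Formula S} :
      Formula.IsUniversal φ → Formula.IsUniversal (.all (.fo σ n) φ)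
  | rel {w : List (Srt k)} (hw : w ≠ []) (n : ℕ) {φ : Formula S} :
      Formula.IsUniversal φ → Formula.IsUniversal (.all (.rel w n) φ)
  | fn {w : List (Srt k)} (hw : w ≠ []) (σ : Srt k) (n : ℕ) {φ : Formula S} :
      Formula.IsUniversal φ → Formula.IsUniversal (.all (.fn w σ n) φ)

/-- `∃* ∀* ψ` with `ψ` quantifier-free; existential relation variables range over the foreground
sort, and existential function variables map tuples of the foreground sort to a background
sort. -/
inductive Formula.HasEQSMTForm {k : ℕ} {S : Signature k} : Formula S → Prop
  | univ {φ : Formula S} : φ.IsUniversal → Formula.HasEQSMTForm φ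
  | fo (σ : Srt k) (n : ℕ) {φ : Formula S} :
      Formula.HasEQSMTForm φ → Formula.HasEQSMTForm (.ex (.fo σ n) φ)
  | rel {w : List (Srt k)} (hw : w ≠ []) (hw₀ : ∀ τ ∈ w, τ = 0) (n : ℕ) {φ : Formula S} :
      Formula.HasEQSMTForm φ → Formula.HasEQSMTForm (.ex (.rel w n) φ)
  | fn {w : List (Srt k)} (hw : w ≠ []) (hw₀ : ∀ τ ∈ w, τ = 0) {σ : Srt k} (hσ : σ ≠ 0) (n : ℕ)
      {φ : Formula S} :
      Formula.HasEQSMTForm φ → Formula.HasEQSMTForm (.ex (.fn w σ n) φ)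

/-- The EQSMT sentences over `S`. -/
def eqsmtSentences {k : ℕ} (S : Signature k) : Set (Formula S) :=
  {φ | φ.HasEQSMTForm ∧ φ.IsSentence}

/-- `∀* ψ` with `ψ` quantifier-free, over first-order variables. -/
inductive Formula.IsForall {k : ℕ} {S : Signature k} : Formula S → Prop
  | qf {φ : Formula S} : φ.IsQF → Formula.IsForall φ
  | all (σ : Srt k) (n : ℕ) {φ : Formula S} :
      Formula.IsForall φ → Formula.IsForall (.all (.fo σ n) φ)

/-- `∃* ∀* ψ` with `ψ` quantifier-free, over first-order variables. -/
inductive Formula.IsExistsForall {k : ℕ} {S : Signature k} : Formula S → Prop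
  | univ {φ : Formula S} : φ.IsForall → Formula.IsExistsForall φ
  | ex (σ : Srt k) (n : ℕ) {φ : Formula S} :
      Formula.IsExistsForall φ → Formula.IsExistsForall (.ex (.fo σ n) φ)

/-- The first-order `∃*∀*` sentences over the single sort `σ`. -/
def efSentences {k : ℕ} (S : Signature k) (σ : Srt k) : Set (Formula S) :=
  {φ | φ.IsExistsForall ∧ φ.IsOver σ ∧ φ.IsSentence}

/-- An uninterpreted combination of theories: for each background sort an arbitrary set of
first-order sentences over that sort. -/
structure UCT {k : ℕ} (S : Signature k) where
  theory : Fin k → Set (Formula S)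
  isOver : ∀ i, ∀ α ∈ theory i, α.IsOver i.succ
  isSentence : ∀ i, ∀ α ∈ theory i, α.IsSentence

/-- The union of the theories of the background sorts. -/
def UCT.union {k : ℕ} {S : Signature k} (T : UCT S) : Set (Formula S) :=
  ⋃ i, T.theory i

end Fragments

section Coding

open Encodable

/-- The Gödel number of a variable. -/
def Var.code {k : ℕ} : Var k → ℕ
  | .fo σ n => Nat.pair 0 (Nat.pair (encode σ) n)
  | .fn w σ n => Nat.pair 1 (Nat.pair (encode (w, σ)) n)
  | .rel w n => Nat.pair 2 (Nat.pair (encode w) n)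

/-- The Gödel number of a term, relative to numberings of the symbols of each type. -/
def Term.code {k : ℕ} {S : Signature k} [∀ w σ, Encodable (S.Func w σ)] :
    {σ : Srt k} → Term S σ → ℕ
  | _, .var σ n => Nat.pair 0 (Nat.pair (encode σ) n)
  | σ, .app (w := w) f args =>
      Nat.pair 1 (Nat.pair (encode (w, σ))
        (Nat.pair (encode f) (encode (List.ofFn fun j => (args j).code))))
  | _, .fapp w σ n args =>
      Nat.pair 2 (Nat.pair (encode (w, σ))
        (Nat.pair n (encode (List.ofFn fun j => (args j).code))))

/-- The Gödel number of a formula, relative to numberings of the symbols of each type. -/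
def Formula.code {k : ℕ} {S : Signature k} [∀ w σ, Encodable (S.Func w σ)]
    [∀ w, Encodable (S.Rel w)] : Formula S → ℕ
  | .bot => Nat.pair 0 0
  | .imp φ ψ => Nat.pair 1 (Nat.pair φ.code ψ.code)
  | .eq (σ := σ) s t => Nat.pair 2 (Nat.pair (encode σ) (Nat.pair s.code t.code))
  | .ratom (w := w) R args =>
      Nat.pair 3 (Nat.pair (encode w)
        (Nat.pair (encode R) (encode (List.ofFn fun j => (args j).code))))
  | .rapp w n args =>
      Nat.pair 4 (Nat.pair (encode w)
        (Nat.pair n (encode (List.ofFn fun j => (args j).code))))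
  | .ex v φ => Nat.pair 5 (Nat.pair v.code φ.code)
  | .all v φ => Nat.pair 6 (Nat.pair v.code φ.code)

theorem Var.code_injective {k : ℕ} : Function.Injective (Var.code (k := k)) := by
  intro v v' h
  cases v <;> cases v' <;> simp_all [Var.code, Nat.pair_eq_pair, -encode_prod_val]

theorem Term.code_injective {k : ℕ} {S : Signature k} [∀ w σ, Encodable (S.Func w σ)]
    {σ : Srt k} : Function.Injective (Term.code (S := S) (σ := σ)) := by
  intro s
  induction s with
  | var σ n =>
    intro t h
    cases t <;> simp_all [Term.code, Nat.pair_eq_pair, -encode_prod_val]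
  | app f args ih =>
    intro t h
    cases t with
    | var => simp [Term.code, Nat.pair_eq_pair] at h
    | fapp => simp [Term.code, Nat.pair_eq_pair] at h
    | app g args' =>
      simp only [Term.code, Nat.pair_eq_pair, encode_inj, Prod.mk.injEq, true_and,
        and_true] at h
      obtain ⟨rfl, h₂, h₃⟩ := h
      obtain rfl := encode_inj.1 h₂
      congr 1
      funext j
      exact ih j (congrFun (List.ofFn_injective h₃) j)
  | fapp w σ n args ih =>
    intro t h
    cases t with
    | var => simp [Term.code, Nat.pair_eq_pair] at h
    | app => simp [Term.code, Nat.pair_eq_pair] at h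
    | fapp w' _ n' args' =>
      simp only [Term.code, Nat.pair_eq_pair, encode_inj, Prod.mk.injEq, true_and,
        and_true] at h
      obtain ⟨rfl, rfl, h₃⟩ := h
      congr 1
      funext j
      exact ih j (congrFun (List.ofFn_injective h₃) j)

/-- Different formulas have different Gödel numbers. -/
theorem Formula.code_injective {k : ℕ} {S : Signature k} [∀ w σ, Encodable (S.Func w σ)]
    [∀ w, Encodable (S.Rel w)] : Function.Injective (Formula.code (S := S)) := by
  intro φ
  induction φ with
  | bot => intro χ h; cases χ <;> simp_all [Formula.code, Nat.pair_eq_pair]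
  | imp φ ψ ih₁ ih₂ =>
    intro χ h
    cases χ <;> simp [Formula.code, Nat.pair_eq_pair] at h
    rw [ih₁ h.1, ih₂ h.2]
  | eq s t =>
    intro χ h
    cases χ <;> simp only [Formula.code, Nat.pair_eq_pair, encode_inj] at h <;> try omega
    obtain ⟨-, rfl, h₁, h₂⟩ := h
    rw [Term.code_injective h₁, Term.code_injective h₂]
  | ratom R args =>
    intro χ h
    cases χ <;> simp only [Formula.code, Nat.pair_eq_pair, encode_inj] at h <;> try omega
    obtain ⟨-, rfl, h₁, h₂⟩ := h
    obtain rfl := encode_inj.1 h₁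
    congr 1
    funext j
    exact Term.code_injective (congrFun (List.ofFn_injective h₂) j)
  | rapp w n args =>
    intro χ h
    cases χ <;> simp only [Formula.code, Nat.pair_eq_pair, encode_inj] at h <;> try omega
    obtain ⟨-, rfl, rfl, h₂⟩ := h
    congr 1
    funext j
    exact Term.code_injective (congrFun (List.ofFn_injective h₂) j)
  | ex v φ ih =>
    intro χ h
    cases χ <;> simp [Formula.code, Nat.pair_eq_pair] at h
    rw [Var.code_injective h.1, ih h.2]
  | all v φ ih =>
    intro χ h
    cases χ <;> simp [Formula.code, Nat.pair_eq_pair] at h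
    rw [Var.code_injective h.1, ih h.2]

end Coding

section Decidability

/-- `f` solves `T`-satisfiability of the sentences in `F`: given the Gödel number of a sentence
in `F`, it answers whether this sentence is `T`-satisfiable. -/
def IsSolver {k : ℕ} {S : Signature k} [∀ w σ, Encodable (S.Func w σ)] [∀ w, Encodable (S.Rel w)]
    (T F : Set (Formula S)) (f : ℕ → Bool) : Prop :=
  ∀ φ ∈ F, f φ.code = true ↔ Satisfiable.{u} T φ

/-- `T`-satisfiability of the sentences in `F` is decidable. -/
def SatDecidable {k : ℕ} {S : Signature k} [∀ w σ, Encodable (S.Func w σ)]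
    [∀ w, Encodable (S.Rel w)] (T F : Set (Formula S)) : Prop :=
  ∃ f : ℕ → Bool, Computable f ∧ IsSolver.{u} T F f

/-- A decision procedure that makes black-box calls to `k` solvers: from the input it computes the
finite list of its calls (the number of a solver and the input for it), and from the input and
the answers to these calls it computes its own answer. -/
structure BlackBoxProcedure (k : ℕ) where
  calls : ℕ → List (Fin k × ℕ)
  answer : ℕ → List Bool → Bool
  computable_calls : Computable calls
  computable_answer : Computable₂ answer

/-- The answer of the procedure on input `n` when it is run with the given solvers. -/
def BlackBoxProcedure.run {k : ℕ} (P : BlackBoxProcedure k) (solver : Fin k → ℕ → Bool) (n : ℕ) :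
    Bool :=
  P.answer n ((P.calls n).map fun c => solver c.1 c.2)

end Decidability

end EQSMT

/-! Fix an EQSMT sentence with Gödel number `n` and interpret its existential variables. Whether a
choice of the universal variables falsifies the matrix depends only on finite data: the truth values
of the subformulas, which background subterms of equal sort coincide, and which foreground element
each foreground subterm denotes. An assignment `a` records such data as one number per node of the
syntax tree (`val`). `Consistent` imposes the laws that need no background structure: the
connectives, congruence for function and relation variables (Ackermann's reduction), and the values
of the existential foreground and relation variables.

The foreground can be kept small. No symbol involves it and existential functions map into the
background, so at most `n + 1` elements suffice, enough for the values of the existential foreground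
variables. An existential relation is then a finite table, which can be guessed, and an existential
function becomes a finite family of first-order existential variables, one for each `key`, that is,
a function variable together with the labels of its arguments.

The background sorts separate. As the signature is pure, a consistent assignment is realised by some
choice of the universal variables as soon as it is realised in each background sort separately.
Hence the sentence holds if and only if every consistent falsifying assignment is unrealisable in
some sort: a universally quantified disjunction whose disjuncts share no variables is a disjunction
of universally quantified statements. A guess `γ` consists of the size of the foreground, the
tables, and the sorts that are to exclude each assignment (`Handles`). `Covers` tests that no
falsifying assignment is left over. What remains for one sort is whether its theory has a model with
values for the keys such that no values of the nodes realise an assignment handled by this sort.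
This is an `∃*∀*` sentence, whose code is `codeCall` and whose meaning is `exists_codeCall`.

From a successful guess, `satisfiable_of_covers` glues the models of the separate theories along a
finite foreground. Conversely, `exists_covers_of_satisfies` reads a guess off a model. There are
finitely many guesses, bounded primitive recursively in `n`, so all calls can be listed in advance.
-/

namespace EQSMT

/-! ### Closure properties of primitive recursive functions and predicates -/

section PrimrecTools

variable {α β σ : Type*} [Primcodable α] [Primcodable β] [Primcodable σ]

theorem primrec_unpair_fst {f : α → ℕ} (hf : Primrec f) : Primrec fun a => (f a).unpair.1 :=
  Primrec.fst.comp (Primrec.unpair.comp hf)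

theorem primrec_unpair_snd {f : α → ℕ} (hf : Primrec f) : Primrec fun a => (f a).unpair.2 :=
  Primrec.snd.comp (Primrec.unpair.comp hf)

theorem primrec_natPair {f g : α → ℕ} (hf : Primrec f) (hg : Primrec g) :
    Primrec fun a => Nat.pair (f a) (g a) :=
  Primrec₂.natPair.comp hf hg

theorem primrec_natPow {f g : α → ℕ} (hf : Primrec f) (hg : Primrec g) :
    Primrec fun a => f a ^ g a :=
  (Primrec₂.unpaired'.1 Nat.Primrec.pow).comp hf hg

theorem primrecPred_forall_mem {l : α → List β} {p : α → β → Prop} (hl : Primrec l)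
    (hp : PrimrecPred fun x : α × β => p x.1 x.2) : PrimrecPred fun a => ∀ b ∈ l a, p a b := by
  have h : PrimrecRel fun (b : β) (a : α) => p a b :=
    PrimrecPred.comp (f := fun x : β × α => (x.2, x.1)) hp (Primrec.snd.pair Primrec.fst)
  exact (PrimrecRel.forall_mem_list h).comp hl Primrec.id

theorem primrecPred_exists_mem {l : α → List β} {p : α → β → Prop} (hl : Primrec l)
    (hp : PrimrecPred fun x : α × β => p x.1 x.2) : PrimrecPred fun a => ∃ b ∈ l a, p a b := by
  have h : PrimrecRel fun (b : β) (a : α) => p a b :=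
    PrimrecPred.comp (f := fun x : β × α => (x.2, x.1)) hp (Primrec.snd.pair Primrec.fst)
  exact (PrimrecRel.exists_mem_list h).comp hl Primrec.id

theorem primrecPred_imp {p q : α → Prop} (hp : PrimrecPred p) (hq : PrimrecPred q) :
    PrimrecPred fun a => p a → q a :=
  (hp.not.or hq).of_eq fun _ => by tauto

theorem primrecPred_iff {p q : α → Prop} (hp : PrimrecPred p) (hq : PrimrecPred q) :
    PrimrecPred fun a => (p a ↔ q a) :=
  ((primrecPred_imp hp hq).and (primrecPred_imp hq hp)).of_eq fun _ => by tauto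

theorem primrecPred_eq {f g : α → β} (hf : Primrec f) (hg : Primrec g) :
    PrimrecPred fun a => f a = g a :=
  Primrec.eq.comp hf hg

theorem primrecPred_lt {f g : α → ℕ} (hf : Primrec f) (hg : Primrec g) :
    PrimrecPred fun a => f a < g a :=
  Primrec.nat_lt.comp hf hg

theorem primrecPred_le {f g : α → ℕ} (hf : Primrec f) (hg : Primrec g) :
    PrimrecPred fun a => f a ≤ g a :=
  Primrec.nat_le.comp hf hg

theorem primrec_list_map {l : α → List β} {f : α → β → σ} (hl : Primrec l)
    (hf : Primrec fun x : α × β => f x.1 x.2) : Primrec fun a => (l a).map fun b => f a b :=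
  Primrec.list_map hl hf

theorem primrec_list_flatMap {l : α → List β} {f : α → β → List σ} (hl : Primrec l)
    (hf : Primrec fun x : α × β => f x.1 x.2) : Primrec fun a => (l a).flatMap fun b => f a b :=
  Primrec.list_flatMap hl hf

theorem primrec_add {f g : α → ℕ} (hf : Primrec f) (hg : Primrec g) :
    Primrec fun a => f a + g a := Primrec.nat_add.comp hf hg

theorem primrec_mul {f g : α → ℕ} (hf : Primrec f) (hg : Primrec g) :
    Primrec fun a => f a * g a := Primrec.nat_mul.comp hf hg

theorem primrec_div {f g : α → ℕ} (hf : Primrec f) (hg : Primrec g) :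
    Primrec fun a => f a / g a := Primrec.nat_div.comp hf hg

theorem primrec_mod {f g : α → ℕ} (hf : Primrec f) (hg : Primrec g) :
    Primrec fun a => f a % g a := Primrec.nat_mod.comp hf hg

theorem primrec_append {f g : α → List β} (hf : Primrec f) (hg : Primrec g) :
    Primrec fun a => f a ++ g a := Primrec.list_append.comp hf hg

theorem primrec_cons {f : α → β} {g : α → List β} (hf : Primrec f) (hg : Primrec g) :
    Primrec fun a => f a :: g a := Primrec.list_cons.comp hf hg

theorem primrec_range {f : α → ℕ} (hf : Primrec f) :
    Primrec fun a => List.range (f a) := Primrec.list_range.comp hf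

theorem primrec_encode {f : α → List ℕ} (hf : Primrec f) :
    Primrec fun a => Encodable.encode (f a) := Primrec.encode.comp hf

theorem primrec_fst {f : α → β × σ} (hf : Primrec f) : Primrec fun a => (f a).1 :=
  Primrec.fst.comp hf

theorem primrec_snd {f : α → β × σ} (hf : Primrec f) : Primrec fun a => (f a).2 :=
  Primrec.snd.comp hf

theorem primrec_getD {f : α → List ℕ} {g : α → ℕ} (hf : Primrec f) (hg : Primrec g) :
    Primrec fun a => (f a).getD (g a) 0 := (Primrec.list_getD 0).comp hf hg

theorem primrec_sum {f : α → List ℕ} (hf : Primrec f) : Primrec fun a => (f a).sum :=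
  (Primrec.list_foldr (h := fun _ (x : ℕ × ℕ) => x.1 + x.2) hf (Primrec.const 0)
    ((Primrec.nat_add.comp Primrec.fst Primrec.snd).comp Primrec.snd).to₂).of_eq fun _ => rfl

end PrimrecTools

/-! ### Syntax trees, assignments and guesses as arithmetic on Gödel numbers -/

section Nodes

open Classical

/-- The list of numbers with a given code. -/
noncomputable def listOf (c : ℕ) : List ℕ := (Encodable.decode c : Option (List ℕ)).getD []

/-- The first component of the data of a node. -/
def typ (p : ℕ) : ℕ := (p / 2).unpair.2.unpair.1

/-- The second component of the data of a node. -/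
def arg (p : ℕ) : ℕ := (p / 2).unpair.2.unpair.2

/-- A *node* is `2 * c` for the code `c` of a term or `2 * c + 1` for the code `c` of a formula.
The tag of a node tells by which constructor it is built: `0`, `1`, `2` for `var`, `app`, `fapp`
and `3`, …, `9` for `bot`, `imp`, `eq`, `ratom`, `rapp`, `ex`, `all`. -/
noncomputable def tag (p : ℕ) : ℕ :=
  if p % 2 = 0 then (p / 2).unpair.1 else (p / 2).unpair.1 + 3

/-- The nodes of the immediate subterms and subformulas. -/
noncomputable def children (p : ℕ) : List ℕ :=
  if tag p = 1 ∨ tag p = 2 ∨ tag p = 6 ∨ tag p = 7 then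
    (listOf (arg p).unpair.2).map fun c => 2 * c
  else if tag p = 4 then [2 * typ p + 1, 2 * arg p + 1]
  else if tag p = 5 then [2 * (arg p).unpair.1, 2 * (arg p).unpair.2]
  else if tag p = 8 ∨ tag p = 9 then [2 * arg p + 1]
  else []

/-- The outermost symbol or variable of a node, with its type. -/
noncomputable def headSym (p : ℕ) : ℕ :=
  if tag p = 0 then p / 2 else Nat.pair (tag p) (Nat.pair (typ p) (arg p).unpair.1)

/-- The sort of a term, or the sort of the arguments of an atom of a relation symbol. -/
noncomputable def sortOf (p : ℕ) : ℕ :=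
  if tag p = 0 then typ p
  else if tag p = 1 ∨ tag p = 2 then (typ p).unpair.2
  else if tag p = 6 then (listOf (typ p)).headI
  else 0

/-- The code of the outermost variable of a node. -/
noncomputable def headVar (p : ℕ) : ℕ :=
  if tag p = 0 then p / 2
  else if tag p = 2 then Nat.pair 1 (Nat.pair (typ p) (arg p).unpair.1)
  else Nat.pair 2 (Nat.pair (typ p) (arg p).unpair.1)

/-- The nodes reachable from the formula with code `n`. -/
noncomputable def nodes (n : ℕ) : List ℕ :=
  (fun l : List ℕ => l ++ l.flatMap fun p => children p)^[n] [2 * n + 1]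

/-- The codes of the universally quantified variables of the formula with code `n`. -/
noncomputable def univs (n : ℕ) : List ℕ :=
  (nodes n).flatMap fun p => if tag p = 9 then [typ p] else []

/-- The node is an application of an existential variable. -/
def IsEx (n p : ℕ) : Prop := (tag p = 0 ∨ tag p = 2 ∨ tag p = 7) ∧ ¬ ∃ v ∈ univs n, v = headVar p

/-- The digit of `a` at place `j` in base `B`. -/
def digit (B a j : ℕ) : ℕ := a / B ^ j % B

/-- Exceeds every value in use: background terms are labelled by nodes, at most `2 * n + 1`,
foreground elements by numbers at most `n`, and truth values by `0` or `1`. -/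
def base (n : ℕ) : ℕ := 2 * n + 3

/-- An assignment has one digit for each number below `2 * n + 2`, a range that contains all nodes.
-/
def numAssign (n : ℕ) : ℕ := base n ^ (2 * n + 2)

/-- The value that the assignment `a` gives to the node `p`. -/
def val (n a p : ℕ) : ℕ := digit (base n) a p

/-- The outermost symbol of a node together with the values of its children. -/
noncomputable def key (n a p : ℕ) : ℕ :=
  Nat.pair (headSym p) (Encodable.encode ((children p).map fun q => val n a q))

/-- A finite supply of names for the table entries of the existential variables, whatever values
their arguments take. -/
noncomputable def keys (n : ℕ) : List ℕ :=
  (List.range (numAssign n)).flatMap fun a => (nodes n).map fun p => key n a p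

/-- The size of the foreground universe according to the guess `γ`. -/
def fgSize (γ : ℕ) : ℕ := γ.unpair.1

/-- The values of the existential foreground and relation variables according to the guess `γ`. -/
def fgVal (n γ x : ℕ) : ℕ := digit (base n) γ.unpair.2.unpair.1 x

/-- The assignment `a` is handled by the sort `s` according to the guess `γ`. -/
def Handles (k γ a s : ℕ) : Prop := digit 2 γ.unpair.2.unpair.2 (a * (k + 1) + s) = 1

/-- The node `p` obeys the local laws of evaluation under the assignment `a`. -/
def Local (n γ a p : ℕ) : Prop :=
  (tag p ≤ 2 → sortOf p = 0 → val n a p < fgSize γ) ∧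
  (tag p = 2 ∨ tag p = 7 → ∀ q ∈ nodes n, key n a q = key n a p → val n a q = val n a p) ∧
  (tag p = 3 → val n a p = 0) ∧
  (tag p = 4 → (val n a p ≠ 0 ↔
    (val n a ((children p).getD 0 0) ≠ 0 → val n a ((children p).getD 1 0) ≠ 0))) ∧
  (tag p = 5 → (val n a p ≠ 0 ↔
    val n a ((children p).getD 0 0) = val n a ((children p).getD 1 0))) ∧
  (tag p = 8 ∨ tag p = 9 → val n a p = val n a ((children p).getD 0 0)) ∧
  (IsEx n p → tag p = 0 → sortOf p = 0 → val n a p = fgVal n γ (key n a p) % fgSize γ) ∧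
  (IsEx n p → tag p = 7 → (val n a p ≠ 0 ↔ fgVal n γ (key n a p) ≠ 0))

/-- The part of realisability that can be tested without a solver. Congruence is demanded for
function and relation variables only; for the symbols of the signature it comes from the background
structure, through `Describes`. -/
def Consistent (n γ a : ℕ) : Prop := ∀ p ∈ nodes n, Local n γ a p

/-- The guess `γ` handles every consistent assignment that falsifies the formula. -/
def Covers (k n γ : ℕ) : Prop :=
  0 < fgSize γ ∧ fgSize γ ≤ n + 1 ∧ ∀ a ∈ List.range (numAssign n), Consistent n γ a →
    val n a (2 * n + 1) = 0 →
    ∃ s ∈ List.range k, Handles k γ a (s + 1)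

end Nodes

/-! ### Gödel numbers of the emitted sentences, and the procedure -/

section Output

open Classical

def codeBot : ℕ := Nat.pair 0 0
def codeImp (a b : ℕ) : ℕ := Nat.pair 1 (Nat.pair a b)
def codeTop : ℕ := codeImp codeBot codeBot
def codeVar (s x : ℕ) : ℕ := Nat.pair 0 (Nat.pair s x)
def codeEq (s a b : ℕ) : ℕ := Nat.pair 2 (Nat.pair s (Nat.pair a b))

/-- The code of the negation of the conjunction of a list of formulas. -/
def codeNegConj (l : List ℕ) : ℕ := l.foldr (fun a b => codeImp a b) codeBot

noncomputable def codeLit (P : Prop) (a : ℕ) : ℕ := if P then a else codeImp a codeBot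

noncomputable def codeArgs (s p : ℕ) : ℕ :=
  Encodable.encode ((children p).map fun q => codeVar s (2 * q))

/-- The literal that compares the nodes `p` and `q` of sort `s` under the assignment `a`. -/
noncomputable def codeCompare (n s a p q : ℕ) : ℕ :=
  if (tag p ≤ 2 ∧ sortOf p = s) ∧ tag q ≤ 2 ∧ sortOf q = s then
    codeLit (val n a p = val n a q) (codeEq s (codeVar s (2 * p)) (codeVar s (2 * q)))
  else codeTop

/-- The literal that describes the node `p` in terms of its children under the assignment `a`. -/
noncomputable def codeDescribe (n s a p : ℕ) : ℕ :=
  if sortOf p = s then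
    if tag p = 1 then
      codeEq s (codeVar s (2 * p))
        (Nat.pair 1 (Nat.pair (typ p) (Nat.pair (arg p).unpair.1 (codeArgs s p))))
    else if tag p = 6 then
      codeLit (val n a p ≠ 0)
        (Nat.pair 3 (Nat.pair (typ p) (Nat.pair (arg p).unpair.1 (codeArgs s p))))
    else if IsEx n p then
      codeEq s (codeVar s (2 * p)) (codeVar s (2 * key n a p + 1))
    else codeTop
  else codeTop

/-- Together these literals say that, within the sort `s`, the node variables realise the assignment
`a`. -/
noncomputable def codeLits (n s a : ℕ) : List ℕ :=
  (nodes n).flatMap fun p => codeDescribe n s a p :: (nodes n).map fun q => codeCompare n s a p q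

/-- The outer negation cancels the one in `codeNegConj`. The result is a conjunction which says that
no handled consistent assignment is realised. -/
noncomputable def codeMatrix (k n γ s : ℕ) : ℕ :=
  codeImp (codeNegConj ((List.range (numAssign n)).map fun a =>
    if Handles k γ a s ∧ Consistent n γ a then codeNegConj (codeLits n s a) else codeTop)) codeBot

def codeQuant (t s : ℕ) (l : List ℕ) (c : ℕ) : ℕ :=
  l.foldr (fun x d => Nat.pair t (Nat.pair (codeVar s x) d)) c

/-- The code of the `∃*∀*` sentence of sort `s` for the guess `γ`. -/
noncomputable def codeCall (k n γ s : ℕ) : ℕ :=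
  codeQuant 5 s ((keys n).map fun x => 2 * x + 1)
    (codeQuant 6 s ((nodes n).map fun p => 2 * p) (codeMatrix k n γ s))

/-- A bound for the guesses that have to be considered. -/
noncomputable def numGuess (k n : ℕ) : ℕ :=
  Nat.pair (n + 2) (Nat.pair (base n ^ ((keys n).sum + 1)) (2 ^ (numAssign n * (k + 1)))) + 1

/-- All guesses are queried, so the list of calls does not depend on any answer. -/
noncomputable def callsOf (k n : ℕ) : List (Fin k × ℕ) :=
  (List.range (numGuess k n)).flatMap fun γ =>
    (List.finRange k).map fun i => (i, codeCall k n γ (i + 1))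

/-- An answer is looked up by the content of its call. Repeated calls do no harm, since a solver
answers equal calls equally. -/
noncomputable def answerOf (k n : ℕ) (l : List Bool) : Bool :=
  decide (∃ γ ∈ List.range (numGuess k n), Covers k n γ ∧
    ∀ i ∈ List.finRange k, ∃ c ∈ (callsOf k n).zip l, c = ((i, codeCall k n γ (i + 1)), true))

end Output

/-! ### Computability of the procedure -/

section Primrec

open Classical

-- With the closure properties as rules, `fun_prop` proves each arithmetic definition above
-- primitive recursive once it is unfolded; iterations and folds are treated by hand.
attribute [fun_prop] Primrec PrimrecPred
attribute [fun_prop] Primrec.const Primrec.id Primrec.comp Primrec.pair primrec_fst primrec_snd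
  primrec_natPair primrec_natPow primrec_unpair_fst primrec_unpair_snd primrec_add primrec_mul
  primrec_div primrec_mod primrec_append primrec_list_map primrec_cons primrec_range
  primrec_encode primrec_getD primrec_sum primrec_list_flatMap primrecPred_forall_mem
  primrecPred_exists_mem primrecPred_eq primrecPred_le primrecPred_lt
  PrimrecPred.and PrimrecPred.or PrimrecPred.not primrecPred_iff primrecPred_imp Primrec.ite

variable {α : Type*} [Primcodable α]

@[fun_prop]
theorem primrec_listOf {f : α → ℕ} (hf : Primrec f) : Primrec fun a => listOf (f a) :=
  Primrec.option_getD.comp (Primrec.decode.comp hf) (Primrec.const [])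

@[fun_prop]
theorem primrec_headI {f : α → List ℕ} (hf : Primrec f) : Primrec fun a => (f a).headI :=
  Primrec.list_headI.comp hf

@[fun_prop]
theorem primrec_typ {f : α → ℕ} (hf : Primrec f) : Primrec fun a => typ (f a) := by
  unfold typ; fun_prop

@[fun_prop]
theorem primrec_arg {f : α → ℕ} (hf : Primrec f) : Primrec fun a => arg (f a) := by
  unfold arg; fun_prop

@[fun_prop]
theorem primrec_tag {f : α → ℕ} (hf : Primrec f) : Primrec fun a => tag (f a) := by
  unfold tag; fun_prop

@[fun_prop]
theorem primrec_children {f : α → ℕ} (hf : Primrec f) : Primrec fun a => children (f a) := by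
  unfold children; fun_prop

@[fun_prop]
theorem primrec_headSym {f : α → ℕ} (hf : Primrec f) : Primrec fun a => headSym (f a) := by
  unfold headSym; fun_prop

@[fun_prop]
theorem primrec_sortOf {f : α → ℕ} (hf : Primrec f) : Primrec fun a => sortOf (f a) := by
  unfold sortOf; fun_prop

@[fun_prop]
theorem primrec_headVar {f : α → ℕ} (hf : Primrec f) : Primrec fun a => headVar (f a) := by
  unfold headVar; fun_prop

@[fun_prop]
theorem primrec_nodes {f : α → ℕ} (hf : Primrec f) : Primrec fun a => nodes (f a) :=
  Primrec.nat_iterate (h := fun _ (l : List ℕ) => l ++ l.flatMap fun p => children p) hf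
    (g := fun a => [2 * f a + 1]) (by fun_prop) (by unfold Primrec₂; fun_prop)

@[fun_prop]
theorem primrec_univs {f : α → ℕ} (hf : Primrec f) : Primrec fun a => univs (f a) := by
  unfold univs; fun_prop

@[fun_prop]
theorem primrecPred_isEx {f g : α → ℕ} (hf : Primrec f) (hg : Primrec g) :
    PrimrecPred fun a => IsEx (f a) (g a) := by
  unfold IsEx; fun_prop

@[fun_prop]
theorem primrec_digit {f g h : α → ℕ} (hf : Primrec f) (hg : Primrec g) (hh : Primrec h) :
    Primrec fun a => digit (f a) (g a) (h a) := by
  unfold digit; fun_prop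

@[fun_prop]
theorem primrec_base {f : α → ℕ} (hf : Primrec f) : Primrec fun a => base (f a) := by
  unfold base; fun_prop

@[fun_prop]
theorem primrec_numAssign {f : α → ℕ} (hf : Primrec f) : Primrec fun a => numAssign (f a) := by
  unfold numAssign; fun_prop

@[fun_prop]
theorem primrec_val {f g h : α → ℕ} (hf : Primrec f) (hg : Primrec g) (hh : Primrec h) :
    Primrec fun a => val (f a) (g a) (h a) := by
  unfold val; fun_prop

@[fun_prop]
theorem primrec_key {f g h : α → ℕ} (hf : Primrec f) (hg : Primrec g) (hh : Primrec h) :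
    Primrec fun a => key (f a) (g a) (h a) := by
  unfold key; fun_prop

@[fun_prop]
theorem primrec_keys {f : α → ℕ} (hf : Primrec f) : Primrec fun a => keys (f a) := by
  unfold keys; fun_prop

@[fun_prop]
theorem primrec_fgSize {f : α → ℕ} (hf : Primrec f) : Primrec fun a => fgSize (f a) := by
  unfold fgSize; fun_prop

@[fun_prop]
theorem primrec_fgVal {f g h : α → ℕ} (hf : Primrec f) (hg : Primrec g) (hh : Primrec h) :
    Primrec fun a => fgVal (f a) (g a) (h a) := by
  unfold fgVal; fun_prop

@[fun_prop]
theorem primrecPred_handles (k : ℕ) {f g h : α → ℕ} (hf : Primrec f) (hg : Primrec g)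
    (hh : Primrec h) : PrimrecPred fun a => Handles k (f a) (g a) (h a) := by
  unfold Handles; fun_prop

@[fun_prop]
theorem primrecPred_local {f g h i : α → ℕ} (hf : Primrec f) (hg : Primrec g) (hh : Primrec h)
    (hi : Primrec i) : PrimrecPred fun a => Local (f a) (g a) (h a) (i a) := by
  unfold Local; fun_prop

@[fun_prop]
theorem primrecPred_consistent {f g h : α → ℕ} (hf : Primrec f) (hg : Primrec g)
    (hh : Primrec h) : PrimrecPred fun a => Consistent (f a) (g a) (h a) := by
  unfold Consistent; fun_prop

@[fun_prop]
theorem primrecPred_covers (k : ℕ) {f g : α → ℕ} (hf : Primrec f) (hg : Primrec g) :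
    PrimrecPred fun a => Covers k (f a) (g a) := by
  unfold Covers; fun_prop

@[fun_prop]
theorem primrec_codeImp {f g : α → ℕ} (hf : Primrec f) (hg : Primrec g) :
    Primrec fun a => codeImp (f a) (g a) := by
  unfold codeImp; fun_prop

@[fun_prop]
theorem primrec_codeVar {f g : α → ℕ} (hf : Primrec f) (hg : Primrec g) :
    Primrec fun a => codeVar (f a) (g a) := by
  unfold codeVar; fun_prop

@[fun_prop]
theorem primrec_codeEq {f g h : α → ℕ} (hf : Primrec f) (hg : Primrec g) (hh : Primrec h) :
    Primrec fun a => codeEq (f a) (g a) (h a) := by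
  unfold codeEq; fun_prop

@[fun_prop]
theorem primrec_codeNegConj {f : α → List ℕ} (hf : Primrec f) :
    Primrec fun a => codeNegConj (f a) :=
  Primrec.list_foldr (h := fun _ (x : ℕ × ℕ) => codeImp x.1 x.2) hf (Primrec.const codeBot)
    (by unfold Primrec₂; fun_prop)

@[fun_prop]
theorem primrec_codeLit {P : α → Prop} {f : α → ℕ} (hP : PrimrecPred P) (hf : Primrec f) :
    Primrec fun a => codeLit (P a) (f a) := by
  unfold codeLit; fun_prop

@[fun_prop]
theorem primrec_codeArgs {f g : α → ℕ} (hf : Primrec f) (hg : Primrec g) :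
    Primrec fun a => codeArgs (f a) (g a) := by
  unfold codeArgs; fun_prop

@[fun_prop]
theorem primrec_codeCompare {f g h i j : α → ℕ} (hf : Primrec f) (hg : Primrec g)
    (hh : Primrec h) (hi : Primrec i) (hj : Primrec j) :
    Primrec fun a => codeCompare (f a) (g a) (h a) (i a) (j a) := by
  unfold codeCompare; fun_prop

@[fun_prop]
theorem primrec_codeDescribe {f g h i : α → ℕ} (hf : Primrec f) (hg : Primrec g)
    (hh : Primrec h) (hi : Primrec i) :
    Primrec fun a => codeDescribe (f a) (g a) (h a) (i a) := by
  unfold codeDescribe; fun_prop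

@[fun_prop]
theorem primrec_codeLits {f g h : α → ℕ} (hf : Primrec f) (hg : Primrec g) (hh : Primrec h) :
    Primrec fun a => codeLits (f a) (g a) (h a) := by
  unfold codeLits; fun_prop

@[fun_prop]
theorem primrec_codeMatrix (k : ℕ) {f g h : α → ℕ} (hf : Primrec f) (hg : Primrec g)
    (hh : Primrec h) : Primrec fun a => codeMatrix k (f a) (g a) (h a) := by
  unfold codeMatrix; fun_prop

@[fun_prop]
theorem primrec_codeQuant (t : ℕ) {f g : α → ℕ} {l : α → List ℕ} (hf : Primrec f)
    (hl : Primrec l) (hg : Primrec g) : Primrec fun a => codeQuant t (f a) (l a) (g a) :=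
  Primrec.list_foldr
    (h := fun a (x : ℕ × ℕ) => Nat.pair t (Nat.pair (codeVar (f a) x.1) x.2)) hl hg
    (by unfold Primrec₂; fun_prop)

@[fun_prop]
theorem primrec_codeCall (k : ℕ) {f g h : α → ℕ} (hf : Primrec f) (hg : Primrec g)
    (hh : Primrec h) : Primrec fun a => codeCall k (f a) (g a) (h a) := by
  unfold codeCall; fun_prop

@[fun_prop]
theorem primrec_numGuess (k : ℕ) {f : α → ℕ} (hf : Primrec f) :
    Primrec fun a => numGuess k (f a) := by
  unfold numGuess; fun_prop

@[fun_prop]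
theorem primrec_finVal {k : ℕ} {f : α → Fin k} (hf : Primrec f) :
    Primrec fun a => (f a : ℕ) := Primrec.fin_val.comp hf

@[fun_prop]
theorem primrec_callsOf (k : ℕ) {f : α → ℕ} (hf : Primrec f) :
    Primrec fun a => callsOf k (f a) := by
  unfold callsOf; fun_prop

@[fun_prop]
theorem primrec_zip {β γ : Type*} [Primcodable β] [Primcodable γ] {f : α → List β}
    {g : α → List γ} (hf : Primrec f) (hg : Primrec g) :
    Primrec fun a => (f a).zip (g a) := by
  -- Zipping amounts to collecting, over the indices of the first list, those pairs of entries that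
  -- are both defined.
  have h : Primrec fun a => (List.range (f a).length).flatMap fun j =>
      (Option.map₂ Prod.mk ((f a)[j]?) ((g a)[j]?)).toList := by
    refine primrec_list_flatMap (primrec_range (Primrec.list_length.comp hf))
      (Primrec.optionToList.comp ?_)
    have h₁ : Primrec fun x : α × ℕ => (f x.1)[x.2]? :=
      Primrec.list_getElem?.comp (hf.comp Primrec.fst) Primrec.snd
    have h₂ : Primrec fun x : α × ℕ => (g x.1)[x.2]? :=
      Primrec.list_getElem?.comp (hg.comp Primrec.fst) Primrec.snd
    refine (Primrec.option_bind h₁ (Primrec.option_map (h₂.comp Primrec.fst)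
      ((Primrec.snd.comp Primrec.fst).pair Primrec.snd).to₂).to₂).of_eq fun x => ?_
    cases h₁ : (f x.1)[x.2]? <;> cases h₂ : (g x.1)[x.2]? <;> simp [h₂]
  refine h.of_eq fun a => ?_
  generalize f a = l
  generalize g a = m
  clear h hf hg
  induction l generalizing m with
  | nil => simp
  | cons x l ih =>
    cases m with
    | nil => simp
    | cons y m =>
      simp only [List.length_cons, List.range_succ_eq_map, List.flatMap_cons, List.flatMap_map,
        List.getElem?_cons_succ, List.zip_cons_cons, ← ih]
      simp

theorem computable_answerOf (k : ℕ) : Computable₂ (answerOf k) := by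
  refine Primrec₂.to_comp ?_
  have h : PrimrecPred fun x : ℕ × List Bool => ∃ γ ∈ List.range (numGuess k x.1),
      Covers k x.1 γ ∧ ∀ i ∈ List.finRange k, ∃ c ∈ (callsOf k x.1).zip x.2,
        c = ((i, codeCall k x.1 γ (i + 1)), true) := by
    refine primrecPred_exists_mem (by fun_prop) (PrimrecPred.and (by fun_prop)
      (primrecPred_forall_mem (Primrec.const _) (primrecPred_exists_mem ?_ ?_)))
    · exact primrec_zip (primrec_callsOf k (Primrec.fst.comp (Primrec.fst.comp Primrec.fst)))
        (Primrec.snd.comp (Primrec.fst.comp Primrec.fst))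
    · have hi : Primrec fun x : (((ℕ × List Bool) × ℕ) × Fin k) × (Fin k × ℕ) × Bool => x.1.2 :=
        Primrec.snd.comp Primrec.fst
      have hγ : Primrec fun x : (((ℕ × List Bool) × ℕ) × Fin k) × (Fin k × ℕ) × Bool =>
        x.1.1.2 := Primrec.snd.comp (Primrec.fst.comp Primrec.fst)
      have hn : Primrec fun x : (((ℕ × List Bool) × ℕ) × Fin k) × (Fin k × ℕ) × Bool =>
        x.1.1.1.1 := Primrec.fst.comp (Primrec.fst.comp (Primrec.fst.comp Primrec.fst))
      exact primrecPred_eq Primrec.snd (Primrec.pair (Primrec.pair hi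
        (primrec_codeCall k hn hγ (primrec_add (primrec_finVal hi) (Primrec.const 1))))
        (Primrec.const true))
  refine Primrec₂.mk (h.decide.of_eq fun x => ?_)
  rw [answerOf]

/-- The decision procedure for EQSMT sentences. -/
noncomputable def procedure (k : ℕ) : BlackBoxProcedure k where
  calls := callsOf k
  answer := answerOf k
  computable_calls := (primrec_callsOf k Primrec.id).to_comp
  computable_answer := computable_answerOf k

/-- Zipping the calls with their answers tags each call with the reply to it, and the calls of every
guess in range are in the list. -/
theorem procedure_run_eq_true {k : ℕ} {solver : Fin k → ℕ → Bool} {n : ℕ} :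
    (procedure k).run solver n = true ↔ ∃ γ < numGuess k n, Covers k n γ ∧
      ∀ i : Fin k, solver i (codeCall k n γ (i + 1)) = true := by
  have hz : (callsOf k n).zip ((callsOf k n).map fun c => solver c.1 c.2) =
      (callsOf k n).map fun c => (c, solver c.1 c.2) := by
    generalize callsOf k n = l
    induction l with
    | nil => rfl
    | cons a l ih => simp [ih]
  simp only [BlackBoxProcedure.run, procedure, answerOf, hz, decide_eq_true_eq, List.mem_range,
    List.mem_finRange, true_imp_iff, exists_eq_right]
  refine exists_congr fun γ => and_congr_right fun hγ => and_congr_right fun _ =>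
    forall_congr' fun i => ?_
  simp only [List.mem_map, Prod.mk.injEq]
  constructor
  · rintro ⟨c, -, rfl, h⟩
    exact h
  · intro h
    refine ⟨(i, codeCall k n γ (i + 1)), ?_, rfl, h⟩
    simp only [callsOf, List.mem_flatMap, List.mem_range, List.mem_map, List.mem_finRange,
      true_and]
    exact ⟨γ, hγ, i, rfl⟩

/-- The solvers are computable but need not be primitive recursive, so the mapped list is built by
recursion on the number of entries already treated. -/
theorem computable_list_map {β γ : Type*} [Primcodable β] [Primcodable γ] {f : α → List β}
    {g : β → γ} (hf : Computable f) (hg : Computable g) : Computable fun a => (f a).map g := by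
  have h : Computable fun a => Nat.rec (motive := fun _ => List γ) []
      (fun j l => l ++ (((f a)[j]?).map g).toList) (f a).length := by
    have h₂ : Computable fun y : α × (ℕ × List γ) =>
        y.2.2 ++ (((f y.1)[y.2.1]?).map g).toList :=
      Computable.list_append.comp (Computable.snd.comp Computable.snd)
        (Primrec.optionToList.to_comp.comp (Computable.option_map
          (Computable.list_getElem?.comp (hf.comp Computable.fst)
            (Computable.fst.comp Computable.snd)) (hg.comp Computable.snd).to₂))
    exact Computable.nat_rec (h := fun a (x : ℕ × List γ) =>
      x.2 ++ (((f a)[x.1]?).map g).toList) (Computable.list_length.comp hf) (Computable.const [])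
      (Computable₂.mk h₂)
  refine h.of_eq fun a => ?_
  have : ∀ (l : List β) (j : ℕ), j ≤ l.length → Nat.rec (motive := fun _ => List γ) []
      (fun j m => m ++ ((l[j]?).map g).toList) j = (l.take j).map g := by
    intro l j hj
    induction j with
    | zero => simp
    | succ j ih =>
      have hj' : j < l.length := hj
      simp only [ih hj'.le, List.take_add_one, List.map_append, hj', List.getElem?_eq_getElem]
      simp
  rw [this _ _ le_rfl, List.take_length]

theorem computable_run {k : ℕ} (P : BlackBoxProcedure k) {solver : Fin k → ℕ → Bool}
    (hs : ∀ i, Computable (solver i)) : Computable (P.run solver) := by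
  -- Finitely many computable functions are jointly computable: tabulate their values in a vector
  -- and select an entry.
  have hF : Computable fun c : Fin k × ℕ => solver c.1 c.2 :=
    (Computable.vector_get.comp ((Computable.vector_ofFn hs).comp Computable.snd)
      Computable.fst).of_eq fun c => by simp
  exact P.computable_answer.comp Computable.id (computable_list_map P.computable_calls hF)

end Primrec

/-! ### Descent in the syntax tree -/

section Decoding

open Encodable

theorem listOf_encode (l : List ℕ) : listOf (encode l) = l := by
  have : (decode (encode l) : Option (List ℕ)) = some l := encodek l
  simp only [listOf]
  exact congrArg (fun o => Option.getD o []) this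

theorem encode_fin {n : ℕ} (i : Fin n) : encode i = (i : ℕ) := rfl

theorem encode_list_fin {n : ℕ} (w : List (Fin n)) : encode w = encode (w.map Fin.val) := by
  induction w with
  | nil => rfl
  | cons a w ih => simp [encode_list_cons, ih, encode_fin]

theorem listOf_encode_fin {n : ℕ} (w : List (Fin n)) : listOf (encode w) = w.map Fin.val := by
  rw [encode_list_fin, listOf_encode]

theorem lt_encode_of_mem {l : List ℕ} {a : ℕ} (h : a ∈ l) : a < encode l := by
  induction l with
  | nil => simp at h
  | cons b l ih =>
    rw [encode_list_cons]
    rcases List.mem_cons.1 h with rfl | h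
    · exact Nat.lt_succ_of_le (Nat.left_le_pair _ _)
    · exact (ih h).trans (Nat.lt_succ_of_le (Nat.right_le_pair _ _))

theorem lt_of_mem_listOf {c a : ℕ} (h : a ∈ listOf c) : a < c := by
  unfold listOf at h
  cases hd : (decode c : Option (List ℕ)) with
  | none => rw [hd] at h; simp at h
  | some l =>
    rw [hd] at h
    have h₂ : encode l = c := by
      have := Denumerable.decode_eq_ofNat (List ℕ) c
      have h₃ := hd.symm.trans this
      rw [Option.some_inj] at h₃
      rw [h₃]
      exact Denumerable.encode_ofNat c
    exact h₂ ▸ lt_encode_of_mem h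

theorem unpair_snd_lt {c : ℕ} (h : c.unpair.1 ≠ 0) : c.unpair.2 < c := by
  conv_rhs => rw [← Nat.pair_unpair c]
  have := Nat.pair_lt_pair_left c.unpair.2 (Nat.pos_of_ne_zero h)
  exact (Nat.right_le_pair _ _).trans_lt this

/-- Children are read off from the second component of a pair, which is smaller than the pair when
the first component is nonzero. Among nodes with a known tag, the first component vanishes only for
tags `0` and `3`, which have no children. -/
theorem child_lt {p q : ℕ} (h : q ∈ children p) : q / 2 < p / 2 := by
  have key : (p / 2).unpair.1 ≠ 0 → typ p < p / 2 ∧ arg p < p / 2 := fun h =>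
    ⟨(Nat.unpair_left_le _).trans_lt (unpair_snd_lt h),
      (Nat.unpair_right_le _).trans_lt (unpair_snd_lt h)⟩
  have ht : tag p ≠ 0 → tag p ≠ 3 → (p / 2).unpair.1 ≠ 0 := by
    unfold tag
    split_ifs <;> omega
  unfold children at h
  split_ifs at h with h₁ h₂ h₃ h₄
  · obtain ⟨c, hc, rfl⟩ := List.mem_map.1 h
    have h₅ := (lt_of_mem_listOf hc).trans_le (Nat.unpair_right_le _)
    have := key (ht (by omega) (by omega))
    omega
  · have := key (ht (by omega) (by omega))
    simp only [List.mem_cons, List.not_mem_nil, or_false] at h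
    omega
  · have := key (ht (by omega) (by omega))
    have h₅ := Nat.unpair_left_le (arg p)
    have h₆ := Nat.unpair_right_le (arg p)
    simp only [List.mem_cons, List.not_mem_nil, or_false] at h
    omega
  · have := key (ht (by omega) (by omega))
    simp only [List.mem_cons, List.not_mem_nil, or_false] at h
    omega
  · simp at h

theorem mem_iterate_children_mono {n i i' q : ℕ} (hi : i ≤ i')
    (h : q ∈ (fun l : List ℕ => l ++ l.flatMap fun p => children p)^[i] [2 * n + 1]) :
    q ∈ (fun l : List ℕ => l ++ l.flatMap fun p => children p)^[i'] [2 * n + 1] := by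
  induction hi with
  | refl => exact h
  | step _ ih =>
    rw [Function.iterate_succ_apply']
    exact List.mem_append_left _ ih

/-- Each step down lowers `p / 2`, which starts at `n`, so `p` appears after at most `n - p / 2`
rounds. Hence the `n` rounds in `nodes` reach everything. -/
theorem mem_nodes_aux (n : ℕ) {j p : ℕ}
    (h : p ∈ (fun l : List ℕ => l ++ l.flatMap fun p => children p)^[j] [2 * n + 1]) :
    p / 2 ≤ n ∧
      p ∈ (fun l : List ℕ => l ++ l.flatMap fun p => children p)^[n - p / 2] [2 * n + 1] := by
  induction j generalizing p with
  | zero =>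
    simp only [Function.iterate_zero, id, List.mem_singleton] at h
    have h₁ : p / 2 = n := by omega
    rw [h₁]
    simp [h]
  | succ j ih =>
    rw [Function.iterate_succ_apply'] at h
    rcases List.mem_append.1 h with h | h
    · exact ih h
    · obtain ⟨q, hq, hp⟩ := List.mem_flatMap.1 h
      have h₁ := ih hq
      have h₂ := child_lt hp
      refine ⟨by omega, mem_iterate_children_mono (i := n - q / 2 + 1) (by omega) ?_⟩
      rw [Function.iterate_succ_apply']
      exact List.mem_append_right _ (List.mem_flatMap.2 ⟨q, h₁.2, hp⟩)

theorem root_mem_nodes (n : ℕ) : 2 * n + 1 ∈ nodes n :=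
  mem_iterate_children_mono (i := 0) (Nat.zero_le n) (by simp)

theorem child_mem_nodes {n p q : ℕ} (hp : p ∈ nodes n) (hq : q ∈ children p) : q ∈ nodes n := by
  have h₁ := mem_nodes_aux n hp
  have h₂ : q ∈ (fun l : List ℕ => l ++ l.flatMap fun p => children p)^[n - p / 2 + 1]
      [2 * n + 1] := by
    rw [Function.iterate_succ_apply']
    exact List.mem_append_right _ (List.mem_flatMap.2 ⟨p, h₁.2, hq⟩)
  have h₃ := (mem_nodes_aux n h₂).2
  have h₄ := child_lt hq
  exact mem_iterate_children_mono (by omega) h₃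

theorem lt_of_mem_nodes {n p : ℕ} (hp : p ∈ nodes n) : p < 2 * n + 2 := by
  have := (mem_nodes_aux n hp).1
  omega

/-- The nodes satisfy every property that is inherited by children and holds for the root. -/
theorem nodes_induction {n : ℕ} {P : ℕ → Prop} (h₀ : P (2 * n + 1))
    (hs : ∀ p q, P p → q ∈ children p → P q) {p : ℕ} (hp : p ∈ nodes n) : P p := by
  have : ∀ (j : ℕ), ∀ p ∈ (fun l : List ℕ => l ++ l.flatMap fun p => children p)^[j] [2 * n + 1],
      P p := by
    intro j
    induction j with
    | zero =>
      intro p hp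
      simp only [Function.iterate_zero, id, List.mem_singleton] at hp
      exact hp ▸ h₀
    | succ j ih =>
      intro p hp
      rw [Function.iterate_succ_apply'] at hp
      rcases List.mem_append.1 hp with hp | hp
      · exact ih p hp
      · obtain ⟨q, hq, hp⟩ := List.mem_flatMap.1 hp
        exact hs q p (ih q hq) hp
  exact this n p hp

end Decoding

/-! ### The arithmetic functions on codes of actual terms and formulas -/

section NodeData

open Encodable

variable {k : ℕ} {S : Signature k} [∀ w σ, Encodable (S.Func w σ)]
  {w : List (Srt k)} {σ : Srt k} {n : ℕ}

def Term.node {σ : Srt k} (t : Term S σ) : ℕ := 2 * t.code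

theorem Term.node_half (t : Term S σ) : t.node / 2 = t.code := by unfold Term.node; omega

theorem Term.node_mod (t : Term S σ) : t.node % 2 = 0 := by unfold Term.node; omega

theorem tag_var : tag (Term.var (S := S) σ n).node = 0 := by
  simp [tag, Term.node_half, Term.node_mod, Term.code]

theorem tag_app (f : S.Func w σ) (args : ∀ j : Fin w.length, Term S (w.get j)) :
    tag (Term.app f args).node = 1 := by
  simp [tag, Term.node_half, Term.node_mod, Term.code]

theorem tag_fapp (args : ∀ j : Fin w.length, Term S (w.get j)) :
    tag (Term.fapp w σ n args).node = 2 := by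
  simp [tag, Term.node_half, Term.node_mod, Term.code]

theorem map_listOf_ofFn (args : ∀ j : Fin w.length, Term S (w.get j)) :
    ((listOf (encode (List.ofFn fun j => (args j).code))).map fun c => 2 * c) =
      List.ofFn fun j => (args j).node := by
  rw [listOf_encode, List.map_ofFn]; rfl

theorem children_var : children (Term.var (S := S) σ n).node = [] := by
  simp [children, tag_var]

theorem children_app (f : S.Func w σ) (args : ∀ j : Fin w.length, Term S (w.get j)) :
    children (Term.app f args).node = List.ofFn fun j => (args j).node := by
  rw [← map_listOf_ofFn]
  simp [children, tag_app, arg, Term.node_half, Term.code, -encode_prod_val]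

theorem children_fapp (args : ∀ j : Fin w.length, Term S (w.get j)) :
    children (Term.fapp w σ n args).node = List.ofFn fun j => (args j).node := by
  rw [← map_listOf_ofFn]
  simp [children, tag_fapp, arg, Term.node_half, Term.code, -encode_prod_val]

theorem sortOf_node (t : Term S σ) : sortOf t.node = σ := by
  cases t with
  | var => simp [sortOf, tag_var, typ, Term.node_half, Term.code, encode_fin]
  | app => simp [sortOf, tag_app, typ, Term.node_half, Term.code, encode_fin]
  | fapp => simp [sortOf, tag_fapp, typ, Term.node_half, Term.code, encode_fin]

theorem tag_node_le (t : Term S σ) : tag t.node ≤ 2 := by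
  cases t with
  | var => simp [tag_var]
  | app => simp [tag_app]
  | fapp => simp [tag_fapp]

/-- A first-order variable and the term consisting of it have the same Gödel number. -/
theorem headVar_var : headVar (Term.var (S := S) σ n).node = (Var.fo σ n).code := by
  simp [headVar, tag_var, Term.node_half, Term.code, Var.code]

theorem headVar_fapp (args : ∀ j : Fin w.length, Term S (w.get j)) :
    headVar (Term.fapp w σ n args).node = (Var.fn w σ n).code := by
  simp [headVar, tag_fapp, Term.node_half, Term.code, Var.code, typ, arg]

theorem sort_eq_of_node_eq {σ τ : Srt k} {s : Term S σ} {t : Term S τ} (h : s.node = t.node) :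
    σ = τ := by
  have := congrArg sortOf h
  rw [sortOf_node, sortOf_node] at this
  exact Fin.ext this

theorem Term.node_injective : Function.Injective (Term.node (S := S) (σ := σ)) := by
  intro s t h
  unfold Term.node at h
  exact Term.code_injective (by omega)

variable [∀ w, Encodable (S.Rel w)]

def Formula.node (φ : Formula S) : ℕ := 2 * φ.code + 1

theorem Formula.node_half (φ : Formula S) : φ.node / 2 = φ.code := by
  unfold Formula.node; omega

theorem Formula.node_mod (φ : Formula S) : ¬ φ.node % 2 = 0 := by
  unfold Formula.node; omega

theorem tag_bot : tag (Formula.bot (S := S)).node = 3 := by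
  simp [tag, Formula.node_half, Formula.node_mod, Formula.code]

theorem tag_imp (φ ψ : Formula S) : tag (Formula.imp φ ψ).node = 4 := by
  simp [tag, Formula.node_half, Formula.node_mod, Formula.code]

theorem tag_eq (s t : Term S σ) : tag (Formula.eq s t).node = 5 := by
  simp [tag, Formula.node_half, Formula.node_mod, Formula.code]

theorem tag_ratom (R : S.Rel w) (args : ∀ j : Fin w.length, Term S (w.get j)) :
    tag (Formula.ratom R args).node = 6 := by
  simp [tag, Formula.node_half, Formula.node_mod, Formula.code]

theorem tag_rapp (args : ∀ j : Fin w.length, Term S (w.get j)) :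
    tag (Formula.rapp w n args).node = 7 := by
  simp [tag, Formula.node_half, Formula.node_mod, Formula.code]

theorem tag_ex (v : Var k) (φ : Formula S) : tag (Formula.ex v φ).node = 8 := by
  simp [tag, Formula.node_half, Formula.node_mod, Formula.code]

theorem tag_all (v : Var k) (φ : Formula S) : tag (Formula.all v φ).node = 9 := by
  simp [tag, Formula.node_half, Formula.node_mod, Formula.code]

theorem children_bot : children (Formula.bot (S := S)).node = [] := by
  simp [children, tag_bot]

theorem children_imp (φ ψ : Formula S) : children (Formula.imp φ ψ).node = [φ.node, ψ.node] := by
  rw [children, tag_imp]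
  simp [arg, typ, Formula.node_half, Formula.code]
  simp [Formula.node]

theorem children_eq (s t : Term S σ) : children (Formula.eq s t).node = [s.node, t.node] := by
  simp [children, tag_eq, arg, Formula.node_half, Formula.code, Term.node]

theorem children_ratom (R : S.Rel w) (args : ∀ j : Fin w.length, Term S (w.get j)) :
    children (Formula.ratom R args).node = List.ofFn fun j => (args j).node := by
  rw [← map_listOf_ofFn]
  simp [children, tag_ratom, arg, Formula.node_half, Formula.code]

theorem children_rapp (args : ∀ j : Fin w.length, Term S (w.get j)) :
    children (Formula.rapp w n args).node = List.ofFn fun j => (args j).node := by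
  rw [← map_listOf_ofFn]
  simp [children, tag_rapp, arg, Formula.node_half, Formula.code]

theorem children_ex (v : Var k) (φ : Formula S) :
    children (Formula.ex v φ).node = [φ.node] := by
  rw [children, tag_ex]
  simp [arg, Formula.node_half, Formula.code]
  simp [Formula.node]

theorem children_all (v : Var k) (φ : Formula S) :
    children (Formula.all v φ).node = [φ.node] := by
  rw [children, tag_all]
  simp [arg, Formula.node_half, Formula.code]
  simp [Formula.node]

theorem typ_all (v : Var k) (φ : Formula S) : typ (Formula.all v φ).node = v.code := by
  simp [typ, Formula.node_half, Formula.code]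

theorem lt_tag_node (φ : Formula S) : 2 < tag φ.node := by
  simp [tag, Formula.node_mod]

theorem headVar_rapp (args : ∀ j : Fin w.length, Term S (w.get j)) :
    headVar (Formula.rapp w n args).node = (Var.rel w n).code := by
  simp [headVar, tag_rapp, Formula.node_half, Formula.code, Var.code, typ, arg]

theorem Formula.node_injective : Function.Injective (Formula.node (S := S)) := by
  intro s t h
  unfold Formula.node at h
  exact Formula.code_injective (by omega)

theorem node_ne_node {s : Term S σ} {φ : Formula S} : s.node ≠ φ.node := by
  unfold Term.node Formula.node
  omega

end NodeData

/-! ### Reduction of the quantifier prefix to a pair of valuations -/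

section Prefix

variable {k : ℕ} {S : Signature k}

/-- All variables that occur in the atoms of a formula, free or bound. -/
def Formula.atomVars : Formula S → Set (Var k)
  | .bot => ∅
  | .imp φ ψ => φ.atomVars ∪ ψ.atomVars
  | .eq s t => s.vars ∪ t.vars
  | .ratom _ args => ⋃ j, (args j).vars
  | .rapp w n args => {.rel w n} ∪ ⋃ j, (args j).vars
  | .ex _ φ => φ.atomVars
  | .all _ φ => φ.atomVars

/-- The variables that are universally quantified in a formula. -/
def Formula.univVars : Formula S → Set (Var k)
  | .imp φ ψ => φ.univVars ∪ ψ.univVars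
  | .ex _ φ => φ.univVars
  | .all v φ => {v} ∪ φ.univVars
  | _ => ∅

/-- Satisfaction of the formula that is left when all quantifiers are removed. -/
def Formula.MatrixHolds (M : Model.{u} S) (ρ : Valuation M.carrier) : Formula S → Prop
  | .bot => False
  | .imp φ ψ => φ.MatrixHolds M ρ → ψ.MatrixHolds M ρ
  | .eq s t => s.eval M ρ = t.eval M ρ
  | .ratom R args => M.rel R fun j => (args j).eval M ρ
  | .rapp w n args =>
      (show Tuple M.carrier w → Prop from ρ (.rel w n)) fun j => (args j).eval M ρ
  | .ex _ φ => φ.MatrixHolds M ρ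
  | .all _ φ => φ.MatrixHolds M ρ

theorem Formula.IsQF.holds_iff {φ : Formula S} (h : φ.IsQF) (M : Model.{u} S)
    (ρ : Valuation M.carrier) : φ.Holds M ρ ↔ φ.MatrixHolds M ρ := by
  induction φ with
  | imp φ ψ ih₁ ih₂ => exact imp_congr (ih₁ h.1) (ih₂ h.2)
  | ex => exact h.elim
  | all => exact h.elim
  | _ => exact Iff.rfl

theorem Formula.IsQF.univVars_eq {φ : Formula S} (h : φ.IsQF) : φ.univVars = ∅ := by
  induction φ with
  | imp φ ψ ih₁ ih₂ => simp [univVars, ih₁ h.1, ih₂ h.2]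
  | ex => exact h.elim
  | all => exact h.elim
  | _ => rfl

theorem holds_all_iff_of {M : Model.{u} S} {v : Var k} {φ : Formula S}
    (ih : ∀ ρ, φ.Holds M ρ ↔
      ∀ ρ', (∀ x, x ∉ φ.univVars → ρ' x = ρ x) → φ.MatrixHolds M ρ') (ρ : Valuation M.carrier) :
    (Formula.all v φ).Holds M ρ ↔
      ∀ ρ', (∀ x, x ∉ (Formula.all v φ).univVars → ρ' x = ρ x) →
        (Formula.all v φ).MatrixHolds M ρ' := by
  constructor
  · intro h ρ' hρ'
    refine (ih _).1 (h (ρ' v)) ρ' fun x hx => ?_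
    by_cases hv : x = v
    · subst hv; simp
    · rw [Function.update_of_ne hv]
      exact hρ' x (by simp [Formula.univVars, hv, hx])
  · intro h a
    refine (ih _).2 fun ρ' hρ' => h ρ' fun x hx => ?_
    simp only [Formula.univVars, Set.singleton_union, Set.mem_insert_iff, not_or] at hx
    rw [hρ' x hx.2, Function.update_of_ne hx.1]

/-- The universal block is one quantification over all valuations that differ at most on `univVars`;
repeated quantification of a variable makes no difference. -/
theorem Formula.IsUniversal.holds_iff {φ : Formula S} (h : φ.IsUniversal) (M : Model.{u} S)
    (ρ : Valuation M.carrier) : φ.Holds M ρ ↔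
      ∀ ρ', (∀ x, x ∉ φ.univVars → ρ' x = ρ x) → φ.MatrixHolds M ρ' := by
  induction h generalizing ρ with
  | qf h =>
    rw [h.holds_iff]
    constructor
    · intro h' ρ' hρ'
      rwa [funext fun x => hρ' x (by simp [h.univVars_eq])]
    · intro h'
      exact h' ρ fun _ _ => rfl
  | fo σ n h ih => exact holds_all_iff_of ih ρ
  | rel hw n h ih => exact holds_all_iff_of ih ρ
  | fn hw σ n h ih => exact holds_all_iff_of ih ρ

/-- The valuation collects the existential witnesses. A variable bound in both blocks belongs to the
inner, universal one, so its witness plays no role. -/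
theorem Formula.HasEQSMTForm.exists_of_holds {φ : Formula S} (h : φ.HasEQSMTForm)
    {M : Model.{u} S} {ρ : Valuation M.carrier} (hφ : φ.Holds M ρ) :
    ∃ ρ₁ : Valuation M.carrier,
      ∀ ρ', (∀ x, x ∉ φ.univVars → ρ' x = ρ₁ x) → φ.MatrixHolds M ρ' := by
  induction h generalizing ρ with
  | univ h => exact ⟨ρ, (h.holds_iff M ρ).1 hφ⟩
  | fo σ n h ih => obtain ⟨a, ha⟩ := hφ; exact ih ha
  | rel hw hw₀ n h ih => obtain ⟨a, ha⟩ := hφ; exact ih ha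
  | fn hw hw₀ hσ n h ih => obtain ⟨a, ha⟩ := hφ; exact ih ha

theorem Formula.HasEQSMTForm.holds_of_forall {φ : Formula S} (h : φ.HasEQSMTForm)
    {M : Model.{u} S} {ρ : Valuation M.carrier}
    (hρ : ∀ ρ', (∀ x, x ∉ φ.univVars → ρ' x = ρ x) → φ.MatrixHolds M ρ') : φ.Holds M ρ := by
  -- The valuation already contains the witnesses, so updating it by its own value changes nothing.
  have key : ∀ (v : Var k) (ψ : Formula S), ψ.Holds M ρ → (Formula.ex v ψ).Holds M ρ :=
    fun v ψ h => ⟨ρ v, by rwa [Function.update_eq_self]⟩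
  induction h with
  | univ h => exact (h.holds_iff M ρ).2 hρ
  | fo σ n h ih => exact key _ _ (ih hρ)
  | rel hw hw₀ n h ih => exact key _ _ (ih hρ)
  | fn hw hw₀ hσ n h ih => exact key _ _ (ih hρ)

theorem Formula.IsForall.isUniversal {φ : Formula S} (h : φ.IsForall) : φ.IsUniversal := by
  induction h with
  | qf h => exact .qf h
  | all σ n _ ih => exact .fo σ n ih

theorem Formula.IsExistsForall.hasEQSMTForm {φ : Formula S} (h : φ.IsExistsForall) :
    φ.HasEQSMTForm := by
  induction h with
  | univ h => exact .univ h.isUniversal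
  | ex σ n _ ih => exact .fo σ n ih

theorem Term.eval_congr {M : Model.{u} S} {ρ ρ' : Valuation M.carrier} {σ : Srt k}
    (t : Term S σ) (h : ∀ v ∈ t.vars, ρ v = ρ' v) : t.eval M ρ = t.eval M ρ' := by
  induction t with
  | var σ n => exact h _ rfl
  | app f args ih =>
    simp only [Term.eval]
    congr 1
    funext j
    exact ih j fun v hv => h v (Set.mem_iUnion.2 ⟨j, hv⟩)
  | fapp w σ n args ih =>
    have h₁ : ρ (.fn w σ n) = ρ' (.fn w σ n) := h _ (Or.inl rfl)
    have h₂ : (fun j => (args j).eval M ρ) = fun j => (args j).eval M ρ' :=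
      funext fun j => ih j fun v hv => h v (Or.inr (Set.mem_iUnion.2 ⟨j, hv⟩))
    simp only [Term.eval, h₁, h₂]

theorem Formula.holds_congr {M : Model.{u} S} (φ : Formula S) {ρ ρ' : Valuation M.carrier}
    (h : ∀ v ∈ φ.freeVars, ρ v = ρ' v) : φ.Holds M ρ ↔ φ.Holds M ρ' := by
  induction φ generalizing ρ ρ' with
  | bot => exact Iff.rfl
  | imp φ ψ ih₁ ih₂ =>
    exact imp_congr (ih₁ fun v hv => h v (Or.inl hv)) (ih₂ fun v hv => h v (Or.inr hv))
  | eq s t =>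
    simp only [Holds, s.eval_congr fun v hv => h v (Or.inl hv),
      t.eval_congr fun v hv => h v (Or.inr hv)]
  | ratom R args =>
    have h₂ : (fun j => (args j).eval M ρ) = fun j => (args j).eval M ρ' :=
      funext fun j => (args j).eval_congr fun v hv => h v (Set.mem_iUnion.2 ⟨j, hv⟩)
    simp only [Holds, h₂]
  | rapp w n args =>
    have h₁ : ρ (.rel w n) = ρ' (.rel w n) := h _ (Or.inl rfl)
    have h₂ : (fun j => (args j).eval M ρ) = fun j => (args j).eval M ρ' :=
      funext fun j => (args j).eval_congr fun v hv => h v (Or.inr (Set.mem_iUnion.2 ⟨j, hv⟩))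
    simp only [Holds, h₁, h₂]
  | ex v φ ih =>
    refine exists_congr fun a => ih fun x hx => ?_
    by_cases hv : x = v
    · subst hv; simp
    · rw [Function.update_of_ne hv, Function.update_of_ne hv]
      exact h x ⟨hx, hv⟩
  | all v φ ih =>
    refine forall_congr' fun a => ih fun x hx => ?_
    by_cases hv : x = v
    · subst hv; simp
    · rw [Function.update_of_ne hv, Function.update_of_ne hv]
      exact h x ⟨hx, hv⟩

theorem Formula.HasEQSMTForm.satisfies_iff {φ : Formula S} (h : φ.HasEQSMTForm)
    (hs : φ.IsSentence) (M : Model.{u} S) : M.Satisfies φ ↔ ∃ ρ : Valuation M.carrier,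
      ∀ ρ', (∀ x, x ∉ φ.univVars → ρ' x = ρ x) → φ.MatrixHolds M ρ' := by
  constructor
  · intro hM
    have hne : ∀ v : Var k, Nonempty (v.Domain M.carrier) := by
      intro v
      cases v with
      | fo σ n => exact M.nonempty σ
      | fn w σ n => exact ⟨fun _ => (M.nonempty σ).some⟩
      | rel w n => exact ⟨fun _ => True⟩
    exact h.exists_of_holds (hM fun v => (hne v).some)
  · rintro ⟨ρ, hρ⟩ ρ'
    refine (φ.holds_congr fun v hv => ?_).1 (h.holds_of_forall hρ)
    rw [hs] at hv
    exact hv.elim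

/-- The variables that may be quantified existentially in an EQSMT sentence. -/
def Var.IsExistential : Var k → Prop
  | .fo _ _ => True
  | .fn w σ _ => (∀ τ ∈ w, τ = 0) ∧ σ ≠ 0
  | .rel w _ => ∀ τ ∈ w, τ = 0

theorem Formula.IsQF.atomVars_eq {φ : Formula S} (h : φ.IsQF) : φ.atomVars = φ.freeVars := by
  induction φ with
  | imp φ ψ ih₁ ih₂ => simp [atomVars, freeVars, ih₁ h.1, ih₂ h.2]
  | ex => exact h.elim
  | all => exact h.elim
  | _ => rfl

theorem mem_univVars_all {v x : Var k} {φ : Formula S}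
    (h : x ∈ φ.univVars ∨ x ∈ φ.freeVars) :
    x ∈ (Formula.all v φ).univVars ∨ x ∈ (Formula.all v φ).freeVars := by
  by_cases hv : x = v
  · exact Or.inl (Or.inl hv)
  · exact h.imp Or.inr fun h => ⟨h, hv⟩

theorem Formula.IsUniversal.atomVars_subset {φ : Formula S} (h : φ.IsUniversal) {x : Var k}
    (hx : x ∈ φ.atomVars) : x ∈ φ.univVars ∨ x ∈ φ.freeVars := by
  induction h with
  | qf h => exact Or.inr (h.atomVars_eq ▸ hx)
  | fo σ n h ih => exact mem_univVars_all (ih hx)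
  | rel hw n h ih => exact mem_univVars_all (ih hx)
  | fn hw σ n h ih => exact mem_univVars_all (ih hx)

theorem mem_univVars_ex {v x : Var k} (hv : v.IsExistential) {φ : Formula S}
    (h : x ∈ φ.univVars ∨ x ∈ φ.freeVars ∨ x.IsExistential) :
    x ∈ (Formula.ex v φ).univVars ∨ x ∈ (Formula.ex v φ).freeVars ∨ x.IsExistential := by
  by_cases hx : x = v
  · exact Or.inr (Or.inr (hx ▸ hv))
  · exact h.imp_right fun h => h.imp_left fun h => ⟨h, hx⟩

/-- For a sentence, every non-universal variable in an atom thus has a type permitted in the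
existential block. This is how the restriction to foreground arguments enters. -/
theorem Formula.HasEQSMTForm.atomVars_subset {φ : Formula S} (h : φ.HasEQSMTForm) {x : Var k}
    (hx : x ∈ φ.atomVars) : x ∈ φ.univVars ∨ x ∈ φ.freeVars ∨ x.IsExistential := by
  induction h with
  | univ h => exact (h.atomVars_subset hx).imp_right Or.inl
  | fo σ n h ih => exact mem_univVars_ex (v := .fo σ n) trivial (ih hx)
  | rel hw hw₀ n h ih => exact mem_univVars_ex (v := .rel _ n) hw₀ (ih hx)
  | fn hw hw₀ hσ n h ih => exact mem_univVars_ex (v := .fn _ _ n) ⟨hw₀, hσ⟩ (ih hx)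

end Prefix

/-! ### Formulas over a single sort only see that sort -/

section Transfer

variable {k : ℕ} {S : Signature k}

/-- A map between structures that is a bijective homomorphism on the sort `σ`. -/
structure SortIso (M N : Model.{u} S) (σ : Srt k) where
  map : ∀ τ, M.carrier τ → N.carrier τ
  bijective : Function.Bijective (map σ)
  map_func : ∀ {w : List (Srt k)} (f : S.Func w σ) (a : Tuple M.carrier w), (∀ τ ∈ w, τ = σ) →
    map σ (M.func f a) = N.func f fun j => map _ (a j)
  map_rel : ∀ {w : List (Srt k)} (R : S.Rel w) (a : Tuple M.carrier w), (∀ τ ∈ w, τ = σ) →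
    (M.rel R a ↔ N.rel R fun j => map _ (a j))

variable {M N : Model.{u} S} {σ : Srt k}

theorem SortIso.eval (e : SortIso M N σ) {ρ : Valuation M.carrier} {ρ' : Valuation N.carrier}
    (hρ : ∀ n, e.map σ (ρ (.fo σ n)) = ρ' (.fo σ n)) {τ : Srt k} (t : Term S τ)
    (ht : t.IsOver σ) : e.map τ (t.eval M ρ) = t.eval N ρ' := by
  induction t with
  | var τ n => cases ht; exact hρ n
  | app f args ih =>
    obtain ⟨rfl, hw, ha⟩ := ht
    simp only [Term.eval, e.map_func f _ hw]
    congr 1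
    funext j
    exact ih j (ha j)
  | fapp => exact ht.elim

/-- Injectivity on `σ` transfers equations, surjectivity transfers quantifiers. The maps on other
sorts may be arbitrary; they are present so that tuples can be mapped without transport along
equalities of sorts. -/
theorem SortIso.holds_iff (e : SortIso M N σ) {φ : Formula S} (hφ : φ.IsOver σ)
    {ρ : Valuation M.carrier}
    {ρ' : Valuation N.carrier} (hρ : ∀ n, e.map σ (ρ (.fo σ n)) = ρ' (.fo σ n)) :
    φ.Holds M ρ ↔ φ.Holds N ρ' := by
  have upd : ∀ {ρ : Valuation M.carrier} {ρ' : Valuation N.carrier},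
      (∀ n, e.map σ (ρ (.fo σ n)) = ρ' (.fo σ n)) → ∀ (m : ℕ) (a : M.carrier σ) (n : ℕ),
      e.map σ (Function.update ρ (.fo σ m) a (.fo σ n)) =
        Function.update ρ' (.fo σ m) (e.map σ a) (.fo σ n) := by
    intro ρ ρ' h m a n
    by_cases hn : n = m
    · subst hn
      exact (congrArg (e.map σ) (Function.update_self (β := Var.Domain M.carrier) _ _ _)).trans
        (Function.update_self (β := Var.Domain N.carrier) (.fo σ n) (e.map σ a) ρ').symm
    · have hne : (Var.fo σ n : Var k) ≠ .fo σ m := by simpa using hn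
      exact (congrArg (e.map σ) (Function.update_of_ne (β := Var.Domain M.carrier) hne _ _)).trans
        ((h n).trans (Function.update_of_ne (β := Var.Domain N.carrier) hne _ _).symm)
  induction φ generalizing ρ ρ' with
  | bot => exact Iff.rfl
  | imp φ ψ ih₁ ih₂ => exact imp_congr (ih₁ hφ.1 hρ) (ih₂ hφ.2 hρ)
  | eq s t =>
    rename_i τ
    have hτ : τ = σ := by
      cases s with
      | var => exact hφ.1
      | app => exact hφ.1.1
      | fapp => exact hφ.1.elim
    subst hτ
    simp only [Formula.Holds, ← e.eval hρ s hφ.1, ← e.eval hρ t hφ.2, e.bijective.1.eq_iff]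
  | ratom R args =>
    simp only [Formula.Holds, e.map_rel R _ hφ.1, e.eval hρ _ (hφ.2 _)]
  | rapp => exact hφ.elim
  | ex v φ ih =>
    obtain ⟨⟨m, rfl⟩, hφ⟩ := hφ
    constructor
    · rintro ⟨a, ha⟩
      exact ⟨e.map σ a, (ih hφ (upd hρ m a)).1 ha⟩
    · rintro ⟨b, hb⟩
      obtain ⟨a, rfl⟩ := e.bijective.2 b
      exact ⟨a, (ih hφ (upd hρ m a)).2 hb⟩
  | all v φ ih =>
    obtain ⟨⟨m, rfl⟩, hφ⟩ := hφ
    constructor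
    · intro h b
      obtain ⟨a, rfl⟩ := e.bijective.2 b
      exact (ih hφ (upd hρ m a)).1 (h a)
    · intro h a
      exact (ih hφ (upd hρ m a)).2 (h (e.map σ a))

theorem SortIso.satisfies (e : SortIso M N σ) {φ : Formula S} (hφ : φ.IsOver σ)
    (h : N.Satisfies φ) :
    M.Satisfies φ := by
  intro ρ
  have hne : ∀ v : Var k, Nonempty (v.Domain N.carrier) := by
    intro v
    cases v with
    | fo σ n => exact N.nonempty σ
    | fn w σ n => exact ⟨fun _ => (N.nonempty σ).some⟩
    | rel w n => exact ⟨fun _ => True⟩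
  let ρ' : Valuation N.carrier := fun v =>
    match v with
    | .fo τ n => e.map τ (ρ (.fo τ n))
    | .fn w τ n => (hne (.fn w τ n)).some
    | .rel w n => (hne (.rel w n)).some
  exact (e.holds_iff hφ (ρ' := ρ') fun n => rfl).2 (h ρ')

end Transfer

/-! ### Nodes of a formula are its subterms and subformulas -/

section Nodes

variable {k : ℕ} {S : Signature k} [∀ w σ, Encodable (S.Func w σ)] [∀ w, Encodable (S.Rel w)]

/-- The node of a subterm or subformula of `φ`. -/
def IsSubNode (φ : Formula S) (p : ℕ) : Prop :=
  (∃ (σ : Srt k) (t : Term S σ), p = t.node ∧ t.vars ⊆ φ.atomVars) ∨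
  ∃ ψ : Formula S, p = ψ.node ∧ ψ.atomVars ⊆ φ.atomVars ∧ ψ.univVars ⊆ φ.univVars

/-- Being the number of actual syntax is inherited by children, so no junk numbers occur among the
nodes of a formula. -/
theorem isSubNode_of_mem_nodes {φ : Formula S} {p : ℕ} (hp : p ∈ nodes φ.code) :
    IsSubNode φ p := by
  refine nodes_induction (P := IsSubNode φ) (Or.inr ⟨φ, rfl, subset_rfl, subset_rfl⟩) ?_ hp
  rintro p q (⟨σ, t, rfl, ht⟩ | ⟨ψ, rfl, ha, hu⟩) hq
  · cases t with
    | var => rw [children_var] at hq; simp at hq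
    | app f args =>
      rw [children_app, List.mem_ofFn] at hq
      obtain ⟨j, rfl⟩ := hq
      exact Or.inl ⟨_, args j, rfl, (Set.subset_iUnion (fun j => (args j).vars) j).trans ht⟩
    | fapp w σ n args =>
      rw [children_fapp, List.mem_ofFn] at hq
      obtain ⟨j, rfl⟩ := hq
      exact Or.inl ⟨_, args j, rfl, (Set.subset_iUnion (fun j => (args j).vars) j).trans
        (Set.subset_union_right.trans ht)⟩
  · cases ψ with
    | bot => rw [children_bot] at hq; simp at hq
    | imp ψ χ =>
      rw [children_imp] at hq
      simp only [List.mem_cons, List.not_mem_nil, or_false] at hq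
      rcases hq with rfl | rfl
      · exact Or.inr ⟨ψ, rfl, Set.subset_union_left.trans ha, Set.subset_union_left.trans hu⟩
      · exact Or.inr ⟨χ, rfl, Set.subset_union_right.trans ha, Set.subset_union_right.trans hu⟩
    | eq s t =>
      rw [children_eq] at hq
      simp only [List.mem_cons, List.not_mem_nil, or_false] at hq
      rcases hq with rfl | rfl
      · exact Or.inl ⟨_, s, rfl, Set.subset_union_left.trans ha⟩
      · exact Or.inl ⟨_, t, rfl, Set.subset_union_right.trans ha⟩
    | ratom R args =>
      rw [children_ratom, List.mem_ofFn] at hq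
      obtain ⟨j, rfl⟩ := hq
      exact Or.inl ⟨_, args j, rfl, (Set.subset_iUnion (fun j => (args j).vars) j).trans ha⟩
    | rapp w n args =>
      rw [children_rapp, List.mem_ofFn] at hq
      obtain ⟨j, rfl⟩ := hq
      exact Or.inl ⟨_, args j, rfl, (Set.subset_iUnion (fun j => (args j).vars) j).trans
        (Set.subset_union_right.trans ha)⟩
    | ex v ψ =>
      rw [children_ex, List.mem_singleton] at hq
      exact Or.inr ⟨ψ, hq, ha, hu⟩
    | all v ψ =>
      rw [children_all, List.mem_singleton] at hq
      exact Or.inr ⟨ψ, hq, ha, Set.subset_union_right.trans hu⟩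

/-- A node with tag `9` is a universally quantified subformula. Conversely, descending through the
prefix meets every universal quantifier, since the matrix has none. -/
theorem mem_univs_iff {φ : Formula S} (h : φ.HasEQSMTForm) (v : Var k) :
    v.code ∈ univs φ.code ↔ v ∈ φ.univVars := by
  constructor
  · intro hv
    obtain ⟨p, hp, hv⟩ := List.mem_flatMap.1 hv
    split_ifs at hv with ht
    · rw [List.mem_singleton] at hv
      rcases isSubNode_of_mem_nodes hp with ⟨σ, t, rfl, -⟩ | ⟨ψ, rfl, -, hu⟩
      · have := tag_node_le t
        omega
      · cases ψ with
        | all x ψ =>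
          rw [typ_all] at hv
          exact hu (Or.inl (Var.code_injective hv))
        | bot => rw [tag_bot] at ht; omega
        | imp => rw [tag_imp] at ht; omega
        | eq => rw [tag_eq] at ht; omega
        | ratom => rw [tag_ratom] at ht; omega
        | rapp => rw [tag_rapp] at ht; omega
        | ex => rw [tag_ex] at ht; omega
    · simp at hv
  · intro hv
    suffices H : ∀ ψ : Formula S, ψ.HasEQSMTForm → ψ.node ∈ nodes φ.code → v ∈ ψ.univVars →
        ∃ x, ∃ ψ' : Formula S, (Formula.all x ψ').node ∈ nodes φ.code ∧ v = x by
      obtain ⟨x, ψ, hψ, rfl⟩ := H φ h (root_mem_nodes _) hv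
      refine List.mem_flatMap.2 ⟨_, hψ, ?_⟩
      rw [if_pos (tag_all _ _), typ_all]
      exact List.mem_singleton_self _
    intro ψ hψ hp hv
    have hall : ∀ (x : Var k) (ψ : Formula S), (ψ.node ∈ nodes φ.code → v ∈ ψ.univVars →
          ∃ x, ∃ ψ' : Formula S, (Formula.all x ψ').node ∈ nodes φ.code ∧ v = x) →
        (Formula.all x ψ).node ∈ nodes φ.code → v ∈ (Formula.all x ψ).univVars →
          ∃ x, ∃ ψ' : Formula S, (Formula.all x ψ').node ∈ nodes φ.code ∧ v = x := by
      rintro x ψ ih hp (hv | hv)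
      · exact ⟨x, ψ, hp, hv⟩
      · exact ih (child_mem_nodes hp (by rw [children_all]; simp)) hv
    have hex : ∀ (x : Var k) (ψ : Formula S), (Formula.ex x ψ).node ∈ nodes φ.code →
        ψ.node ∈ nodes φ.code :=
      fun x ψ hp => child_mem_nodes hp (by rw [children_ex]; simp)
    induction hψ with
    | univ h =>
      induction h with
      | qf h => rw [h.univVars_eq] at hv; exact hv.elim
      | fo σ n h ih => exact hall _ _ ih hp hv
      | rel hw n h ih => exact hall _ _ ih hp hv
      | fn hw σ n h ih => exact hall _ _ ih hp hv
    | fo σ n h ih => exact ih (hex _ _ hp) hv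
    | rel hw hw₀ n h ih => exact ih (hex _ _ hp) hv
    | fn hw hw₀ hσ n h ih => exact ih (hex _ _ hp) hv

end Nodes

/-! ### Meaning of the emitted sentences -/

section Output

open Encodable

variable {k : ℕ} {S : Signature k}

theorem isOver_var {σ τ : Srt k} (h : τ = σ) (x : ℕ) : (Term.var (S := S) τ x).IsOver σ := by
  simp only [Term.IsOver, h]

theorem fo_mem {σ τ : Srt k} {V : Set (Var k)} (h : τ = σ) {x : ℕ} (hx : Var.fo σ x ∈ V) :
    Var.fo τ x ∈ V :=
  h ▸ hx

variable [∀ w σ, Encodable (S.Func w σ)]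

/-- The value of a first-order variable. -/
def foVal {A : Srt k → Type u} (ρ : Valuation A) (σ : Srt k) (x : ℕ) : A σ := ρ (.fo σ x)

theorem codeArgs_eq {w : List (Srt k)} {σ : Srt k} (hw : ∀ τ ∈ w, τ = σ)
    (args : ∀ j : Fin w.length, Term S (w.get j)) {p : ℕ}
    (hp : children p = List.ofFn fun j => (args j).node) :
    codeArgs σ p =
      encode (List.ofFn fun j => (Term.var (S := S) (w.get j) (2 * (args j).node)).code) := by
  unfold codeArgs
  rw [hp, List.map_ofFn]
  congr 2
  funext j
  simp only [Function.comp, codeVar, Term.code, encode_fin, hw _ (List.get_mem w j)]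

variable [∀ w, Encodable (S.Rel w)]

/-- `c` is the code of a quantifier-free formula over the sort `σ` with free variables in `V`
and the meaning `sem`. -/
def IsCodeOf (σ : Srt k) (V : Set (Var k)) (c : ℕ)
    (sem : ∀ M : Model.{u} S, Valuation M.carrier → Prop) : Prop :=
  ∃ φ : Formula S, φ.code = c ∧ φ.IsQF ∧ φ.IsOver σ ∧ φ.freeVars ⊆ V ∧
    ∀ M ρ, φ.Holds M ρ ↔ sem M ρ

/-- The formula with code `c` holds. -/
def HoldsCode (c : ℕ) (M : Model.{u} S) (ρ : Valuation M.carrier) : Prop :=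
  ∀ φ : Formula S, φ.code = c → φ.Holds M ρ

variable {σ : Srt k} {V : Set (Var k)} {c d : ℕ}
  {sem sem' : ∀ M : Model.{u} S, Valuation M.carrier → Prop}

theorem IsCodeOf.holdsCode_iff (h : IsCodeOf σ V c sem) (M : Model.{u} S)
    (ρ : Valuation M.carrier) : HoldsCode c M ρ ↔ sem M ρ := by
  obtain ⟨φ, rfl, -, -, -, hφ⟩ := h
  rw [← hφ]
  exact ⟨fun h => h φ rfl, fun h ψ hψ => Formula.code_injective hψ ▸ h⟩

theorem IsCodeOf.congr (h : IsCodeOf σ V c sem) (hs : ∀ M ρ, sem M ρ ↔ sem' M ρ) :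
    IsCodeOf σ V c sem' := by
  obtain ⟨φ, hc, hq, ho, hv, hφ⟩ := h
  exact ⟨φ, hc, hq, ho, hv, fun M ρ => (hφ M ρ).trans (hs M ρ)⟩

theorem isCodeOf_bot : IsCodeOf (S := S) σ V codeBot fun _ _ => False :=
  ⟨.bot, rfl, trivial, trivial, Set.empty_subset _, fun _ _ => Iff.rfl⟩

theorem IsCodeOf.imp (h : IsCodeOf σ V c sem) (h' : IsCodeOf σ V d sem') :
    IsCodeOf σ V (codeImp c d) fun M ρ => sem M ρ → sem' M ρ := by
  obtain ⟨φ, rfl, hq, ho, hv, hφ⟩ := h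
  obtain ⟨ψ, rfl, hq', ho', hv', hψ⟩ := h'
  exact ⟨.imp φ ψ, rfl, ⟨hq, hq'⟩, ⟨ho, ho'⟩, Set.union_subset hv hv',
    fun M ρ => imp_congr (hφ M ρ) (hψ M ρ)⟩

theorem isCodeOf_top : IsCodeOf (S := S) σ V codeTop fun _ _ => True :=
  (isCodeOf_bot.imp isCodeOf_bot).congr fun _ _ => by simp

theorem IsCodeOf.lit (h : IsCodeOf σ V c sem) (P : Prop) :
    IsCodeOf σ V (codeLit P c) fun M ρ => (sem M ρ ↔ P) := by
  unfold codeLit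
  split_ifs with hP
  · exact h.congr fun M ρ => by simp [hP]
  · exact (h.imp isCodeOf_bot).congr fun M ρ => by simp [hP]

theorem isCodeOf_negConj (l : List ℕ)
    (h : ∀ c ∈ l, ∃ sem, IsCodeOf.{u} (S := S) σ V c sem) :
    IsCodeOf.{u} (S := S) σ V (codeNegConj l) fun M ρ => ¬ ∀ c ∈ l, HoldsCode c M ρ := by
  induction l with
  | nil => exact isCodeOf_bot.congr fun _ _ => by simp
  | cons c l ih =>
    obtain ⟨sem, hc⟩ := h c (by simp)
    refine (hc.imp (ih fun c hc => h c (by simp [hc]))).congr fun M ρ => ?_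
    simp only [List.forall_mem_cons, hc.holdsCode_iff]
    tauto

theorem isCodeOf_eq_var {x y : ℕ} (hx : Var.fo σ x ∈ V) (hy : Var.fo σ y ∈ V) :
    IsCodeOf (S := S) σ V (codeEq σ (codeVar σ x) (codeVar σ y))
      fun _ ρ => foVal ρ σ x = foVal ρ σ y := by
  refine ⟨.eq (.var σ x) (.var σ y), rfl, trivial, ⟨rfl, rfl⟩, ?_, fun _ _ => Iff.rfl⟩
  rintro v (rfl | rfl)
  · exact hx
  · exact hy

theorem isCodeOf_app {w : List (Srt k)} (hw : ∀ τ ∈ w, τ = σ) (f : S.Func w σ)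
    (args : ∀ j : Fin w.length, Term S (w.get j)) {p : ℕ} (hp : p = (Term.app f args).node)
    (hV : Var.fo σ (2 * p) ∈ V) (hV' : ∀ j, Var.fo σ (2 * (args j).node) ∈ V) :
    IsCodeOf (S := S) σ V (codeEq σ (codeVar σ (2 * p))
        (Nat.pair 1 (Nat.pair (typ p) (Nat.pair (arg p).unpair.1 (codeArgs σ p)))))
      fun M ρ => foVal ρ σ (2 * p) = M.func f fun j => foVal ρ (w.get j) (2 * (args j).node) := by
  refine ⟨.eq (.var σ (2 * p)) (.app f fun j => .var (w.get j) (2 * (args j).node)), ?_, trivial,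
    ⟨rfl, by
      simp only [Term.IsOver]
      exact ⟨trivial, hw, fun j => hw _ (List.get_mem w j)⟩⟩, ?_, fun _ _ => Iff.rfl⟩
  · have hc : codeArgs σ p = _ := codeArgs_eq hw args (hp ▸ children_app f args)
    have ht : typ p = encode (w, σ) := by
      simp [hp, typ, Term.node_half, Term.code, -encode_prod_val]
    have ha : (arg p).unpair.1 = encode f := by
      simp [hp, arg, Term.node_half, Term.code]
    rw [hc, ht, ha]
    rfl
  · rintro v (rfl | hv)
    · exact hV
    · obtain ⟨j, hv⟩ := Set.mem_iUnion.1 hv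
      rw [Set.mem_singleton_iff.1 hv]
      exact fo_mem (hw _ (List.get_mem w j)) (hV' j)

theorem isCodeOf_ratom {w : List (Srt k)} (hw : ∀ τ ∈ w, τ = σ) (R : S.Rel w)
    (args : ∀ j : Fin w.length, Term S (w.get j)) {p : ℕ} (hp : p = (Formula.ratom R args).node)
    (hV : ∀ j, Var.fo σ (2 * (args j).node) ∈ V) :
    IsCodeOf (S := S) σ V
        (Nat.pair 3 (Nat.pair (typ p) (Nat.pair (arg p).unpair.1 (codeArgs σ p))))
      fun M ρ => M.rel R fun j => foVal ρ (w.get j) (2 * (args j).node) := by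
  refine ⟨.ratom R fun j => .var (w.get j) (2 * (args j).node), ?_, trivial,
    ⟨hw, fun j => isOver_var (hw _ (List.get_mem w j)) _⟩, ?_, fun _ _ => Iff.rfl⟩
  · have hc : codeArgs σ p = _ := codeArgs_eq hw args (hp ▸ children_ratom R args)
    have ht : typ p = encode w := by
      simp [hp, typ, Formula.node_half, Formula.code]
    have ha : (arg p).unpair.1 = encode R := by
      simp [hp, arg, Formula.node_half, Formula.code]
    rw [hc, ht, ha]
    rfl
  · intro v hv
    obtain ⟨j, hv⟩ := Set.mem_iUnion.1 hv
    rw [Set.mem_singleton_iff.1 hv]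
    exact fo_mem (hw _ (List.get_mem w j)) (hV j)

theorem sortOf_ratom {w : List (Srt k)} (R : S.Rel w)
    (args : ∀ j : Fin w.length, Term S (w.get j)) (hw : ∀ τ ∈ w, τ = σ) :
    sortOf (Formula.ratom R args).node = σ := by
  have ht : typ (Formula.ratom R args).node = encode w := by
    simp [typ, Formula.node_half, Formula.code]
  simp only [sortOf, tag_ratom, ht, listOf_encode_fin]
  cases w with
  -- A nullary relation symbol would have no sort to which its atom could be attributed.
  | nil => exact (S.rel_nil.false R).elim
  | cons τ w => simp [hw τ]

/-- The valuation `ρ` interprets the variable of the node `p` as prescribed by the variables of its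
children, if the values of the nodes are those of the assignment `a`. -/
def Describes (n a p : ℕ) (σ : Srt k) (M : Model.{u} S) (ρ : Valuation M.carrier) : Prop :=
  (∀ (w : List (Srt k)) (f : S.Func w σ) (args : ∀ j : Fin w.length, Term S (w.get j)),
    p = (Term.app f args).node →
    foVal ρ σ (2 * p) = M.func f fun j => foVal ρ (w.get j) (2 * (args j).node)) ∧
  (∀ (w : List (Srt k)) (R : S.Rel w) (args : ∀ j : Fin w.length, Term S (w.get j)),
    (∀ τ ∈ w, τ = σ) → p = (Formula.ratom R args).node →
    ((M.rel R fun j => foVal ρ (w.get j) (2 * (args j).node)) ↔ val n a p ≠ 0)) ∧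
  (IsEx n p → sortOf p = σ → foVal ρ σ (2 * p) = foVal ρ σ (2 * key n a p + 1))

/-- Terms of sort `σ` have the same value under `a` if and only if their variables have. -/
def Compares (n a p q : ℕ) (σ : Srt k) {A : Srt k → Type u} (ρ : Valuation A) : Prop :=
  tag p ≤ 2 → sortOf p = σ → tag q ≤ 2 → sortOf q = σ →
    (foVal ρ σ (2 * p) = foVal ρ σ (2 * q) ↔ val n a p = val n a q)

/-- The variables of the nodes, which are quantified universally. -/
def nodeVars (n : ℕ) (σ : Srt k) : Set (Var k) := {v | ∃ p ∈ nodes n, v = .fo σ (2 * p)}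

/-- The variables of the keys, which are quantified existentially. -/
def keyVars (n : ℕ) (σ : Srt k) : Set (Var k) := {v | ∃ x ∈ keys n, v = .fo σ (2 * x + 1)}

theorem key_mem_keys {n a p : ℕ} (ha : a < numAssign n) (hp : p ∈ nodes n) :
    key n a p ∈ keys n :=
  List.mem_flatMap.2 ⟨a, List.mem_range.2 ha, List.mem_map.2 ⟨p, hp, rfl⟩⟩

theorem isCodeOf_compare {n a p q : ℕ} (hp : p ∈ nodes n) (hq : q ∈ nodes n) :
    IsCodeOf (S := S) σ (nodeVars n σ ∪ keyVars n σ) (codeCompare n σ a p q)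
      fun _ ρ => Compares n a p q σ ρ := by
  unfold codeCompare
  split_ifs with h
  · refine ((isCodeOf_eq_var (Or.inl ⟨p, hp, rfl⟩) (Or.inl ⟨q, hq, rfl⟩)).lit _).congr
      fun M ρ => ?_
    simp [Compares, h]
  · refine isCodeOf_top.congr fun M ρ => ?_
    simp only [true_iff, Compares]
    tauto

/-- At most one clause of `Describes` is not vacuous at a given node, and `codeDescribe` emits the
literal for it. Purity puts the arguments of a symbol into the sort `σ`, so that the literal is over
`σ`. -/
theorem isCodeOf_describe (hS : S.IsPure) (hσ : σ ≠ 0) {φ : Formula S} {a p : ℕ}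
    (ha : a < numAssign φ.code) (hp : p ∈ nodes φ.code) :
    IsCodeOf (S := S) σ (nodeVars φ.code σ ∪ keyVars φ.code σ) (codeDescribe φ.code σ a p)
      fun M ρ => Describes φ.code a p σ M ρ := by
  have hchild : ∀ q ∈ children p,
      Var.fo σ (2 * q) ∈ nodeVars φ.code σ ∪ keyVars φ.code σ :=
    fun q hq => Or.inl ⟨q, child_mem_nodes hp hq, rfl⟩
  have hex : IsEx φ.code p → tag p ≠ 1 ∧ tag p ≠ 6 := by
    rintro ⟨h, -⟩
    omega
  unfold codeDescribe
  split_ifs with h₀ h₁ h₂ h₃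
  · rcases isSubNode_of_mem_nodes hp with ⟨τ, t, rfl, -⟩ | ⟨ψ, rfl, -⟩
    · cases t with
      | app f args =>
        rw [sortOf_node] at h₀
        obtain rfl := Fin.ext h₀
        have hw := (hS.1 _ _ ⟨f⟩).2
        refine (isCodeOf_app hw f args rfl (Or.inl ⟨_, hp, rfl⟩) fun j => hchild _ ?_).congr
          fun M ρ => ⟨fun h => ⟨?_, ?_, ?_⟩, fun h => h.1 _ f args rfl⟩
        · rw [children_app, List.mem_ofFn]
          exact ⟨j, rfl⟩
        · intro w' f' args' h'
          cases Term.node_injective h'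
          exact h
        · intro w' R args' _ h'
          exact (node_ne_node h').elim
        · exact fun h' => ((hex h').1 h₁).elim
      | var => rw [tag_var] at h₁; omega
      | fapp => rw [tag_fapp] at h₁; omega
    · have := lt_tag_node ψ
      omega
  · rcases isSubNode_of_mem_nodes hp with ⟨τ, t, rfl, -⟩ | ⟨ψ, rfl, -⟩
    · have := tag_node_le t
      omega
    · cases ψ with
      | ratom R args =>
        obtain ⟨τ, hτ, hw⟩ := hS.2 _ ⟨R⟩
        rw [sortOf_ratom R args hw] at h₀
        obtain rfl := Fin.ext h₀
        refine ((isCodeOf_ratom hw R args rfl fun j => hchild _ ?_).lit _).congr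
          fun M ρ => ⟨fun h => ⟨?_, ?_, ?_⟩, fun h => h.2.1 _ R args hw rfl⟩
        · rw [children_ratom, List.mem_ofFn]
          exact ⟨j, rfl⟩
        · intro w' f' args' h'
          exact (node_ne_node h'.symm).elim
        · intro w' R args' _ h'
          cases Formula.node_injective h'
          exact h
        · exact fun h' => ((hex h').2 h₂).elim
      | bot => rw [tag_bot] at h₂; omega
      | imp => rw [tag_imp] at h₂; omega
      | eq => rw [tag_eq] at h₂; omega
      | rapp => rw [tag_rapp] at h₂; omega
      | ex => rw [tag_ex] at h₂; omega
      | all => rw [tag_all] at h₂; omega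
  · refine (isCodeOf_eq_var (Or.inl ⟨p, hp, rfl⟩)
      (Or.inr ⟨_, key_mem_keys ha hp, rfl⟩)).congr
      fun M ρ => ⟨fun h => ⟨?_, ?_, fun _ _ => h⟩, fun h => h.2.2 h₃ h₀⟩
    · rintro w f args rfl
      exact (h₁ (tag_app _ _)).elim
    · rintro w R args - rfl
      exact (h₂ (tag_ratom _ _)).elim
  · refine isCodeOf_top.congr fun M ρ => ⟨fun _ => ⟨?_, ?_, fun h => (h₃ h).elim⟩, fun _ => trivial⟩
    · rintro w f args rfl
      exact (h₁ (tag_app _ _)).elim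
    · rintro w R args - rfl
      exact (h₂ (tag_ratom _ _)).elim
  · refine isCodeOf_top.congr fun M ρ =>
      ⟨fun _ => ⟨?_, ?_, fun _ h => (h₀ h).elim⟩, fun _ => trivial⟩
    · rintro w f args rfl
      exact (h₀ (sortOf_node _)).elim
    · rintro w R args hw rfl
      exact (h₀ (sortOf_ratom R args hw)).elim

theorem isCodeOf_negConj_lits (hS : S.IsPure) (hσ : σ ≠ 0) {φ : Formula S} {a : ℕ}
    (ha : a < numAssign φ.code) :
    IsCodeOf (S := S) σ (nodeVars φ.code σ ∪ keyVars φ.code σ)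
      (codeNegConj (codeLits φ.code σ a))
      fun M ρ => ¬ ∀ p ∈ nodes φ.code, Describes φ.code a p σ M ρ ∧
        ∀ q ∈ nodes φ.code, Compares φ.code a p q σ ρ := by
  refine (isCodeOf_negConj _ ?_).congr fun M ρ => not_congr ?_
  · intro c hc
    obtain ⟨p, hp, hc⟩ := List.mem_flatMap.1 hc
    rcases List.mem_cons.1 hc with rfl | hc
    · exact ⟨_, isCodeOf_describe hS hσ ha hp⟩
    · obtain ⟨q, hq, rfl⟩ := List.mem_map.1 hc
      exact ⟨_, isCodeOf_compare hp hq⟩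
  · simp only [codeLits, List.forall_mem_flatMap, List.forall_mem_cons, List.forall_mem_map]
    refine forall₂_congr fun p hp => and_congr
      ((isCodeOf_describe hS hσ ha hp).holdsCode_iff M ρ) (forall₂_congr fun q hq =>
      (isCodeOf_compare hp hq).holdsCode_iff M ρ)

theorem isCodeOf_matrix (hS : S.IsPure) (hσ : σ ≠ 0) (φ : Formula S) (γ : ℕ) :
    IsCodeOf (S := S) σ (nodeVars φ.code σ ∪ keyVars φ.code σ) (codeMatrix k φ.code γ σ)
      fun M ρ => ∀ a < numAssign φ.code, Handles k γ a σ → Consistent φ.code γ a →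
        ¬ ∀ p ∈ nodes φ.code, Describes φ.code a p σ M ρ ∧
          ∀ q ∈ nodes φ.code, Compares φ.code a p q σ ρ := by
  have key : ∀ a < numAssign φ.code, IsCodeOf (S := S) σ (nodeVars φ.code σ ∪ keyVars φ.code σ)
      (open Classical in if Handles k γ a σ ∧ Consistent φ.code γ a then
        codeNegConj (codeLits φ.code σ a) else codeTop)
      fun M ρ => Handles k γ a σ → Consistent φ.code γ a →
        ¬ ∀ p ∈ nodes φ.code, Describes φ.code a p σ M ρ ∧
          ∀ q ∈ nodes φ.code, Compares φ.code a p q σ ρ := by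
    intro a ha
    split_ifs with h
    · exact (isCodeOf_negConj_lits hS hσ ha).congr fun M ρ => by simp [h.1, h.2]
    · exact isCodeOf_top.congr fun M ρ => by
        simp only [true_iff]
        exact fun h₁ h₂ => (h ⟨h₁, h₂⟩).elim
  refine ((isCodeOf_negConj _ ?_).imp isCodeOf_bot).congr fun M ρ => ?_
  · intro c hc
    obtain ⟨a, ha, rfl⟩ := List.mem_map.1 hc
    exact ⟨_, key a (List.mem_range.1 ha)⟩
  · simp only [List.forall_mem_map, List.mem_range]
    refine not_not.trans ?_
    exact forall₂_congr fun a ha => (key a ha).holdsCode_iff M ρ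

theorem exists_codeQuant_all {φ : Formula S} (hφ : φ.IsForall) (ho : φ.IsOver σ) (l : List ℕ) :
    ∃ ψ : Formula S, ψ.code = codeQuant 6 σ l φ.code ∧ ψ.IsForall ∧ ψ.IsOver σ ∧
      ψ.freeVars = φ.freeVars \ {v | ∃ x ∈ l, v = .fo σ x} ∧
      ψ.univVars = φ.univVars ∪ {v | ∃ x ∈ l, v = .fo σ x} ∧
      ∀ (M : Model.{u} S) ρ, ψ.MatrixHolds M ρ ↔ φ.MatrixHolds M ρ := by
  induction l with
  | nil => exact ⟨φ, rfl, hφ, ho, by simp, by simp, fun _ _ => Iff.rfl⟩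
  | cons x l ih =>
    obtain ⟨ψ, hc, hq, ho', hf, hu, hm⟩ := ih
    refine ⟨.all (.fo σ x) ψ, ?_, .all σ x hq, ⟨⟨x, rfl⟩, ho'⟩, ?_, ?_, hm⟩
    · simp only [codeQuant, List.foldr_cons] at hc ⊢
      rw [← hc]
      rfl
    · ext v
      simp only [Formula.freeVars, hf, List.mem_cons, Set.mem_sdiff, Set.mem_ofPred_eq,
        Set.mem_singleton_iff, exists_eq_or_imp, not_or]
      exact ⟨fun ⟨⟨a, b⟩, c⟩ => ⟨a, c, b⟩, fun ⟨a, c, b⟩ => ⟨⟨a, b⟩, c⟩⟩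
    · ext v
      simp only [Formula.univVars, hu, List.mem_cons, Set.mem_union, Set.mem_ofPred_eq,
        Set.mem_singleton_iff, exists_eq_or_imp]
      tauto

theorem exists_codeQuant_ex {φ : Formula S} (hφ : φ.IsExistsForall) (ho : φ.IsOver σ)
    (l : List ℕ) :
    ∃ ψ : Formula S, ψ.code = codeQuant 5 σ l φ.code ∧ ψ.IsExistsForall ∧ ψ.IsOver σ ∧
      ψ.freeVars = φ.freeVars \ {v | ∃ x ∈ l, v = .fo σ x} ∧
      ψ.univVars = φ.univVars ∧
      ∀ (M : Model.{u} S) ρ, ψ.MatrixHolds M ρ ↔ φ.MatrixHolds M ρ := by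
  induction l with
  | nil => exact ⟨φ, rfl, hφ, ho, by simp, by simp, fun _ _ => Iff.rfl⟩
  | cons x l ih =>
    obtain ⟨ψ, hc, hq, ho', hf, hu, hm⟩ := ih
    refine ⟨.ex (.fo σ x) ψ, ?_, .ex σ x hq, ⟨⟨x, rfl⟩, ho'⟩, ?_, hu, hm⟩
    · simp only [codeQuant, List.foldr_cons] at hc ⊢
      rw [← hc]
      rfl
    · ext v
      simp only [Formula.freeVars, hf, List.mem_cons, Set.mem_sdiff, Set.mem_ofPred_eq,
        Set.mem_singleton_iff, exists_eq_or_imp, not_or]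
      exact ⟨fun ⟨⟨a, b⟩, c⟩ => ⟨a, c, b⟩, fun ⟨a, c, b⟩ => ⟨⟨a, b⟩, c⟩⟩

/-- The meaning of the sentence that is passed to the solver of the sort `σ`. -/
theorem exists_codeCall (hS : S.IsPure) (hσ : σ ≠ 0) (φ : Formula S) (γ : ℕ) :
    ∃ χ ∈ efSentences S σ, χ.code = codeCall k φ.code γ σ ∧
      ∀ M : Model.{u} S, M.Satisfies χ ↔ ∃ ρ : Valuation M.carrier, ∀ ρ' : Valuation M.carrier,
        (∀ v, v ∉ nodeVars φ.code σ → ρ' v = ρ v) →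
        ∀ a < numAssign φ.code, Handles k γ a σ → Consistent φ.code γ a →
        ¬ ∀ p ∈ nodes φ.code, Describes φ.code a p σ M ρ' ∧
          ∀ q ∈ nodes φ.code, Compares φ.code a p q σ ρ' := by
  obtain ⟨ψ₀, hc₀, hq₀, ho₀, hf₀, hm₀⟩ := isCodeOf_matrix.{u} hS hσ φ γ
  obtain ⟨ψ₁, hc₁, hq₁, ho₁, hf₁, hu₁, hm₁⟩ := exists_codeQuant_all.{u} (.qf hq₀) ho₀
    ((nodes φ.code).map fun p => 2 * p)
  obtain ⟨χ, hc, hq, ho, hf, hu, hm⟩ := exists_codeQuant_ex.{u} (.univ hq₁) ho₁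
    ((keys φ.code).map fun x => 2 * x + 1)
  have hnode : {v | ∃ x ∈ (nodes φ.code).map fun p => 2 * p, v = Var.fo σ x} =
      nodeVars φ.code σ := by
    ext v; simp [nodeVars]
  have hkey : {v | ∃ x ∈ (keys φ.code).map fun x => 2 * x + 1, v = Var.fo σ x} =
      keyVars φ.code σ := by
    ext v; simp [keyVars]
  rw [hnode] at hf₁ hu₁
  rw [hkey] at hf
  rw [hq₀.univVars_eq, Set.empty_union] at hu₁
  have hs : χ.IsSentence := by
    rw [Formula.IsSentence, hf, hf₁, Set.sdiff_sdiff]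
    exact Set.sdiff_eq_empty.2 hf₀
  refine ⟨χ, ⟨hq, ho, hs⟩, by rw [hc, hc₁, hc₀]; rfl, fun M => ?_⟩
  -- An `∃*∀*` sentence has EQSMT form, so the analysis of prefixes applies to it too; its universal
  -- variables are the node variables.
  rw [hq.hasEQSMTForm.satisfies_iff hs]
  refine exists_congr fun ρ => forall_congr' fun ρ' => ?_
  rw [hu, hu₁, hm, hm₁, ← hq₀.holds_iff, hm₀]

end Output

/-! ### Finite functions as digit expansions -/

section Digits

theorem exists_digits {B : ℕ} (L : ℕ) (f : ℕ → ℕ) (hf : ∀ j < L, f j < B) :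
    ∃ a < B ^ L, ∀ j < L, digit B a j = f j := by
  induction L with
  | zero => exact ⟨0, by simp, by simp⟩
  | succ L ih =>
    obtain ⟨a, ha, h⟩ := ih fun j hj => hf j (by omega)
    have hB : 0 < B := (Nat.zero_le _).trans_lt (hf L (by omega))
    have hL := hf L (by omega)
    refine ⟨a + f L * B ^ L, ?_, fun j hj => ?_⟩
    · calc a + f L * B ^ L < B ^ L + f L * B ^ L := by omega
        _ = (f L + 1) * B ^ L := by ring
        _ ≤ B * B ^ L := Nat.mul_le_mul_right _ hL
        _ = B ^ (L + 1) := by ring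
    · rcases Nat.lt_succ_iff_lt_or_eq.1 hj with hj | rfl
      · rw [← h j hj]
        unfold digit
        -- For `j < L`, a new digit at place `L` changes the quotient by `B ^ j` by a multiple of
        -- `B`, so the digit at place `j` survives.
        obtain ⟨d, rfl⟩ : ∃ d, L = j + 1 + d := ⟨L - (j + 1), by omega⟩
        have : a + f (j + 1 + d) * B ^ (j + 1 + d) =
            a + B ^ j * (B * (f (j + 1 + d) * B ^ d)) := by ring
        rw [this, Nat.add_mul_div_left _ _ (pow_pos hB j), Nat.add_mul_mod_self_left]
      · unfold digit
        rw [Nat.add_mul_div_right _ _ (pow_pos hB j), Nat.div_eq_of_lt ha, zero_add,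
          Nat.mod_eq_of_lt hL]

theorem exists_assignment (n : ℕ) (v : ℕ → ℕ) (hv : ∀ p < 2 * n + 2, v p < base n) :
    ∃ a < numAssign n, ∀ p < 2 * n + 2, val n a p = v p :=
  exists_digits _ v hv

end Digits

/-! ### What a key determines -/

section Keys

open Encodable

variable {k : ℕ} {S : Signature k} [∀ w σ, Encodable (S.Func w σ)]
  {w : List (Srt k)} {σ : Srt k} {m a c : ℕ}

theorem unpair_headSym (p : ℕ) : (headSym p).unpair.1 = tag p := by
  unfold headSym
  split_ifs with h
  · rw [h]
    unfold tag at h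
    split_ifs at h
    exact h
  · simp

theorem headSym_var : headSym (Term.var (S := S) σ c).node = (Var.fo σ c).code := by
  simp [headSym, tag_var, Term.node_half, Term.code, Var.code]

theorem headSym_fapp (args : ∀ j : Fin w.length, Term S (w.get j)) :
    headSym (Term.fapp w σ c args).node = Nat.pair 2 (Nat.pair (encode (w, σ)) c) := by
  rw [headSym, tag_fapp]
  simp [Term.node_half, Term.code, typ, arg]

theorem key_var : key m a (Term.var (S := S) σ c).node =
    Nat.pair (Var.fo σ c).code (encode ([] : List ℕ)) := by
  rw [key, headSym_var, children_var, List.map_nil]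

theorem key_fapp (args : ∀ j : Fin w.length, Term S (w.get j)) :
    key m a (Term.fapp w σ c args).node =
      Nat.pair (Nat.pair 2 (Nat.pair (encode (w, σ)) c))
        (encode (List.ofFn fun j => val m a (args j).node)) := by
  rw [key, headSym_fapp, children_fapp, List.map_ofFn]
  rfl

theorem arg_mem_nodes_app {n : ℕ} {f : S.Func w σ} {args : ∀ j : Fin w.length, Term S (w.get j)}
    (h : (Term.app f args).node ∈ nodes n) (j : Fin w.length) : (args j).node ∈ nodes n :=
  child_mem_nodes h (by rw [children_app, List.mem_ofFn]; exact ⟨j, rfl⟩)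

theorem arg_mem_nodes_fapp {n : ℕ} {args : ∀ j : Fin w.length, Term S (w.get j)}
    (h : (Term.fapp w σ c args).node ∈ nodes n) (j : Fin w.length) : (args j).node ∈ nodes n :=
  child_mem_nodes h (by rw [children_fapp, List.mem_ofFn]; exact ⟨j, rfl⟩)

theorem isEx_var_iff {n : ℕ} :
    IsEx n (Term.var (S := S) σ c).node ↔ (Var.fo σ c).code ∉ univs n := by
  simp [IsEx, tag_var, headVar_var]

theorem isEx_fapp_iff {n : ℕ} {args : ∀ j : Fin w.length, Term S (w.get j)} :
    IsEx n (Term.fapp w σ c args).node ↔ (Var.fn w σ c).code ∉ univs n := by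
  simp [IsEx, tag_fapp, headVar_fapp]

variable [∀ w, Encodable (S.Rel w)]

theorem headSym_rapp (args : ∀ j : Fin w.length, Term S (w.get j)) :
    headSym (Formula.rapp w c args).node = Nat.pair 7 (Nat.pair (encode w) c) := by
  rw [headSym, tag_rapp]
  simp [Formula.node_half, Formula.code, typ, arg]

theorem key_rapp (args : ∀ j : Fin w.length, Term S (w.get j)) :
    key m a (Formula.rapp w c args).node =
      Nat.pair (Nat.pair 7 (Nat.pair (encode w) c))
        (encode (List.ofFn fun j => val m a (args j).node)) := by
  rw [key, headSym_rapp, children_rapp, List.map_ofFn]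
  rfl

/-- The key records the tag, type and name of the head together with the values of the arguments.
This makes equality of keys the premise of the congruence law. -/
theorem eq_fapp_of_key_eq {φ : Formula S} {q : ℕ} (hq : q ∈ nodes φ.code)
    {args : ∀ j : Fin w.length, Term S (w.get j)}
    (h : key m a q = key m a (Term.fapp w σ c args).node) :
    ∃ args' : ∀ j : Fin w.length, Term S (w.get j), q = (Term.fapp w σ c args').node ∧
      ∀ j, val m a (args' j).node = val m a (args j).node := by
  have ht : tag q = 2 := by
    have h₁ := congrArg (fun x => x.unpair.1.unpair.1) h
    simpa [key, unpair_headSym, tag_fapp] using h₁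
  rcases isSubNode_of_mem_nodes hq with ⟨τ, t, rfl, -⟩ | ⟨ψ, rfl, -⟩
  · cases t with
    | var => rw [tag_var] at ht; omega
    | app => rw [tag_app] at ht; omega
    | fapp w' _ c' args' =>
      rw [key_fapp, key_fapp, Nat.pair_eq_pair, Nat.pair_eq_pair, Nat.pair_eq_pair, encode_inj,
        encode_inj, Prod.mk.injEq] at h
      obtain ⟨⟨-, ⟨rfl, rfl⟩, rfl⟩, h⟩ := h
      exact ⟨args', rfl, fun j => congrFun (List.ofFn_injective h) j⟩
  · have := lt_tag_node ψ
    omega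

theorem eq_rapp_of_key_eq {φ : Formula S} {q : ℕ} (hq : q ∈ nodes φ.code)
    {args : ∀ j : Fin w.length, Term S (w.get j)}
    (h : key m a q = key m a (Formula.rapp w c args).node) :
    ∃ args' : ∀ j : Fin w.length, Term S (w.get j), q = (Formula.rapp w c args').node ∧
      ∀ j, val m a (args' j).node = val m a (args j).node := by
  have ht : tag q = 7 := by
    have h₁ := congrArg (fun x => x.unpair.1.unpair.1) h
    simpa [key, unpair_headSym, tag_rapp] using h₁
  rcases isSubNode_of_mem_nodes hq with ⟨τ, t, rfl, -⟩ | ⟨ψ, rfl, -⟩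
  · have := tag_node_le t
    omega
  · cases ψ with
    | rapp w' c' args' =>
      rw [key_rapp, key_rapp, Nat.pair_eq_pair, Nat.pair_eq_pair, Nat.pair_eq_pair, encode_inj,
        encode_inj] at h
      obtain ⟨⟨-, rfl, rfl⟩, h⟩ := h
      exact ⟨args', rfl, fun j => congrFun (List.ofFn_injective h) j⟩
    | bot => rw [tag_bot] at ht; omega
    | imp => rw [tag_imp] at ht; omega
    | eq => rw [tag_eq] at ht; omega
    | ratom => rw [tag_ratom] at ht; omega
    | ex => rw [tag_ex] at ht; omega
    | all => rw [tag_all] at ht; omega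

theorem arg_mem_nodes_ratom {n : ℕ} {R : S.Rel w} {args : ∀ j : Fin w.length, Term S (w.get j)}
    (h : (Formula.ratom R args).node ∈ nodes n) (j : Fin w.length) : (args j).node ∈ nodes n :=
  child_mem_nodes h (by rw [children_ratom, List.mem_ofFn]; exact ⟨j, rfl⟩)

theorem arg_mem_nodes_rapp {n : ℕ} {args : ∀ j : Fin w.length, Term S (w.get j)}
    (h : (Formula.rapp w c args).node ∈ nodes n) (j : Fin w.length) : (args j).node ∈ nodes n :=
  child_mem_nodes h (by rw [children_rapp, List.mem_ofFn]; exact ⟨j, rfl⟩)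

theorem vars_subset_of_mem_nodes {φ : Formula S} {t : Term S σ} (h : t.node ∈ nodes φ.code) :
    t.vars ⊆ φ.atomVars := by
  rcases isSubNode_of_mem_nodes h with ⟨τ, s, hs, hv⟩ | ⟨ψ, hψ, -⟩
  · obtain rfl := sort_eq_of_node_eq hs
    rwa [Term.node_injective hs]
  · exact (node_ne_node hψ).elim

theorem atomVars_subset_of_mem_nodes {φ ψ : Formula S} (h : ψ.node ∈ nodes φ.code) :
    ψ.atomVars ⊆ φ.atomVars := by
  rcases isSubNode_of_mem_nodes h with ⟨τ, s, hs, hv⟩ | ⟨χ, hχ, hv, -⟩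
  · exact (node_ne_node hs.symm).elim
  · rwa [Formula.node_injective hχ]

theorem isExistential_of_not_mem_univs {φ : Formula S} (h : φ ∈ eqsmtSentences S) {v : Var k}
    (hv : v ∈ φ.atomVars) (hu : v.code ∉ univs φ.code) : v.IsExistential := by
  rw [mem_univs_iff h.1] at hu
  rcases h.1.atomVars_subset hv with h₁ | h₁ | h₁
  · exact (hu h₁).elim
  · rw [h.2] at h₁
    exact h₁.elim
  · exact h₁

theorem isEx_rapp_iff {n : ℕ} {args : ∀ j : Fin w.length, Term S (w.get j)} :
    IsEx n (Formula.rapp w c args).node ↔ (Var.rel w c).code ∉ univs n := by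
  simp [IsEx, tag_rapp, headVar_rapp]

end Keys

/-! ### The assignment induced by a valuation -/

section Evaluation

open Classical

variable {k : ℕ} {S : Signature k} [∀ w σ, Encodable (S.Func w σ)] [∀ w, Encodable (S.Rel w)]

/-- The value of a node, where values of terms are labelled by numbers. -/
noncomputable def nodeVal (M : Model.{u} S) (ρ : Valuation M.carrier)
    (lab : ∀ σ, M.carrier σ → ℕ) (p : ℕ) : ℕ :=
  if h : ∃ x : (σ : Srt k) × Term S σ, p = x.2.node then lab _ (h.choose.2.eval M ρ)
  else if ∃ ψ : Formula S, p = ψ.node ∧ ψ.MatrixHolds M ρ then 1 else 0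

variable {M : Model.{u} S} {ρ : Valuation M.carrier} {lab : ∀ σ, M.carrier σ → ℕ}

theorem nodeVal_term {σ : Srt k} (t : Term S σ) :
    nodeVal M ρ lab t.node = lab σ (t.eval M ρ) := by
  have h : ∃ x : (σ : Srt k) × Term S σ, t.node = x.2.node := ⟨⟨σ, t⟩, rfl⟩
  rw [nodeVal, dif_pos h]
  obtain ⟨⟨τ, s⟩, hx⟩ : ∃ y, h.choose = y := ⟨_, rfl⟩
  have hs : t.node = s.node := by
    have := h.choose_spec
    rwa [hx] at this
  obtain rfl := sort_eq_of_node_eq hs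
  obtain rfl := Term.node_injective hs
  rw [hx]

theorem nodeVal_formula (ψ : Formula S) : nodeVal M ρ lab ψ.node ≠ 0 ↔ ψ.MatrixHolds M ρ := by
  have h : ¬ ∃ x : (σ : Srt k) × Term S σ, ψ.node = x.2.node := by
    rintro ⟨x, hx⟩
    exact node_ne_node hx.symm
  rw [nodeVal, dif_neg h]
  split_ifs with h'
  · obtain ⟨χ, hχ, hM⟩ := h'
    simpa [Formula.node_injective hχ] using hM
  · simpa using fun hM => h' ⟨ψ, rfl, hM⟩

theorem nodeVal_formula_le (ψ : Formula S) : nodeVal M ρ lab ψ.node ≤ 1 := by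
  have h : ¬ ∃ x : (σ : Srt k) × Term S σ, ψ.node = x.2.node := by
    rintro ⟨x, hx⟩
    exact node_ne_node hx.symm
  rw [nodeVal, dif_neg h]
  split_ifs <;> simp

theorem nodeVal_eq_of_iff {ψ χ : Formula S} (h : ψ.MatrixHolds M ρ ↔ χ.MatrixHolds M ρ) :
    nodeVal M ρ lab ψ.node = nodeVal M ρ lab χ.node := by
  rw [← nodeVal_formula (lab := lab), ← nodeVal_formula (lab := lab)] at h
  have h₁ := nodeVal_formula_le (M := M) (ρ := ρ) (lab := lab) ψ
  have h₂ := nodeVal_formula_le (M := M) (ρ := ρ) (lab := lab) χ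
  omega

/-- The assignment that is induced by an interpretation of the variables is consistent. -/
theorem consistent_of_val_eq {φ : Formula S} {a γ : ℕ}
    (hlab : ∀ (σ : Srt k) (s t : Term S σ), s.node ∈ nodes φ.code → t.node ∈ nodes φ.code →
      lab σ (s.eval M ρ) = lab σ (t.eval M ρ) → s.eval M ρ = t.eval M ρ)
    (ha : ∀ p ∈ nodes φ.code, val φ.code a p = nodeVal M ρ lab p)
    (hsize : ∀ x : M.carrier 0, lab 0 x < fgSize γ)
    (hvar : ∀ c, (Var.fo (k := k) 0 c).code ∉ univs φ.code →
      lab 0 (foVal ρ 0 c) = fgVal φ.code γ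
        (Nat.pair (Var.fo (k := k) 0 c).code (Encodable.encode ([] : List ℕ))) % fgSize γ)
    (hrel : ∀ w c (args : ∀ j : Fin w.length, Term S (w.get j)),
      (Formula.rapp w c args).node ∈ nodes φ.code → (Var.rel w c).code ∉ univs φ.code →
      ((Formula.rapp w c args).MatrixHolds M ρ ↔
        fgVal φ.code γ (key φ.code a (Formula.rapp w c args).node) ≠ 0)) :
    Consistent φ.code γ a := by
  have hterm : ∀ {σ : Srt k} (t : Term S σ), t.node ∈ nodes φ.code →
      val φ.code a t.node = lab σ (t.eval M ρ) := fun t ht => by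
    rw [ha _ ht, nodeVal_term]
  have hform : ∀ ψ : Formula S, ψ.node ∈ nodes φ.code →
      (val φ.code a ψ.node ≠ 0 ↔ ψ.MatrixHolds M ρ) := fun ψ hψ => by
    rw [ha _ hψ, nodeVal_formula]
  -- Labels are injective on the values of nodes, so equal keys come from equal argument tuples.
  -- Congruence follows from this.
  have hargs : ∀ {w : List (Srt k)} {args args' : ∀ j : Fin w.length, Term S (w.get j)},
      (∀ j, (args j).node ∈ nodes φ.code) → (∀ j, (args' j).node ∈ nodes φ.code) →
      (∀ j, val φ.code a (args' j).node = val φ.code a (args j).node) →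
      (fun j => (args' j).eval M ρ) = fun j => (args j).eval M ρ := by
    intro w args args' h h' hv
    funext j
    refine hlab _ _ _ (h' j) (h j) ?_
    rw [← hterm _ (h' j), ← hterm _ (h j), hv]
  intro p hp
  rcases isSubNode_of_mem_nodes hp with ⟨σ, t, rfl, -⟩ | ⟨ψ, rfl, -⟩
  · have hle := tag_node_le t
    refine ⟨fun _ h₀ => ?_, ?_, by omega, by omega, by omega, by omega, ?_, by omega⟩
    · rw [sortOf_node] at h₀
      obtain rfl : σ = 0 := Fin.ext h₀
      rw [hterm t hp]
      exact hsize _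
    · intro ht q hq hkey
      cases t with
      | var => rw [tag_var] at ht; omega
      | app => rw [tag_app] at ht; omega
      | fapp w _ c args =>
        obtain ⟨args', rfl, hv⟩ := eq_fapp_of_key_eq hq hkey
        rw [hterm _ hq, hterm _ hp]
        simp only [Term.eval, hargs (arg_mem_nodes_fapp hp) (arg_mem_nodes_fapp hq) hv]
    · intro hex ht h₀
      rw [sortOf_node] at h₀
      obtain rfl : σ = 0 := Fin.ext h₀
      cases t with
      | var σ c =>
        rw [hterm _ hp, key_var, ← hvar c (isEx_var_iff.1 hex)]
        rfl
      | app => rw [tag_app] at ht; omega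
      | fapp => rw [tag_fapp] at ht; omega
  · have hlt := lt_tag_node ψ
    refine ⟨by omega, ?_, ?_, ?_, ?_, ?_, by omega, ?_⟩
    · intro ht q hq hkey
      cases ψ with
      | rapp w c args =>
        obtain ⟨args', rfl, hv⟩ := eq_rapp_of_key_eq hq hkey
        rw [ha _ hq, ha _ hp]
        refine nodeVal_eq_of_iff ?_
        simp only [Formula.MatrixHolds, hargs (arg_mem_nodes_rapp hp) (arg_mem_nodes_rapp hq) hv]
      | bot => rw [tag_bot] at ht; omega
      | imp => rw [tag_imp] at ht; omega
      | eq => rw [tag_eq] at ht; omega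
      | ratom => rw [tag_ratom] at ht; omega
      | ex => rw [tag_ex] at ht; omega
      | all => rw [tag_all] at ht; omega
    · intro ht
      cases ψ with
      | bot => exact not_not.1 fun h => (hform _ hp).1 h
      | rapp => rw [tag_rapp] at ht; omega
      | imp => rw [tag_imp] at ht; omega
      | eq => rw [tag_eq] at ht; omega
      | ratom => rw [tag_ratom] at ht; omega
      | ex => rw [tag_ex] at ht; omega
      | all => rw [tag_all] at ht; omega
    · intro ht
      cases ψ with
      | imp ψ χ =>
        rw [hform _ hp, children_imp]
        exact imp_congr
          (hform _ (child_mem_nodes hp (by rw [children_imp]; simp))).symm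
          (hform _ (child_mem_nodes hp (by rw [children_imp]; simp))).symm
      | bot => rw [tag_bot] at ht; omega
      | rapp => rw [tag_rapp] at ht; omega
      | eq => rw [tag_eq] at ht; omega
      | ratom => rw [tag_ratom] at ht; omega
      | ex => rw [tag_ex] at ht; omega
      | all => rw [tag_all] at ht; omega
    · intro ht
      cases ψ with
      | eq s t =>
        have hs : s.node ∈ nodes φ.code := child_mem_nodes hp (by rw [children_eq]; simp)
        have ht : t.node ∈ nodes φ.code := child_mem_nodes hp (by rw [children_eq]; simp)
        rw [hform _ hp, children_eq]
        change s.eval M ρ = t.eval M ρ ↔ val φ.code a s.node = val φ.code a t.node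
        rw [hterm _ hs, hterm _ ht]
        exact ⟨fun h => by rw [h], hlab _ _ _ hs ht⟩
      | bot => rw [tag_bot] at ht; omega
      | rapp => rw [tag_rapp] at ht; omega
      | imp => rw [tag_imp] at ht; omega
      | ratom => rw [tag_ratom] at ht; omega
      | ex => rw [tag_ex] at ht; omega
      | all => rw [tag_all] at ht; omega
    · intro ht
      cases ψ with
      | ex v ψ =>
        rw [children_ex, ha _ hp]
        refine Eq.trans ?_ (ha _ (child_mem_nodes hp (by rw [children_ex]; simp))).symm
        exact nodeVal_eq_of_iff Iff.rfl
      | all v ψ =>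
        rw [children_all, ha _ hp]
        refine Eq.trans ?_ (ha _ (child_mem_nodes hp (by rw [children_all]; simp))).symm
        exact nodeVal_eq_of_iff Iff.rfl
      | bot => rw [tag_bot] at ht; omega
      | rapp => rw [tag_rapp] at ht; omega
      | imp => rw [tag_imp] at ht; omega
      | eq => rw [tag_eq] at ht; omega
      | ratom => rw [tag_ratom] at ht; omega
    · intro hex ht
      cases ψ with
      | rapp w c args => rw [hform _ hp, hrel w c args hp (isEx_rapp_iff.1 hex)]
      | bot => rw [tag_bot] at ht; omega
      | imp => rw [tag_imp] at ht; omega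
      | eq => rw [tag_eq] at ht; omega
      | ratom => rw [tag_ratom] at ht; omega
      | ex => rw [tag_ex] at ht; omega
      | all => rw [tag_all] at ht; omega

end Evaluation

/-! ### Gluing background structures along a finite foreground -/

section Glue

open Classical

variable {k : ℕ} {S : Signature k}

/-- A foreground universe of size `m` together with the background universes of given structures. -/
def GlueCarrier (m : ℕ) (N : Fin k → Model.{u} S) : Srt k → Type u :=
  Fin.cases (ULift (Fin m)) fun i => (N i).carrier i.succ

variable {m : ℕ} (N : Fin k → Model.{u} S)

theorem glueCarrier_eq {i : Fin k} {τ : Srt k} (h : τ = i.succ) :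
    GlueCarrier m N τ = (N i).carrier τ := by
  subst h; rfl

/-- The identification of the sort `i` of the glued structure with the sort `i` of `N i`. -/
noncomputable def glueMap (i : Fin k) (τ : Srt k) (x : GlueCarrier m N τ) : (N i).carrier τ :=
  if h : τ = i.succ then cast (glueCarrier_eq N h) x else ((N i).nonempty τ).some

theorem glueMap_self (i : Fin k) (x : (N i).carrier i.succ) :
    glueMap (m := m) N i i.succ x = x :=
  dif_pos (c := i.succ = i.succ) rfl

/-- The structure with a foreground universe of size `m` that agrees with `N i` on the sort `i`. -/
noncomputable def glue (hm : 0 < m) : Model.{u} S where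
  carrier := GlueCarrier m N
  nonempty σ := by
    refine Fin.cases ?_ (fun i => ?_) σ
    · exact ⟨ULift.up ⟨0, hm⟩⟩
    · exact (N i).nonempty i.succ
  func {w σ} f a :=
    -- The value in sort `0` is a default: a pure signature has no function symbols there.
    Fin.cases (motive := fun σ => S.Func w σ → GlueCarrier m N σ) (fun _ => ULift.up ⟨0, hm⟩)
      (fun i f => (N i).func f fun j => glueMap N i _ (a j)) σ f
  rel {w} R a := ∃ i : Fin k, (∀ τ ∈ w, τ = i.succ) ∧ (N i).rel R fun j => glueMap N i _ (a j)

/-- The index that `glue` chooses for a relation atom is determined by the sort of the first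
argument, which exists because words of relation symbols are nonempty. -/
noncomputable def glueIso (hm : 0 < m) (i : Fin k) : SortIso (glue N hm) (N i) i.succ where
  map := glueMap N i
  bijective := by
    have : glueMap (m := m) N i i.succ = id := funext fun x => glueMap_self N i x
    rw [this]
    exact Function.bijective_id
  map_func f a _ := glueMap_self N i _
  map_rel {w} R a hw := by
    constructor
    · rintro ⟨i', hw', h⟩
      cases w with
      | nil => exact (S.rel_nil.false R).elim
      | cons τ w =>
        have h₁ := hw τ (by simp)
        have h₂ := hw' τ (by simp)
        obtain rfl : i' = i := Fin.succ_injective _ (h₂.symm.trans h₁)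
        exact h
    · exact fun h => ⟨i, hw, h⟩

end Glue

/-! ### From a successful guess to a model -/

section Soundness

open Classical Encodable

variable {k : ℕ} {S : Signature k} [∀ w σ, Encodable (S.Func w σ)]

/-- The label of a foreground element. -/
def fgLabel {m : ℕ} (N : Fin k → Model.{u} S) (τ : Srt k) : GlueCarrier m N τ → ℕ :=
  Fin.cases (motive := fun τ => GlueCarrier m N τ → ℕ) (fun x => x.down.val) (fun _ _ => 0) τ

/-- The existential variables of the glued structure, interpreted as prescribed by `γ` and by
interpretations of the variables in the background structures. -/
noncomputable def glueValuation {m : ℕ} (N : Fin k → Model.{u} S) (hm : 0 < m) (n γ : ℕ)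
    (ρ : ∀ i, Valuation (N i).carrier) : Valuation (GlueCarrier m N)
  | .fo τ c =>
      Fin.cases (motive := fun τ => GlueCarrier m N τ)
        (ULift.up ⟨fgVal n γ (Nat.pair (Var.fo (k := k) 0 c).code (encode ([] : List ℕ))) % m,
          Nat.mod_lt _ hm⟩)
        (fun i => foVal (ρ i) i.succ
          (2 * Nat.pair (Var.fo i.succ c).code (encode ([] : List ℕ)) + 1)) τ
  | .fn w τ c => fun x : Tuple (GlueCarrier m N) w =>
      Fin.cases (motive := fun τ => GlueCarrier m N τ) (ULift.up ⟨0, hm⟩)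
        (fun i => foVal (ρ i) i.succ
          (2 * Nat.pair (Nat.pair 2 (Nat.pair (encode (w, i.succ)) c))
            (encode (List.ofFn fun j => fgLabel N _ (x j))) + 1)) τ
  | .rel w c => fun x : Tuple (GlueCarrier m N) w =>
      fgVal n γ (Nat.pair (Nat.pair 7 (Nat.pair (encode w) c))
        (encode (List.ofFn fun j => fgLabel N _ (x j)))) ≠ 0

/-- The interpretation of the variables of the emitted sentence by the values of the nodes. -/
noncomputable def nodeValuation {m : ℕ} (N : Fin k → Model.{u} S) (hm : 0 < m) (n : ℕ)
    (ρ : Valuation (glue N hm).carrier) (i : Fin k) (ρ₀ : Valuation (N i).carrier) :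
    Valuation (N i).carrier
  | .fo τ x =>
      if h : ∃ t : Term S τ, t.node ∈ nodes n ∧ x = 2 * t.node ∧ τ = i.succ then
        glueMap N i τ (h.choose.eval (glue N hm) ρ)
      else ρ₀ (.fo τ x)
  | .fn w τ c => ρ₀ (.fn w τ c)
  | .rel w c => ρ₀ (.rel w c)

theorem nodeValuation_term {m : ℕ} (N : Fin k → Model.{u} S) (hm : 0 < m) {n : ℕ}
    (ρ : Valuation (glue N hm).carrier) (i : Fin k) (ρ₀ : Valuation (N i).carrier)
    {τ : Srt k} (hτ : τ = i.succ) {t : Term S τ} (ht : t.node ∈ nodes n) :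
    foVal (nodeValuation N hm n ρ i ρ₀) τ (2 * t.node) =
      glueMap N i τ (t.eval (glue N hm) ρ) := by
  have h : ∃ s : Term S τ, s.node ∈ nodes n ∧ 2 * t.node = 2 * s.node ∧ τ = i.succ :=
    ⟨t, ht, rfl, hτ⟩
  have h₁ : h.choose = t := Term.node_injective (by have := h.choose_spec.2.1; omega)
  exact (dif_pos h).trans (congrArg (fun s : Term S τ => glueMap N i τ (s.eval (glue N hm) ρ)) h₁)

theorem nodeValuation_succ {m : ℕ} (N : Fin k → Model.{u} S) (hm : 0 < m) {n : ℕ}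
    (ρ : Valuation (glue N hm).carrier) (i : Fin k) (ρ₀ : Valuation (N i).carrier)
    {t : Term S i.succ} (ht : t.node ∈ nodes n) :
    foVal (nodeValuation N hm n ρ i ρ₀) i.succ (2 * t.node) =
      (show (N i).carrier i.succ from t.eval (glue N hm) ρ) :=
  (nodeValuation_term N hm ρ i ρ₀ rfl ht).trans (glueMap_self N i _)

theorem nodeValuation_of_ne {m : ℕ} (N : Fin k → Model.{u} S) (hm : 0 < m) {n : ℕ}
    (ρ : Valuation (glue N hm).carrier) (i : Fin k) (ρ₀ : Valuation (N i).carrier)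
    {v : Var k} (hv : v ∉ nodeVars n i.succ) :
    nodeValuation N hm n ρ i ρ₀ v = ρ₀ v := by
  cases v with
  | fo τ x =>
    refine dif_neg ?_
    rintro ⟨t, ht, rfl, rfl⟩
    exact hv ⟨_, ht, rfl⟩
  | fn => rfl
  | rel => rfl

/-- Labels of all elements: foreground elements are labelled by their number, and the value of a
background term by the least node that has this value. -/
noncomputable def label {m : ℕ} (N : Fin k → Model.{u} S) (hm : 0 < m)
    (ρ : Valuation (glue N hm).carrier) (τ : Srt k) (x : (glue N hm).carrier τ) : ℕ :=
  if τ = 0 then fgLabel N τ x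
  else sInf {q | ∃ t : Term S τ, q = t.node ∧ t.eval (glue N hm) ρ = x}

/-- For a background value, the least node is attained by a term with this value, and a node
determines its term. Foreground labels are the elements themselves. -/
theorem label_injective {m : ℕ} (N : Fin k → Model.{u} S) (hm : 0 < m)
    (ρ : Valuation (glue N hm).carrier) {τ : Srt k} (s t : Term S τ)
    (h : label N hm ρ τ (s.eval _ ρ) = label N hm ρ τ (t.eval _ ρ)) :
    s.eval (glue N hm) ρ = t.eval (glue N hm) ρ := by
  unfold label at h
  split_ifs at h with h₀
  · subst h₀
    exact ULift.ext _ _ (Fin.ext h)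
  · have key : ∀ t : Term S τ, ∃ t' : Term S τ,
        sInf {q | ∃ t' : Term S τ, q = t'.node ∧ t'.eval (glue N hm) ρ = t.eval _ ρ} = t'.node ∧
          t'.eval (glue N hm) ρ = t.eval _ ρ := fun t =>
      Nat.sInf_mem (s := {q | ∃ t' : Term S τ, q = t'.node ∧ t'.eval (glue N hm) ρ = t.eval _ ρ})
        ⟨_, t, rfl, rfl⟩
    obtain ⟨s', hs, hs'⟩ := key s
    obtain ⟨t', ht, ht'⟩ := key t
    rw [hs, ht] at h
    rw [← hs', ← ht', Term.node_injective h]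

theorem label_lt {m n : ℕ} (N : Fin k → Model.{u} S) (hm : 0 < m) (hmn : m ≤ n + 1)
    (ρ : Valuation (glue N hm).carrier) {τ : Srt k} {t : Term S τ} (ht : t.node < 2 * n + 2) :
    label N hm ρ τ (t.eval _ ρ) < base n := by
  unfold label base
  split_ifs with h₀
  · subst h₀
    have : fgLabel N 0 (t.eval (glue N hm) ρ) < m :=
      (show ULift (Fin m) from t.eval (glue N hm) ρ).down.isLt
    omega
  · have : sInf {q | ∃ t' : Term S τ, q = t'.node ∧ t'.eval (glue N hm) ρ = t.eval _ ρ} ≤ t.node :=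
      Nat.sInf_le ⟨t, rfl, rfl⟩
    omega

variable [∀ w, Encodable (S.Rel w)]

theorem nodeVal_lt {M : Model.{u} S} {ρ : Valuation M.carrier} {lab : ∀ σ, M.carrier σ → ℕ}
    {B p : ℕ} (hB : 1 < B)
    (h : ∀ (σ : Srt k) (t : Term S σ), p = t.node → lab σ (t.eval M ρ) < B) :
    nodeVal M ρ lab p < B := by
  unfold nodeVal
  split_ifs with h₁
  · exact h _ _ h₁.choose_spec
  · exact hB
  · omega

/-- If a guess passes the test and the answers to its calls are positive, then the EQSMT sentence
is satisfiable. -/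
theorem satisfiable_of_covers (hS : S.IsPure) {φ : Formula S} (hφ : φ ∈ eqsmtSentences S)
    (T : UCT S) {γ : ℕ} (hγ : Covers k φ.code γ)
    (h : ∀ i : Fin k, ∃ χ ∈ efSentences S i.succ, χ.code = codeCall k φ.code γ (i + 1) ∧
      Satisfiable.{u} (T.theory i) χ) : Satisfiable.{u} T.union φ := by
  have h' : ∀ i : Fin k, ∃ N : Model.{u} S, (∀ α ∈ T.theory i, N.Satisfies α) ∧
      ∃ ρ : Valuation N.carrier, ∀ ρ' : Valuation N.carrier,
        (∀ v, v ∉ nodeVars φ.code i.succ → ρ' v = ρ v) →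
        ∀ a < numAssign φ.code, Handles k γ a (i + 1) → Consistent φ.code γ a →
        ¬ ∀ p ∈ nodes φ.code, Describes φ.code a p i.succ N ρ' ∧
          ∀ q ∈ nodes φ.code, Compares φ.code a p q i.succ ρ' := by
    intro i
    obtain ⟨χ, hχ, hc, N, hT, hN⟩ := h i
    obtain ⟨χ', hχ', hc', hsem⟩ := exists_codeCall.{u} hS (Fin.succ_ne_zero i) φ γ
    obtain rfl : χ = χ' := Formula.code_injective (hc.trans hc'.symm)
    exact ⟨N, hT, (hsem N).1 hN⟩
  choose N hT ρ hN using h'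
  obtain ⟨hm, hmn, hcov⟩ := hγ
  set n := φ.code with hn
  refine ⟨glue N hm, ?_, ?_⟩
  · intro α hα
    obtain ⟨i, hα⟩ := Set.mem_iUnion.1 hα
    exact (glueIso N hm i).satisfies (T.isOver i α hα) (hT i α hα)
  refine (hφ.1.satisfies_iff hφ.2 _).2 ⟨glueValuation N hm n γ ρ, fun ρ₂ hρ₂ => ?_⟩
  -- A refuting choice of the universal variables induces a consistent falsifying assignment. Some
  -- sort handles it, but the values of the terms realise it there, contrary to the sentence
  -- satisfied by `N i`.
  by_contra hfalse
  have hoff : ∀ v : Var k, v.code ∉ univs n → ρ₂ v = glueValuation N hm n γ ρ v :=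
    fun v hv => hρ₂ v fun h => hv ((mem_univs_iff hφ.1 v).2 h)
  obtain ⟨a, ha, hval⟩ := exists_assignment n (nodeVal (glue N hm) ρ₂ (label N hm ρ₂))
    (fun p hp => nodeVal_lt (by unfold base; omega)
      fun σ t ht => label_lt N hm hmn ρ₂ (ht ▸ hp))
  have hval' : ∀ p ∈ nodes n, val n a p = nodeVal (glue N hm) ρ₂ (label N hm ρ₂) p :=
    fun p hp => hval p (lt_of_mem_nodes hp)
  have hterm : ∀ {τ : Srt k} {t : Term S τ}, t.node ∈ nodes n →
      val n a t.node = label N hm ρ₂ τ (t.eval _ ρ₂) := fun ht => by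
    rw [hval' _ ht, nodeVal_term]
  have hform : ∀ {ψ : Formula S}, ψ.node ∈ nodes n →
      (val n a ψ.node ≠ 0 ↔ ψ.MatrixHolds _ ρ₂) := fun hψ => by
    rw [hval' _ hψ, nodeVal_formula]
  -- Existential functions and relations have foreground arguments only, whose labels are their
  -- values under `a`. So the glued valuation reads exactly the table entry named by the key of the
  -- node.
  have hfg : ∀ {w : List (Srt k)} {args : ∀ j : Fin w.length, Term S (w.get j)},
      (∀ τ ∈ w, τ = 0) → (∀ j, (args j).node ∈ nodes n) →
      (List.ofFn fun j => fgLabel N _ ((args j).eval (glue N hm) ρ₂)) =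
        List.ofFn fun j => val n a (args j).node := by
    intro w args hw hargs
    congr 1
    funext j
    rw [hterm (hargs j), label, if_pos (hw _ (List.get_mem w j))]
  have hcons : Consistent n γ a := by
    refine consistent_of_val_eq (fun σ s t _ _ => label_injective N hm ρ₂ s t) hval' ?_ ?_ ?_
    · intro x
      rw [label, if_pos rfl]
      exact (show ULift (Fin (fgSize γ)) from x).down.isLt
    · intro c hc
      have := hoff _ hc
      rw [label, if_pos rfl, foVal, this]
      rfl
    · intro w c args hmem hc
      have h₁ := hoff _ hc
      have hw : ∀ τ ∈ w, τ = 0 := isExistential_of_not_mem_univs hφ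
        (atomVars_subset_of_mem_nodes hmem (Or.inl rfl)) hc
      rw [key_rapp, ← hfg hw (arg_mem_nodes_rapp hmem)]
      simp only [Formula.MatrixHolds, h₁]
      rfl
  have hroot : val n a (2 * n + 1) = 0 := by
    have : (2 * n + 1) = φ.node := rfl
    rw [this]
    exact not_not.1 fun h => hfalse ((hform (root_mem_nodes n)).1 h)
  obtain ⟨s, hs, hh⟩ := hcov a (List.mem_range.2 ha) hcons hroot
  let i : Fin k := ⟨s, List.mem_range.1 hs⟩
  -- Each node variable of the sort takes the actual value of its term in the glued structure.
  refine hN i (nodeValuation N hm n ρ₂ i (ρ i)) (fun v hv => nodeValuation_of_ne N hm ρ₂ i _ hv)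
    a ha hh hcons fun p hp => ⟨⟨?_, ?_, ?_⟩, fun q hq => ?_⟩
  · rintro w f args rfl
    have hw := (hS.1 _ _ ⟨f⟩).2
    rw [nodeValuation_term N hm ρ₂ i _ rfl hp, Term.eval]
    refine ((glueIso N hm i).map_func f _ hw).trans ?_
    congr 1
    funext j
    exact (nodeValuation_term N hm ρ₂ i _ (hw _ (List.get_mem w j)) (arg_mem_nodes_app hp j)).symm
  · rintro w R args hw rfl
    rw [hform hp, Formula.MatrixHolds, (glueIso N hm i).map_rel R _ hw]
    refine iff_of_eq ?_
    congr 1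
    funext j
    exact nodeValuation_term N hm ρ₂ i _ (hw _ (List.get_mem w j)) (arg_mem_nodes_ratom hp j)
  · intro hex hsort
    -- Key variables have odd names and node variables even ones, so the values of the keys are
    -- untouched.
    have hodd : ∀ x, foVal (nodeValuation N hm n ρ₂ i (ρ i)) i.succ (2 * x + 1) =
        foVal (ρ i) i.succ (2 * x + 1) := by
      intro x
      refine nodeValuation_of_ne N hm ρ₂ i _ ?_
      rintro ⟨p, -, hp⟩
      simp only [Var.fo.injEq, true_and] at hp
      omega
    rw [hodd]
    rcases isSubNode_of_mem_nodes hp with ⟨τ, t, rfl, hvars⟩ | ⟨ψ, rfl, -⟩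
    · rw [sortOf_node] at hsort
      obtain rfl : τ = i.succ := Fin.ext hsort
      refine (nodeValuation_succ N hm ρ₂ i _ hp).trans ?_
      cases t with
      | var _ c =>
        rw [key_var]
        exact hoff _ (isEx_var_iff.1 hex)
      | app => have := hex.1; rw [tag_app] at this; omega
      | fapp w _ c args =>
        have h₁ := hoff _ (isEx_fapp_iff.1 hex)
        have hw := (isExistential_of_not_mem_univs hφ (hvars (Or.inl rfl))
          (isEx_fapp_iff.1 hex)).1
        rw [key_fapp, ← hfg hw (arg_mem_nodes_fapp hp)]
        exact congrFun h₁ fun j => (args j).eval (glue N hm) ρ₂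
    · cases ψ with
      | rapp => simp [sortOf, tag_rapp] at hsort
      | bot => have := hex.1; rw [tag_bot] at this; omega
      | imp => have := hex.1; rw [tag_imp] at this; omega
      | eq => have := hex.1; rw [tag_eq] at this; omega
      | ratom => have := hex.1; rw [tag_ratom] at this; omega
      | ex => have := hex.1; rw [tag_ex] at this; omega
      | all => have := hex.1; rw [tag_all] at this; omega
  · intro hp₁ hp₂ hq₁ hq₂
    have real : ∀ r ∈ nodes n, tag r ≤ 2 → sortOf r = i.succ →
        ∃ t : Term S i.succ, r = t.node := by
      intro r hr h₁ h₂
      rcases isSubNode_of_mem_nodes hr with ⟨τ, t, rfl, -⟩ | ⟨ψ, rfl, -⟩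
      · rw [sortOf_node] at h₂
        obtain rfl : τ = i.succ := Fin.ext h₂
        exact ⟨t, rfl⟩
      · have := lt_tag_node ψ
        omega
    obtain ⟨s, rfl⟩ := real p hp hp₁ hp₂
    obtain ⟨t, rfl⟩ := real q hq hq₁ hq₂
    rw [nodeValuation_succ N hm ρ₂ i _ hp, nodeValuation_succ N hm ρ₂ i _ hq, hterm hp, hterm hq]
    exact ⟨fun h => congrArg _ h, label_injective N hm ρ₂ s t⟩

end Soundness

/-! ### From a model to a successful guess -/

section Completeness

open Classical Encodable

/-- The distinct values among `f 0, …, f n` are listed. At least one value is always present, so the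
guessed foreground is nonempty even without existential foreground variables. -/
theorem exists_enumeration {A : Type u} (f : ℕ → A) (n : ℕ) :
    ∃ (m : ℕ) (e : ℕ → A), 0 < m ∧ m ≤ n + 1 ∧ (∀ b < m, ∀ b' < m, e b = e b' → b = b') ∧
      ∀ c ≤ n, ∃ b < m, e b = f c := by
  let s : Finset A := (Finset.range (n + 1)).image f
  have hs : ∀ c ≤ n, f c ∈ s := fun c hc =>
    Finset.mem_image_of_mem f (Finset.mem_range.2 (by omega))
  have hpos : 0 < s.card := Finset.card_pos.2 ⟨f 0, hs 0 (Nat.zero_le n)⟩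
  let e := s.equivFin
  refine ⟨s.card, fun b => if h : b < s.card then (e.symm ⟨b, h⟩ : A) else f 0, hpos,
    Finset.card_image_le.trans (by simp), fun b hb b' hb' h => ?_, fun c hc => ?_⟩
  · simp only [dif_pos hb, dif_pos hb'] at h
    simpa using e.symm.injective (Subtype.ext h)
  · refine ⟨e ⟨f c, hs c hc⟩, (e ⟨f c, hs c hc⟩).isLt, ?_⟩
    simp only [dif_pos (e ⟨f c, hs c hc⟩).isLt]
    simp

theorem pair_le_pair {a a' b b' : ℕ} (ha : a ≤ a') (hb : b ≤ b') :
    Nat.pair a b ≤ Nat.pair a' b' := by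
  rcases ha.lt_or_eq with ha | rfl
  · rcases hb.lt_or_eq with hb | rfl
    · exact ((Nat.pair_lt_pair_left b ha).trans (Nat.pair_lt_pair_right a' hb)).le
    · exact (Nat.pair_lt_pair_left b ha).le
  · rcases hb.lt_or_eq with hb | rfl
    · exact (Nat.pair_lt_pair_right a hb).le
    · exact le_rfl

variable {k : ℕ}

/-- There is a guess with given foreground size, given values of the existential foreground and
relation variables, and a given set of pairs of an assignment and a sort that handles it. -/
theorem exists_guess (k n m : ℕ) (hm : m ≤ n + 1) (f : ℕ → ℕ) (hf : ∀ x, f x < base n)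
    (P : ℕ → ℕ → Prop) :
    ∃ γ < numGuess k n, fgSize γ = m ∧ (∀ x ∈ keys n, fgVal n γ x = f x) ∧
      ∀ a < numAssign n, ∀ s ≤ k, Handles k γ a s ↔ P a s := by
  -- The sum of all keys bounds each of them, so this many digits have a place for every key.
  obtain ⟨g, hg, hgf⟩ := exists_digits ((keys n).sum + 1) f fun j _ => hf j
  -- The bit for assignment `a` and sort `s ≤ k` sits at place `a * (k + 1) + s`, from which
  -- division by `k + 1` recovers both.
  obtain ⟨h, hh, hhP⟩ := exists_digits (B := 2) (numAssign n * (k + 1))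
    (fun j => if P (j / (k + 1)) (j % (k + 1)) then 1 else 0)
    fun j _ => by split_ifs <;> omega
  refine ⟨Nat.pair m (Nat.pair g h), ?_, ?_, fun x hx => ?_, fun a ha s hs => ?_⟩
  · exact Nat.lt_succ_of_le (pair_le_pair (by omega) (pair_le_pair hg.le hh.le))
  · simp [fgSize]
  · simp only [fgVal, Nat.unpair_pair]
    exact hgf x (Nat.lt_succ_of_le (List.le_sum_of_mem hx))
  · have hlt : a * (k + 1) + s < numAssign n * (k + 1) :=
      calc a * (k + 1) + s < a * (k + 1) + (k + 1) := by omega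
        _ = (a + 1) * (k + 1) := by ring
        _ ≤ numAssign n * (k + 1) := Nat.mul_le_mul_right _ ha
    have h₁ : (a * (k + 1) + s) / (k + 1) = a := by
      rw [mul_comm, Nat.mul_add_div (by omega), Nat.div_eq_of_lt (by omega), add_zero]
    have h₂ : (a * (k + 1) + s) % (k + 1) = s := by
      rw [mul_comm, Nat.mul_add_mod, Nat.mod_eq_of_lt (by omega)]
    simp only [Handles, Nat.unpair_pair, hhP _ hlt, h₁, h₂]
    split_ifs with hP <;> simp [hP]

variable {S : Signature k}

/-- A foreground element given by its label, as an element of a universe of any sort. -/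
noncomputable def ofLabel (M : Model.{u} S) (e : ℕ → M.carrier 0) (τ : Srt k) (b : ℕ) :
    M.carrier τ :=
  if h : 0 = τ then h ▸ e b else (M.nonempty τ).some

/-- The value of an existential background variable at the labels encoded in a key. -/
noncomputable def keyValue (M : Model.{u} S) (ρ : Valuation M.carrier) (e : ℕ → M.carrier 0)
    (τ : Srt k) (x : ℕ) : M.carrier τ :=
  if h : ∃ c, x = Nat.pair (Var.fo τ c).code (encode ([] : List ℕ)) then foVal ρ τ h.choose
  else if h : ∃ y : List (Srt k) × ℕ × List ℕ,
      x = Nat.pair (Nat.pair 2 (Nat.pair (encode (y.1, τ)) y.2.1)) (encode y.2.2) then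
    (show Tuple M.carrier h.choose.1 → M.carrier τ from ρ (.fn h.choose.1 τ h.choose.2.1))
      fun j => ofLabel M e _ (h.choose.2.2.getD j 0)
  else (M.nonempty τ).some

theorem keyValue_var (M : Model.{u} S) (ρ : Valuation M.carrier) (e : ℕ → M.carrier 0)
    (τ : Srt k) (c : ℕ) :
    keyValue M ρ e τ (Nat.pair (Var.fo τ c).code (encode ([] : List ℕ))) = foVal ρ τ c := by
  have h : ∃ c', Nat.pair (Var.fo τ c).code (encode ([] : List ℕ)) =
      Nat.pair (Var.fo τ c').code (encode ([] : List ℕ)) := ⟨c, rfl⟩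
  have h₁ : c = h.choose := by
    have := Var.code_injective (Nat.pair_eq_pair.1 h.choose_spec).1
    simpa using this
  rw [keyValue, dif_pos h, ← h₁]

theorem keyValue_fn (M : Model.{u} S) (ρ : Valuation M.carrier) (e : ℕ → M.carrier 0)
    (τ : Srt k) (w : List (Srt k)) (c : ℕ) (l : List ℕ) :
    keyValue M ρ e τ (Nat.pair (Nat.pair 2 (Nat.pair (encode (w, τ)) c)) (encode l)) =
      (show Tuple M.carrier w → M.carrier τ from ρ (.fn w τ c))
        fun j => ofLabel M e _ (l.getD j 0) := by
  have h₀ : ¬ ∃ c', Nat.pair (Nat.pair 2 (Nat.pair (encode (w, τ)) c)) (encode l) =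
      Nat.pair (Var.fo τ c').code (encode ([] : List ℕ)) := by
    rintro ⟨c', h⟩
    have := (Nat.pair_eq_pair.1 h).1
    simp [Var.code, Nat.pair_eq_pair] at this
  have h : ∃ y : List (Srt k) × ℕ × List ℕ,
      Nat.pair (Nat.pair 2 (Nat.pair (encode (w, τ)) c)) (encode l) =
      Nat.pair (Nat.pair 2 (Nat.pair (encode (y.1, τ)) y.2.1)) (encode y.2.2) := ⟨(w, c, l), rfl⟩
  have h₁ : h.choose = (w, c, l) := by
    have := h.choose_spec
    generalize h.choose = y at this ⊢
    simp only [Nat.pair_eq_pair, encode_inj, Prod.mk.injEq, true_and, and_true] at this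
    obtain ⟨⟨ha, hb⟩, hc⟩ := this
    exact Prod.ext ha.symm (Prod.ext hb.symm hc.symm)
  rw [keyValue, dif_neg h₀, dif_pos h, h₁]

/-- The truth of an existential relation variable at the labels encoded in a key. -/
def KeyTrue (M : Model.{u} S) (ρ : Valuation M.carrier) (e : ℕ → M.carrier 0) (x : ℕ) : Prop :=
  ∃ (w : List (Srt k)) (c : ℕ) (l : List ℕ),
    x = Nat.pair (Nat.pair 7 (Nat.pair (encode w) c)) (encode l) ∧
    (show Tuple M.carrier w → Prop from ρ (.rel w c)) fun j => ofLabel M e _ (l.getD j 0)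

theorem keyTrue_rel (M : Model.{u} S) (ρ : Valuation M.carrier) (e : ℕ → M.carrier 0)
    (w : List (Srt k)) (c : ℕ) (l : List ℕ) :
    KeyTrue M ρ e (Nat.pair (Nat.pair 7 (Nat.pair (encode w) c)) (encode l)) ↔
      (show Tuple M.carrier w → Prop from ρ (.rel w c))
        fun j => ofLabel M e _ (l.getD j 0) := by
  constructor
  · rintro ⟨w', c', l', h, hρ⟩
    simp only [Nat.pair_eq_pair, encode_inj, true_and] at h
    obtain ⟨⟨rfl, rfl⟩, rfl⟩ := h
    exact hρ
  · exact fun h => ⟨w, c, l, rfl, h⟩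

/-- The number that the guess for a structure stores for a key. -/
noncomputable def keyLabel (M : Model.{u} S) (ρ : Valuation M.carrier) (e : ℕ → M.carrier 0)
    (m : ℕ) (x : ℕ) : ℕ :=
  if h : ∃ y : ℕ × ℕ, x = Nat.pair (Var.fo (k := k) 0 y.1).code (encode ([] : List ℕ)) ∧
      y.2 < m ∧ e y.2 = foVal ρ 0 y.1 then h.choose.2
  else if KeyTrue M ρ e x then 1 else 0

theorem keyLabel_lt {M : Model.{u} S} {ρ : Valuation M.carrier} {e : ℕ → M.carrier 0} {m n : ℕ}
    (hm : m ≤ n + 1) (x : ℕ) : keyLabel M ρ e m x < base n := by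
  unfold keyLabel base
  split_ifs with h
  · have := h.choose_spec.2.1
    omega
  · omega
  · omega

theorem keyLabel_var {M : Model.{u} S} {ρ : Valuation M.carrier} {e : ℕ → M.carrier 0} {m c : ℕ}
    (hc : ∃ b < m, e b = foVal ρ 0 c) :
    keyLabel M ρ e m (Nat.pair (Var.fo (k := k) 0 c).code (encode ([] : List ℕ))) < m ∧
      e (keyLabel M ρ e m (Nat.pair (Var.fo (k := k) 0 c).code (encode ([] : List ℕ)))) =
        foVal ρ 0 c := by
  obtain ⟨b, hb, hbc⟩ := hc
  have h : ∃ y : ℕ × ℕ, Nat.pair (Var.fo (k := k) 0 c).code (encode ([] : List ℕ)) =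
      Nat.pair (Var.fo (k := k) 0 y.1).code (encode ([] : List ℕ)) ∧
      y.2 < m ∧ e y.2 = foVal ρ 0 y.1 := ⟨(c, b), rfl, hb, hbc⟩
  have h₁ : c = h.choose.1 := by
    have := Var.code_injective (Nat.pair_eq_pair.1 h.choose_spec.1).1
    simpa using this
  rw [keyLabel, dif_pos h]
  refine ⟨h.choose_spec.2.1, ?_⟩
  conv_rhs => rw [h₁]
  exact h.choose_spec.2.2

theorem keyLabel_rel {M : Model.{u} S} {ρ : Valuation M.carrier} {e : ℕ → M.carrier 0} {m : ℕ}
    (w : List (Srt k)) (c : ℕ) (l : List ℕ) :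
    keyLabel M ρ e m (Nat.pair (Nat.pair 7 (Nat.pair (encode w) c)) (encode l)) ≠ 0 ↔
      KeyTrue M ρ e (Nat.pair (Nat.pair 7 (Nat.pair (encode w) c)) (encode l)) := by
  have h₀ : ¬ ∃ y : ℕ × ℕ, Nat.pair (Nat.pair 7 (Nat.pair (encode w) c)) (encode l) =
      Nat.pair (Var.fo (k := k) 0 y.1).code (encode ([] : List ℕ)) ∧
      y.2 < m ∧ e y.2 = foVal ρ 0 y.1 := by
    rintro ⟨y, h, -⟩
    have := (Nat.pair_eq_pair.1 h).1
    simp [Var.code, Nat.pair_eq_pair] at this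
  rw [keyLabel, dif_neg h₀]
  split_ifs with h <;> simp [h]

/-- The interpretation of the existential variables of the emitted sentences. -/
noncomputable def keyValuation (M : Model.{u} S) (ρ : Valuation M.carrier)
    (e : ℕ → M.carrier 0) : Valuation M.carrier
  | .fo τ x => keyValue M ρ e τ (x / 2)
  | .fn w τ c => ρ (.fn w τ c)
  | .rel w c => ρ (.rel w c)

theorem foVal_keyValuation (M : Model.{u} S) (ρ : Valuation M.carrier) (e : ℕ → M.carrier 0)
    (τ : Srt k) (x : ℕ) :
    foVal (keyValuation M ρ e) τ (2 * x + 1) = keyValue M ρ e τ x := by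
  change keyValue M ρ e τ ((2 * x + 1) / 2) = _
  congr 1
  omega

variable [∀ w σ, Encodable (S.Func w σ)] [∀ w, Encodable (S.Rel w)]

/-- The universal variables, interpreted by given values `V` of the nodes, where `a` gives the
truth values of the atoms. -/
noncomputable def universalValuation (M : Model.{u} S) (ρ : Valuation M.carrier) (n a : ℕ)
    (V : ∀ τ, ℕ → M.carrier τ) (v : Var k) : v.Domain M.carrier :=
  if v.code ∈ univs n then
    match v with
    | .fo τ c => V τ (Term.var (S := S) τ c).node
    | .fn w τ c => fun x : Tuple M.carrier w =>
        if h : ∃ args : ∀ j : Fin w.length, Term S (w.get j),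
            (Term.fapp w τ c args).node ∈ nodes n ∧ ∀ j, V _ (args j).node = x j then
          V τ (Term.fapp w τ c h.choose).node
        else (M.nonempty τ).some
    | .rel w c => fun x : Tuple M.carrier w =>
        ∃ args : ∀ j : Fin w.length, Term S (w.get j),
          (Formula.rapp w c args).node ∈ nodes n ∧ (∀ j, V _ (args j).node = x j) ∧
            val n a (Formula.rapp w c args).node ≠ 0
  else ρ v

/-! ### Evaluating the matrix at prescribed node values -/

section MatrixEvaluation

variable {M : Model.{u} S} {ρ : Valuation M.carrier} {e : ℕ → M.carrier 0} {a γ : ℕ}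
  {V : ∀ τ, ℕ → M.carrier τ} {φ : Formula S}

/-- A universal function is defined through those of its applications that are nodes; the congruence
clause of consistency and `hV` make the choice of arguments irrelevant. An existential function has
foreground arguments, which `e` recovers from their labels, so its value is the one stored at the
key. -/
theorem eval_universalValuation (hφ : φ ∈ eqsmtSentences S) (hcons : Consistent φ.code γ a)
    (hV : ∀ (τ : Srt k) (s t : Term S τ), s.node ∈ nodes φ.code → t.node ∈ nodes φ.code →
      (V τ s.node = V τ t.node ↔ val φ.code a s.node = val φ.code a t.node))
    (hV₀ : ∀ p, V 0 p = e (val φ.code a p))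
    (happ : ∀ (w : List (Srt k)) (τ : Srt k) (f : S.Func w τ) args,
      (Term.app f args).node ∈ nodes φ.code →
      V τ (Term.app f args).node = M.func f fun j => V _ (args j).node)
    (hvar : ∀ (τ : Srt k) c, (Term.var (S := S) τ c).node ∈ nodes φ.code →
      (Var.fo τ c).code ∉ univs φ.code → V τ (Term.var (S := S) τ c).node = foVal ρ τ c)
    (hfn : ∀ (w : List (Srt k)) (τ : Srt k) c (args : ∀ j : Fin w.length, Term S (w.get j)),
      τ ≠ 0 → (Term.fapp w τ c args).node ∈ nodes φ.code → (Var.fn w τ c).code ∉ univs φ.code →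
      V τ (Term.fapp w τ c args).node = keyValue M ρ e τ (key φ.code a (Term.fapp w τ c args).node))
    {τ : Srt k} (t : Term S τ) (ht : t.node ∈ nodes φ.code) :
    t.eval M (universalValuation M ρ φ.code a V) = V τ t.node := by
  induction t with
  | var τ c =>
    change universalValuation M ρ φ.code a V (.fo τ c) = _
    by_cases hu : (Var.fo τ c).code ∈ univs φ.code
    · exact if_pos hu
    · exact (if_neg hu).trans (hvar τ c ht hu).symm
  | app f args ih =>
    rw [happ _ _ f args ht, Term.eval]
    congr 1
    funext j
    exact ih j (arg_mem_nodes_app ht j)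
  | fapp w τ c args ih =>
    have hargs : (fun j => (args j).eval M (universalValuation M ρ φ.code a V)) =
        fun j => V _ (args j).node := funext fun j => ih j (arg_mem_nodes_fapp ht j)
    rw [Term.eval, hargs]
    by_cases hu : (Var.fn w τ c).code ∈ univs φ.code
    · have h₁ : universalValuation M ρ φ.code a V (.fn w τ c) = _ := if_pos hu
      rw [h₁]
      have h : ∃ args' : ∀ j : Fin w.length, Term S (w.get j),
          (Term.fapp w τ c args').node ∈ nodes φ.code ∧
            ∀ j, V (w.get j) (args' j).node = V (w.get j) (args j).node := ⟨args, ht, fun _ => rfl⟩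
      refine (dif_pos h).trans ?_
      have hmem := h.choose_spec.1
      have hv := h.choose_spec.2
      generalize h.choose = args' at hmem hv
      refine (hV τ _ _ hmem ht).2 ?_
      refine (hcons _ ht).2.1 (Or.inl (tag_fapp _)) _ hmem ?_
      rw [key_fapp, key_fapp]
      congr 3
      funext j
      exact (hV _ _ _ (arg_mem_nodes_fapp hmem j) (arg_mem_nodes_fapp ht j)).1 (hv j)
    · have h₁ : universalValuation M ρ φ.code a V (.fn w τ c) = _ := if_neg hu
      have hex : (Var.fn w τ c).IsExistential := isExistential_of_not_mem_univs hφ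
        (vars_subset_of_mem_nodes ht (Or.inl rfl)) hu
      rw [h₁, hfn w τ c args hex.2 ht hu, key_fapp, keyValue_fn]
      refine congrArg (show Tuple M.carrier w → M.carrier τ from ρ (.fn w τ c)) ?_
      funext j
      have hj : 0 = w.get j := (hex.1 _ (List.get_mem w j)).symm
      rw [ofLabel, dif_pos hj]
      have hget : (List.ofFn fun j => val φ.code a (args j).node).getD j 0 =
          val φ.code a (args j).node := by simp
      rw [hget, ← hV₀]
      generalize (args j).node = p
      generalize w.get j = υ at hj
      subst hj
      rfl

/-- By induction on subformulas, each connective uses its clause of consistency. Atoms of universal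
relations agree with `a` by congruence, those of existential relations by the stored table. -/
theorem matrixHolds_universalValuation (hφ : φ ∈ eqsmtSentences S)
    (hcons : Consistent φ.code γ a)
    (hV : ∀ (τ : Srt k) (s t : Term S τ), s.node ∈ nodes φ.code → t.node ∈ nodes φ.code →
      (V τ s.node = V τ t.node ↔ val φ.code a s.node = val φ.code a t.node))
    (hV₀ : ∀ p, V 0 p = e (val φ.code a p))
    (heval : ∀ (τ : Srt k) (t : Term S τ), t.node ∈ nodes φ.code →
      t.eval M (universalValuation M ρ φ.code a V) = V τ t.node)
    (hratom : ∀ (w : List (Srt k)) (R : S.Rel w) args,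
      (Formula.ratom R args).node ∈ nodes φ.code →
      ((M.rel R fun j => V _ (args j).node) ↔ val φ.code a (Formula.ratom R args).node ≠ 0))
    (hrel : ∀ (w : List (Srt k)) c (args : ∀ j : Fin w.length, Term S (w.get j)),
      (Formula.rapp w c args).node ∈ nodes φ.code → (Var.rel w c).code ∉ univs φ.code →
      (val φ.code a (Formula.rapp w c args).node ≠ 0 ↔
        KeyTrue M ρ e (key φ.code a (Formula.rapp w c args).node)))
    (ψ : Formula S) (hψ : ψ.node ∈ nodes φ.code) :
    ψ.MatrixHolds M (universalValuation M ρ φ.code a V) ↔ val φ.code a ψ.node ≠ 0 := by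
  induction ψ with
  | bot =>
    have := (hcons _ hψ).2.2.1 tag_bot
    simp [Formula.MatrixHolds, this]
  | imp ψ χ ih₁ ih₂ =>
    have h := (hcons _ hψ).2.2.2.1 (tag_imp ψ χ)
    rw [children_imp] at h
    rw [h]
    exact imp_congr (ih₁ (child_mem_nodes hψ (by rw [children_imp]; simp)))
      (ih₂ (child_mem_nodes hψ (by rw [children_imp]; simp)))
  | eq s t =>
    have h := (hcons _ hψ).2.2.2.2.1 (tag_eq s t)
    rw [children_eq] at h
    have hs : s.node ∈ nodes φ.code := child_mem_nodes hψ (by rw [children_eq]; simp)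
    have ht : t.node ∈ nodes φ.code := child_mem_nodes hψ (by rw [children_eq]; simp)
    rw [h, Formula.MatrixHolds, heval _ s hs, heval _ t ht]
    exact hV _ s t hs ht
  | ratom R args =>
    rw [← hratom _ R args hψ, Formula.MatrixHolds]
    simp only [heval _ _ (arg_mem_nodes_ratom hψ _)]
  | rapp w c args =>
    have hargs : (fun j => (args j).eval M (universalValuation M ρ φ.code a V)) =
        fun j => V _ (args j).node := funext fun j => heval _ _ (arg_mem_nodes_rapp hψ j)
    rw [Formula.MatrixHolds, hargs]
    by_cases hu : (Var.rel w c).code ∈ univs φ.code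
    · have h₁ : universalValuation M ρ φ.code a V (.rel w c) = _ := if_pos hu
      rw [h₁]
      constructor
      · rintro ⟨args', hmem, hv, hval⟩
        have h := (hcons _ hψ).2.1 (Or.inr (tag_rapp _)) _ hmem (by
          rw [key_rapp, key_rapp]
          congr 3
          funext j
          exact (hV _ _ _ (arg_mem_nodes_rapp hmem j) (arg_mem_nodes_rapp hψ j)).1 (hv j))
        rwa [← h]
      · exact fun h => ⟨args, hψ, fun _ => rfl, h⟩
    · have h₁ : universalValuation M ρ φ.code a V (.rel w c) = _ := if_neg hu
      have hex : (Var.rel w c).IsExistential := isExistential_of_not_mem_univs hφ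
        (atomVars_subset_of_mem_nodes hψ (Or.inl rfl)) hu
      rw [h₁, hrel w c args hψ hu, key_rapp, keyTrue_rel]
      refine iff_of_eq (congrArg (show Tuple M.carrier w → Prop from ρ (.rel w c)) ?_)
      funext j
      have hj : 0 = w.get j := (hex _ (List.get_mem w j)).symm
      rw [ofLabel, dif_pos hj]
      have hget : (List.ofFn fun j => val φ.code a (args j).node).getD j 0 =
          val φ.code a (args j).node := by simp
      rw [hget, ← hV₀]
      generalize (args j).node = p
      generalize w.get j = υ at hj
      subst hj
      rfl
  | ex v ψ ih =>
    have h := (hcons _ hψ).2.2.2.2.2.1 (Or.inl (tag_ex v ψ))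
    rw [children_ex] at h
    rw [h]
    exact ih (child_mem_nodes hψ (by rw [children_ex]; simp))
  | all v ψ ih =>
    have h := (hcons _ hψ).2.2.2.2.2.1 (Or.inr (tag_all v ψ))
    rw [children_all] at h
    rw [h]
    exact ih (child_mem_nodes hψ (by rw [children_all]; simp))

end MatrixEvaluation

/-- If the EQSMT sentence is satisfiable, then some guess passes the test and the answers to its
calls are positive. -/
theorem exists_covers_of_satisfies (hS : S.IsPure) {φ : Formula S} (hφ : φ ∈ eqsmtSentences S)
    {M : Model.{u} S} (hM : M.Satisfies φ) :
    ∃ γ < numGuess k φ.code, Covers k φ.code γ ∧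
      ∀ (i : Fin k) (χ : Formula S), χ.code = codeCall k φ.code γ (i + 1) → M.Satisfies χ := by
  obtain ⟨ρ, hρ⟩ := (hφ.1.satisfies_iff hφ.2 M).1 hM
  set n := φ.code with hn
  obtain ⟨m, e, hm, hmn, he, hsurj⟩ := exists_enumeration (foVal ρ 0) n
  -- The guess lets sort `i` handle `a` exactly when no node values in `M` realise `a` there. The
  -- emitted sentences then hold in `M` by construction, and only covering needs an argument.
  let Refutes (a : ℕ) (i : Fin k) : Prop := ∀ ρ' : Valuation M.carrier,
    (∀ v, v ∉ nodeVars n i.succ → ρ' v = keyValuation M ρ e v) →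
    ¬ ∀ p ∈ nodes n, Describes n a p i.succ M ρ' ∧ ∀ q ∈ nodes n, Compares n a p q i.succ ρ'
  obtain ⟨γ, hγ, hsize, hfg, hhandles⟩ := exists_guess k n m hmn (keyLabel M ρ e m)
    (keyLabel_lt hmn) fun a s => ∃ i : Fin k, s = i + 1 ∧ Refutes a i
  have hhandles' : ∀ a < numAssign n, ∀ i : Fin k, Handles k γ a (i + 1) ↔ Refutes a i := by
    intro a ha i
    rw [hhandles a ha (i + 1) i.isLt]
    constructor
    · rintro ⟨i', h, hr⟩
      obtain rfl : i = i' := Fin.ext (by omega)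
      exact hr
    · exact fun h => ⟨i, rfl, h⟩
  refine ⟨γ, hγ, ⟨hsize ▸ hm, hsize ▸ hmn, fun a ha hcons hroot => ?_⟩, fun i χ hχ => ?_⟩
  swap
  · obtain ⟨χ', -, hc', hsem⟩ := exists_codeCall.{u} hS (Fin.succ_ne_zero i) φ γ
    obtain rfl : χ = χ' := Formula.code_injective (hχ.trans hc'.symm)
    exact (hsem M).2 ⟨keyValuation M ρ e, fun ρ' hρ' a ha hh _ => (hhandles' a ha i).1 hh ρ' hρ'⟩
  rw [List.mem_range] at ha
  by_contra hno
  -- If no sort refutes `a`, each sort realises it. The realisations are independent and combine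
  -- into one interpretation of the universal variables under which the matrix has the truth value
  -- given by `a`, which is false.
  have hno' : ∀ i : Fin k, ¬ Refutes a i := fun i h =>
    hno ⟨i, List.mem_range.2 i.isLt, (hhandles' a ha i).2 h⟩
  have hex : ∀ i : Fin k, ∃ ρ' : Valuation M.carrier,
      (∀ v, v ∉ nodeVars n i.succ → ρ' v = keyValuation M ρ e v) ∧
      ∀ p ∈ nodes n, Describes n a p i.succ M ρ' ∧ ∀ q ∈ nodes n, Compares n a p q i.succ ρ' := by
    intro i
    by_contra hc
    exact hno' i fun ρ' h₁ h₂ => hc ⟨ρ', h₁, h₂⟩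
  choose ζ hζ₀ hζ using hex
  have hkey : ∀ (i : Fin k) x, foVal (ζ i) i.succ (2 * x + 1) = keyValue M ρ e i.succ x := by
    intro i x
    rw [← foVal_keyValuation]
    refine hζ₀ i _ ?_
    rintro ⟨p, -, hp⟩
    simp only [Var.fo.injEq, true_and] at hp
    omega
  -- Foreground nodes take the enumerated element numbered by their value. The foreground of `M`
  -- need not be shrunk.
  let V : ∀ τ, ℕ → M.carrier τ := fun τ p =>
    Fin.cases (motive := fun τ => M.carrier τ) (e (val n a p))
      (fun i => foVal (ζ i) i.succ (2 * p)) τ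
  have hVsucc : ∀ (i : Fin k) (τ : Srt k), τ = i.succ → ∀ p, V τ p = foVal (ζ i) τ (2 * p) := by
    rintro i τ rfl p
    rfl
  have hV : ∀ (τ : Srt k) (s t : Term S τ), s.node ∈ nodes n → t.node ∈ nodes n →
      (V τ s.node = V τ t.node ↔ val n a s.node = val n a t.node) := by
    intro τ s t hs ht
    induction τ using Fin.cases with
    | zero =>
      have h₁ := (hcons _ hs).1 (tag_node_le s) (sortOf_node s)
      have h₂ := (hcons _ ht).1 (tag_node_le t) (sortOf_node t)
      rw [hsize] at h₁ h₂
      exact ⟨he _ h₁ _ h₂, fun h => congrArg e h⟩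
    | succ i =>
      exact (hζ i _ hs).2 _ ht (tag_node_le s) (sortOf_node s) (tag_node_le t) (sortOf_node t)
  have hV₀ : ∀ p, V 0 p = e (val n a p) := fun p => rfl
  have heval : ∀ (τ : Srt k) (t : Term S τ), t.node ∈ nodes n →
      t.eval M (universalValuation M ρ n a V) = V τ t.node := by
    intro τ t ht
    refine eval_universalValuation (e := e) hφ hcons hV hV₀ ?_ ?_ ?_ t ht
    · intro w τ f args hf
      obtain ⟨hτ, hw⟩ := hS.1 _ _ ⟨f⟩
      obtain ⟨i, rfl⟩ := Fin.exists_succ_eq.2 hτ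
      refine ((hζ i _ hf).1.1 w f args rfl).trans ?_
      congr 1
      funext j
      exact (hVsucc i _ (hw _ (List.get_mem w j)) _).symm
    · intro τ c hc hu
      induction τ using Fin.cases with
      | zero =>
        -- The name of a variable is at most the Gödel number of a formula in which it occurs, so
        -- its value is among the enumerated elements.
        have hcn : c ≤ n := by
          have h₁ := lt_of_mem_nodes hc
          have h₂ : (Term.var (S := S) 0 c).node =
              2 * Nat.pair 0 (Nat.pair (encode (0 : Srt k)) c) := rfl
          have h₃ := Nat.right_le_pair (encode (0 : Srt k)) c
          have h₄ := Nat.right_le_pair 0 (Nat.pair (encode (0 : Srt k)) c)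
          omega
        obtain ⟨h₁, h₂⟩ := keyLabel_var (hsurj c hcn)
        have h₃ := (hcons _ hc).2.2.2.2.2.2.1 (isEx_var_iff.2 hu) tag_var (sortOf_node _)
        rw [hfg _ (key_mem_keys ha hc), key_var, hsize, Nat.mod_eq_of_lt h₁] at h₃
        rw [hV₀, h₃, h₂]
      | succ i =>
        refine ((hζ i _ hc).1.2.2 (isEx_var_iff.2 hu) (sortOf_node _)).trans ?_
        rw [hkey, key_var, keyValue_var]
    · intro w τ c args hτ hc hu
      obtain ⟨i, rfl⟩ := Fin.exists_succ_eq.2 hτ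
      exact ((hζ i _ hc).1.2.2 (isEx_fapp_iff.2 hu) (sortOf_node _)).trans (hkey i _)
  have hroot' := (matrixHolds_universalValuation (e := e) hφ hcons hV hV₀ heval ?_ ?_ φ
    (root_mem_nodes n)).1 (hρ _ fun v hv => if_neg fun h => hv ((mem_univs_iff hφ.1 v).1 h))
  · exact hroot' hroot
  · intro w R args hR
    obtain ⟨τ, hτ, hw⟩ := hS.2 _ ⟨R⟩
    obtain ⟨i, rfl⟩ := Fin.exists_succ_eq.2 hτ
    rw [← (hζ i _ hR).1.2.1 w R args hw rfl]
    refine iff_of_eq ?_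
    congr 1
    funext j
    exact hVsucc i _ (hw _ (List.get_mem w j)) _
  · intro w c args hc hu
    rw [(hcons _ hc).2.2.2.2.2.2.2 (isEx_rapp_iff.2 hu) (tag_rapp _),
      hfg _ (key_mem_keys ha hc), key_rapp, keyLabel_rel]

end Completeness

end EQSMT

/-! ### The theorem -/

theorem theorem1 {k : ℕ} (S : EQSMT.Signature k)
    [∀ w σ, Encodable (S.Func w σ)] [∀ w, Encodable (S.Rel w)] (hS : S.IsPure) :
    -- if the background theories are decidable for `∃*∀*`, then so is their union for EQSMT
    (∀ T : EQSMT.UCT S,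
      (∀ i : Fin k, EQSMT.SatDecidable.{u} (T.theory i) (EQSMT.efSentences S i.succ)) →
      EQSMT.SatDecidable.{u} T.union (EQSMT.eqsmtSentences S)) ∧
    -- one procedure does this for all background theories, by finitely many black-box calls
    -- to their solvers, each on an `∃*∀*` sentence of the respective sort
    (∃ P : EQSMT.BlackBoxProcedure k,
      (∀ φ ∈ EQSMT.eqsmtSentences S, ∀ c ∈ P.calls φ.code,
        ∃ χ ∈ EQSMT.efSentences S c.1.succ, χ.code = c.2) ∧
      ∀ (T : EQSMT.UCT S) (solver : Fin k → ℕ → Bool),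
        (∀ i : Fin k,
          EQSMT.IsSolver.{u} (T.theory i) (EQSMT.efSentences S i.succ) (solver i)) →
        EQSMT.IsSolver.{u} T.union (EQSMT.eqsmtSentences S) (P.run solver)) := by
  have hsolver : ∀ (T : EQSMT.UCT S) (solver : Fin k → ℕ → Bool),
      (∀ i : Fin k, EQSMT.IsSolver.{u} (T.theory i) (EQSMT.efSentences S i.succ) (solver i)) →
      EQSMT.IsSolver.{u} T.union (EQSMT.eqsmtSentences S) ((EQSMT.procedure k).run solver) := by
    intro T solver hs φ hφ
    rw [EQSMT.procedure_run_eq_true]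
    constructor
    · rintro ⟨γ, -, hγ, h⟩
      refine EQSMT.satisfiable_of_covers hS hφ T hγ fun i => ?_
      obtain ⟨χ, hχ, hc, -⟩ := EQSMT.exists_codeCall.{u} hS (Fin.succ_ne_zero i) φ γ
      refine ⟨χ, hχ, hc, (hs i χ hχ).1 ?_⟩
      rw [hc]
      exact h i
    · rintro ⟨M, hT, hM⟩
      obtain ⟨γ, hγ, hcov, h⟩ := EQSMT.exists_covers_of_satisfies hS hφ hM
      refine ⟨γ, hγ, hcov, fun i => ?_⟩
      obtain ⟨χ, hχ, hc, -⟩ := EQSMT.exists_codeCall.{u} hS (Fin.succ_ne_zero i) φ γ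
      -- The single structure `M` witnesses the positive answers to all calls of the guess.
      have := (hs i χ hχ).2 ⟨M, fun α hα => hT α (Set.mem_iUnion.2 ⟨i, hα⟩), h i χ hc⟩
      rwa [hc] at this
  refine ⟨fun T hT => ?_, EQSMT.procedure k, fun φ _ c hc => ?_, hsolver⟩
  · choose f hf hs using hT
    exact ⟨_, EQSMT.computable_run (EQSMT.procedure k) hf, hsolver T f hs⟩
  · obtain ⟨γ, -, hc⟩ := List.mem_flatMap.1 hc
    obtain ⟨i, -, rfl⟩ := List.mem_map.1 hc
    obtain ⟨χ, hχ, hc, -⟩ := EQSMT.exists_codeCall.{u} hS (Fin.succ_ne_zero i) φ γ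
    exact ⟨χ, hχ, hc⟩
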